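/- **Conventions.** Let $X$ be a metric space. A constant speed geodesic is a map $c:[0,1]\to X$ with $d(c(s),c(t))=|s-t|\,d(c(0),c(1))$; a subset is convex if it contains every geodesic between its points. $X$ is *Busemann non-positively curved* (BNPC) if any two points are joined by a geodesic and $t\mapsto d(c_1(t),c_2(t))$ is convex for any two constant speed geodesics $c_1,c_2$. A BNPC space is uniquely geodesic; it is *uniformly convex* if for every $\varepsilon>0$ there is $\delta>0$ such that for all $r>0$ and $x,y_1,y_2\in X$ with $d(x,y_i)\le r$ and $d(y_1,y_2)\ge \varepsilon r$, the midpoint $m$ of $y_1,y_2$ satisfies $d(x,m)\le (1-\delta)r$. A *Clifford isometry* is a surjective isometry $T:X\to X$ for which $d(x,Tx)$ is constant; $\mathrm{CL}(X)$ is the set of all of them. If $\mathrm{CL}(X)$ is a group, $X/\mathrm{CL}(X)$ is the space of its orbits, with the distance of two orbits being the infimum of the distances between their points; $\mathrm{Isom}(X)$ acts on it by isometries. For an isometric action of $\Gamma$ on $X$ and a finite $\Sigma\subset\Gamma$ put $d_\Sigma(x)=\max_{\sigma\in\Sigma}d(\sigma x,x)$; $d_\Sigma\to\infty$ means that $d_\Sigma(x)\to\infty$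 as $x$ leaves every ball. An isometric action of $\Gamma$ on $Y$ is *reduced* if there is no unbounded closed convex proper subset $C\subset Y$ that is at finite Hausdorff distance from $\gamma C$ for every $\gamma\in\Gamma$. **Theorem.** Let $G=G_1\times\dots\times G_n$, $n>1$, be a (Hausdorff) locally compact, compactly generated topological group, and let $\Gamma\le G$ be a uniform (i.e. cocompact) lattice that is irreducible, meaning that $\Gamma\cdot\prod_{j\ne i}G_j$ is dense in $G$ for each $1\le i\le n$. Let $X$ be a complete BNPC uniformly convex metric space such that $\mathrm{CL}(X)$ is a group. Suppose that $\Gamma$ acts on $X$ by isometries with $d_\Sigma\to\infty$, where $\Sigma\subset\Gamma$ is a finite generating set, and that the induced action of $\Gamma$ on $X/\mathrm{CL}(X)$ is reduced. Suppose moreover that $\Gamma$ has no global fixed point in $X/\mathrm{CL}(X)$, unless $X/\mathrm{CL}(X)$ is a single point. Then the $\Gamma$-action on $X/\mathrm{CL}(X)$ extends uniquely to a continuous isometric $G$-action, and this $G$-action factors through one of the $G_i$. -/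

import Mathlib

open Set Filter Topology

noncomputable section

/-! ### Geodesics, convexity, curvature -/

section Geometry

variable {X : Type*} [PseudoMetricSpace X]

/-- `c` restricted to `[0, 1]` is a constant speed (minimizing) geodesic. Values of `c` outside
`[0, 1]` are irrelevant. -/
def IsGeodesic (c : ℝ → X) : Prop :=
  ∀ s ∈ Icc (0 : ℝ) 1, ∀ t ∈ Icc (0 : ℝ) 1, dist (c s) (c t) = |s - t| * dist (c 0) (c 1)

/-- A set is (geodesically) convex if it contains every geodesic joining two of its points. -/
def GeodesicallyConvex (C : Set X) : Prop :=
  ∀ c : ℝ → X, IsGeodesic c → c 0 ∈ C → c 1 ∈ C → ∀ t ∈ Icc (0 : ℝ) 1, c t ∈ C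

variable (X) in
/-- Busemann non-positive curvature: `X` is geodesic, and the distance between any two constant
speed geodesics is a convex function. -/
structure IsBNPC : Prop where
  exists_geodesic : ∀ x y : X, ∃ c : ℝ → X, IsGeodesic c ∧ c 0 = x ∧ c 1 = y
  convex_dist : ∀ c₁ c₂ : ℝ → X, IsGeodesic c₁ → IsGeodesic c₂ →
    ConvexOn ℝ (Icc (0 : ℝ) 1) (fun t => dist (c₁ t) (c₂ t))

/-- `m` is a midpoint of `x` and `y` (it is unique in a uniquely geodesic space). -/
def IsMidpoint (m x y : X) : Prop :=
  dist x m = dist x y / 2 ∧ dist m y = dist x y / 2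

variable (X) in
/-- Uniform convexity: for each `ε > 0` there is `δ > 0` such that for all `r > 0` and all `x`, the
modulus of convexity
`inf {r - d(x, m) : d(x, y₁) ≤ r, d(x, y₂) ≤ r, d(y₁, y₂) ≥ ε r, m the midpoint of y₁ and y₂}`
is at least `δ r`. -/
def IsUniformlyConvex : Prop :=
  ∀ ε : ℝ, 0 < ε → ∃ δ : ℝ, 0 < δ ∧ ∀ r : ℝ, 0 < r → ∀ x y₁ y₂ m : X, IsMidpoint m y₁ y₂ →
    dist x y₁ ≤ r → dist x y₂ ≤ r → ε * r ≤ dist y₁ y₂ → δ * r ≤ r - dist x m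

end Geometry

/-! ### Isometric actions -/

section Actions

variable {Γ : Type*} [Group Γ] {X : Type*} [PseudoMetricSpace X]

/-- The displacement function `d_Σ(x) = max_{σ ∈ Σ} d(σ x, x)` (with `max ∅ = 0`). -/
def displacement (ρ : Γ →* (X ≃ᵢ X)) (S : Finset Γ) (x : X) : NNReal :=
  S.sup fun σ => nndist (ρ σ x) x

/-- `d_Σ → ∞`: the displacement tends to infinity as `x` leaves every ball. -/
def DisplacementTendsToInfinity (ρ : Γ →* (X ≃ᵢ X)) (S : Finset Γ) : Prop :=
  Tendsto (displacement ρ S) (Bornology.cobounded X) atTop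

/-- An isometric action is reduced if there is no unbounded closed convex proper subset at finite
Hausdorff distance from all its translates. -/
def IsReducedAction (ρ : Γ →* (X ≃ᵢ X)) : Prop :=
  ¬ ∃ C : Set X, ¬ Bornology.IsBounded C ∧ IsClosed C ∧ GeodesicallyConvex C ∧ C ≠ univ ∧
    ∀ γ : Γ, Metric.hausdorffEDist C (ρ γ '' C) ≠ ⊤

/-- An isometric action of a topological group is continuous if the map `G × X → X` is. -/
def IsContinuousAction {G : Type*} [Group G] [TopologicalSpace G] (α : G →* (X ≃ᵢ X)) : Prop :=
  Continuous fun p : G × X => α p.1 p.2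

end Actions

/-! ### Clifford isometries and the space of leaves -/

section Clifford

variable {X : Type*} [MetricSpace X]

/-- A Clifford isometry: a surjective isometry with constant displacement. -/
def IsClifford (T : X ≃ᵢ X) : Prop :=
  ∀ x y : X, dist x (T x) = dist y (T y)

variable (X) in
/-- The set `CL(X)` of all Clifford isometries. -/
def cliffordSet : Set (X ≃ᵢ X) := {T | IsClifford T}

variable (X) in
/-- The subgroup of `Isom(X)` generated by `CL(X)`. It is `CL(X)` itself exactly when `CL(X)` is a
group. -/
def cliffordGroup : Subgroup (X ≃ᵢ X) := Subgroup.closure (cliffordSet X)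

variable (X) in
/-- `CL(X)` is a group, i.e. the set of Clifford isometries is a subgroup of `Isom(X)`. -/
def CliffordFormGroup : Prop :=
  ∃ H : Subgroup (X ≃ᵢ X), (H : Set (X ≃ᵢ X)) = cliffordSet X

theorem CliffordFormGroup.coe_cliffordGroup (h : CliffordFormGroup X) :
    (cliffordGroup X : Set (X ≃ᵢ X)) = cliffordSet X := by
  obtain ⟨H, hH⟩ := h
  rw [cliffordGroup, ← hH, Subgroup.closure_eq]

theorem IsClifford.conj {T : X ≃ᵢ X} (hT : IsClifford T) (g : X ≃ᵢ X) :
    IsClifford (g * T * g⁻¹) := by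
  have key : ∀ x, dist x ((g * T * g⁻¹) x) = dist (g⁻¹ x) (T (g⁻¹ x)) := by
    intro x
    have : x = g (g⁻¹ x) := (IsometryEquiv.apply_inv_self g x).symm
    conv_lhs => lhs; rw [this]
    exact g.dist_eq _ _
  intro x y
  rw [key, key]
  exact hT _ _

theorem conj_mem_cliffordGroup (g : X ≃ᵢ X) {T : X ≃ᵢ X} (hT : T ∈ cliffordGroup X) :
    g * T * g⁻¹ ∈ cliffordGroup X := by
  have h : cliffordGroup X ≤ (cliffordGroup X).comap (MulAut.conj g).toMonoidHom :=
    (Subgroup.closure_le _).2 fun S hS => Subgroup.subset_closure (IsClifford.conj hS g)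
  exact h hT

variable (X) in
/-- The orbit equivalence relation of `CL(X)`. -/
def cliffordSetoid : Setoid X where
  r x y := ∃ T ∈ cliffordGroup X, T x = y
  iseqv :=
    { refl := fun _ => ⟨1, one_mem _, rfl⟩
      symm := by
        rintro x _ ⟨T, hT, rfl⟩
        exact ⟨T⁻¹, inv_mem hT, IsometryEquiv.inv_apply_self T x⟩
      trans := by
        rintro x _ _ ⟨T, hT, rfl⟩ ⟨S, hS, rfl⟩
        exact ⟨S * T, mul_mem hS hT, rfl⟩ }

variable (X) in
/-- The orbit space `X / CL(X)`. -/
def CliffordQuotient : Type _ := Quotient (cliffordSetoid X)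

namespace CliffordQuotient

/-- The projection `X → X / CL(X)`. -/
def mk (x : X) : CliffordQuotient X := Quotient.mk (cliffordSetoid X) x

theorem mk_surjective : Function.Surjective (mk : X → CliffordQuotient X) :=
  Quotient.mk_surjective

theorem mk_eq_iff {x y : X} : mk x = mk y ↔ ∃ T ∈ cliffordGroup X, T x = y :=
  Quotient.eq (r := cliffordSetoid X)

/-- The distance of two orbits is the infimum of the distances between their points. -/
instance : Dist (CliffordQuotient X) where
  dist a b := sInf {r : ℝ | ∃ x y : X, mk x = a ∧ mk y = b ∧ dist x y = r}

theorem dist_def (a b : CliffordQuotient X) :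
    dist a b = sInf {r : ℝ | ∃ x y : X, mk x = a ∧ mk y = b ∧ dist x y = r} := rfl

theorem dist_mk_le (x y : X) : dist (mk x) (mk y) ≤ dist x y :=
  csInf_le ⟨0, by rintro _ ⟨x, y, -, -, rfl⟩; exact dist_nonneg⟩ ⟨x, y, rfl, rfl, rfl⟩

theorem exists_dist_lt (x : X) (b : CliffordQuotient X) {ε : ℝ} (hε : 0 < ε) :
    ∃ y : X, mk y = b ∧ dist x y < dist (mk x) b + ε := by
  obtain ⟨y₀, rfl⟩ := mk_surjective b
  obtain ⟨_, ⟨x', y', hx, hy, rfl⟩, hr⟩ := exists_lt_of_csInf_lt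
    (s := {r : ℝ | ∃ x' y' : X, mk x' = mk x ∧ mk y' = mk y₀ ∧ dist x' y' = r})
    ⟨_, x, y₀, rfl, rfl, rfl⟩ (lt_add_of_pos_right _ hε)
  obtain ⟨T, hT, rfl⟩ := mk_eq_iff.1 hx
  refine ⟨T y', ?_, ?_⟩
  · rw [← hy]
    exact (mk_eq_iff.2 ⟨T, hT, rfl⟩).symm
  · rw [T.dist_eq]
    exact hr

/-- The quotient distance. For complete `X` such that `CL(X)` is a group, the orbits are closed and
it separates points. -/
instance : PseudoMetricSpace (CliffordQuotient X) where
  dist_self a := by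
    obtain ⟨x, rfl⟩ := mk_surjective a
    refine le_antisymm ((dist_mk_le x x).trans_eq (dist_self x)) ?_
    exact Real.sInf_nonneg (by rintro _ ⟨x, y, -, -, rfl⟩; exact dist_nonneg)
  dist_comm a b := by
    rw [dist_def, dist_def]
    congr 1
    ext r
    constructor
    · rintro ⟨x, y, hx, hy, h⟩
      exact ⟨y, x, hy, hx, by rw [dist_comm, h]⟩
    · rintro ⟨x, y, hx, hy, h⟩
      exact ⟨y, x, hy, hx, by rw [dist_comm, h]⟩
  dist_triangle a b c := by
    refine le_of_forall_pos_le_add fun ε hε => ?_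
    obtain ⟨x, rfl⟩ := mk_surjective a
    obtain ⟨y, rfl, hy⟩ := exists_dist_lt x b (half_pos hε)
    obtain ⟨z, rfl, hz⟩ := exists_dist_lt y c (half_pos hε)
    have h₁ := dist_mk_le x z
    have h₂ := dist_triangle x y z
    linarith

/-- The map induced on `X / CL(X)` by an isometry of `X`. -/
def map (g : X ≃ᵢ X) : CliffordQuotient X → CliffordQuotient X :=
  Quotient.map' (s₁ := cliffordSetoid X) (s₂ := cliffordSetoid X) g (by
    rintro x _ ⟨T, hT, rfl⟩
    refine ⟨g * T * g⁻¹, conj_mem_cliffordGroup g hT, ?_⟩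
    change g (T (g⁻¹ (g x))) = g (T x)
    rw [IsometryEquiv.inv_apply_self])

theorem map_mk (g : X ≃ᵢ X) (x : X) : map g (mk x) = mk (g x) := rfl

theorem map_mul (g h : X ≃ᵢ X) (a : CliffordQuotient X) : map (g * h) a = map g (map h a) := by
  obtain ⟨x, rfl⟩ := mk_surjective a
  rfl

theorem map_one (a : CliffordQuotient X) : map 1 a = a := by
  obtain ⟨x, rfl⟩ := mk_surjective a
  rfl

theorem dist_map_le (g : X ≃ᵢ X) (a b : CliffordQuotient X) :
    dist (map g a) (map g b) ≤ dist a b := by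
  refine le_of_forall_pos_le_add fun ε hε => ?_
  obtain ⟨x, rfl⟩ := mk_surjective a
  obtain ⟨y, rfl, hy⟩ := exists_dist_lt x b hε
  rw [map_mk, map_mk]
  exact (dist_mk_le _ _).trans (by rw [g.dist_eq]; exact hy.le)

/-- The induced isometric action of `Isom(X)` on `X / CL(X)`. -/
def inducedIsometry : (X ≃ᵢ X) →* (CliffordQuotient X ≃ᵢ CliffordQuotient X) where
  toFun g :=
    { toFun := map g
      invFun := map g⁻¹
      left_inv := fun a => by rw [← map_mul, inv_mul_cancel, map_one]
      right_inv := fun a => by rw [← map_mul, mul_inv_cancel, map_one]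
      isometry_toFun := Isometry.of_dist_eq fun a b => by
        refine le_antisymm (dist_map_le g a b) ?_
        have h := dist_map_le g⁻¹ (map g a) (map g b)
        rwa [← map_mul, ← map_mul, inv_mul_cancel, map_one, map_one] at h }
  map_one' := by ext a; exact map_one a
  map_mul' g h := by ext a; exact map_mul g h a

end CliffordQuotient

end Clifford

/-! ### Lattices in products -/

section Lattices

variable {n : ℕ} {G : Fin n → Type*} [∀ i, Group (G i)] [∀ i, TopologicalSpace (G i)]

/-- A topological group is compactly generated if it is generated by a compact subset. -/
def IsCompactlyGeneratedGroup (G : Type*) [Group G] [TopologicalSpace G] : Prop :=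
  ∃ K : Set G, IsCompact K ∧ Subgroup.closure K = ⊤

/-- A uniform lattice: a discrete cocompact subgroup. -/
structure IsUniformLattice {G : Type*} [Group G] [TopologicalSpace G] (Γ : Subgroup G) : Prop where
  discrete : DiscreteTopology Γ
  cocompact : CompactSpace (G ⧸ Γ)

/-- `Γ` is irreducible in `∏ i, G i`: for each `i` the set `Γ · ∏_{j ≠ i} G j` is dense; here
`∏_{j ≠ i} G j` is the set of elements whose `i`-th coordinate is `1`. -/
def IsIrreducibleSubgroup (Γ : Subgroup (∀ i, G i)) : Prop :=
  ∀ i, Dense {g : ∀ i, G i | ∃ γ ∈ Γ, ∃ h : ∀ i, G i, h i = 1 ∧ g = γ * h}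

end Lattices

end

/-!
Let `Z` be the space of leaves `X / CL(X)`. The point is to find a factor `G i` and a continuous map
`p : G i → Z` with `p (γ i * x) = γ • p x` for `γ ∈ Γ`. Given one such map, the maps of this kind are
at constant distance from each other, because `Γ` projects densely to `G i`; so their values at `1`
form an invariant closed convex set, which is all of `Z` because the action is reduced and has no
fixed point (`IsReducedAction.eq_univ`). The maps are then the orbit maps of an action of `G i`
(`IsEquivariantMap.exists_extension`). For uniqueness, the fixed points of the other factors under
a second extension form an invariant closed convex set, which is nonempty because `Γ` is cocompact
(`eq_of_isContinuousAction`).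

To find `p`, consider the `Γ`-equivariant maps from `G` to `X` or to `Z` that are square integrable
over a fundamental domain of `Γ`. With the `L²` distance they form complete uniformly convex spaces
(`EquivariantL2.isUniformMidpoint_mid`), on which `G` acts isometrically by right translations. Since
`d_Σ` is convex and tends to infinity, it grows linearly, and hence so does the displacement of a
compact set of translations of the maps to `X` (`EquivariantL2.exists_compact_coercive`). Write
`G = A × B` with `B = G i`. Among the maps moved a bounded amount by a compact part of `A`, the
`B`-invariant closed convex sets all meet a fixed ball: otherwise, by uniform convexity, the points of
such a set nearest to a base point would be moved too little by a compact part of `G`. So there is a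
minimal `B`-invariant closed convex set, on which every `B`-invariant continuous convex function is
constant. For each `a ∈ A` the displacement by `a` of the induced map to `Z` is such a function
(`EquivariantL2.exists_parallel_set`).

If two maps and their midpoint are displaced by the same amount under `a`, then equality holds in
Busemann's comparison inequality at almost every point, and the quadrilaterals are parallelograms
(`IsUniformMidpoint.parallelogram`): the pointwise distance of the two maps is `A`-invariant. By
irreducibility `A` acts ergodically on `Γ \ G` (`exists_ae_eq_const`), so that this distance is
constant. The values at `x ∈ G` of the maps in the minimal set form a convex subset of `Z`. The
subsets for different `x` are parallel, hence commensurated by `Γ`, and by reducedness they are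
bounded or dense (`EquivariantL2.bounded_orbit_or_right_invariant`). If they are bounded, then `B`
has bounded orbits on the space of equivariant maps; if this occurs for every factor, then `G` has a
fixed point there, which gives a fixed point of `Γ` in `Z`. If they are dense, then translation by
`a ∈ A` induces an isometry of `Z` with constant displacement. There are none but the identity
(`CliffordQuotient.eq_self_of_isometry_of_dist_const`), because a Clifford isometry of `Z` lifts to
one of `X`. So the maps are `A`-invariant; having constant pointwise displacement under `B`, they are
continuous up to a null set (`EquivariantL2.exists_continuous_equivariant`), and descend to `B`.

The measure theory requires second countable groups. Since `G` is σ-compact, its factors have coarser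
second countable locally compact group topologies, for which `Γ` is still a uniform lattice
(`exists_coarser_secondCountable`); they may fail to be Hausdorff, and so no separation axiom is used
for `G`.
-/

set_option linter.overlappingInstances false
set_option linter.unusedSectionVars false

noncomputable section

/-! ### Uniformly convex midpoint maps -/

section Midpoint

variable {Y : Type*} [PseudoMetricSpace Y]

/-- `m x y` is a midpoint of `x` and `y`, and the midpoints satisfy Busemann's comparison
inequality and uniform convexity. Only midpoints, rather than geodesics, are used below: this is
enough for closed convex sets in complete spaces, and is easily verified for function spaces and for
quotients. -/
structure IsUniformMidpoint (m : Y → Y → Y) : Prop where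
  dist_left : ∀ x y, dist x (m x y) = dist x y / 2
  dist_right : ∀ x y, dist (m x y) y = dist x y / 2
  comparison : ∀ a b c d, dist (m a b) (m c d) ≤ (dist a c + dist b d) / 2
  uniform : ∀ ε : ℝ, 0 < ε → ∃ δ : ℝ, 0 < δ ∧ ∀ r : ℝ, 0 < r → ∀ x y₁ y₂ : Y,
    dist x y₁ ≤ r → dist x y₂ ≤ r → ε * r ≤ dist y₁ y₂ → dist x (m y₁ y₂) ≤ (1 - δ) * r

/-- A set is midpoint closed if it contains the chosen midpoint of any two of its points. -/
def MidClosed (m : Y → Y → Y) (C : Set Y) : Prop :=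
  ∀ a ∈ C, ∀ b ∈ C, m a b ∈ C

variable {m : Y → Y → Y}

theorem MidClosed.inter {C D : Set Y} (hC : MidClosed m C) (hD : MidClosed m D) :
    MidClosed m (C ∩ D) :=
  fun a ha b hb => ⟨hC a ha.1 b hb.1, hD a ha.2 b hb.2⟩

namespace IsUniformMidpoint

theorem dist_self (hm : IsUniformMidpoint m) (x : Y) : dist x (m x x) = 0 := by
  rw [hm.dist_left, _root_.dist_self]; norm_num

theorem dist_mid_le (hm : IsUniformMidpoint m) (x a b : Y) :
    dist x (m a b) ≤ (dist x a + dist x b) / 2 := by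
  have h₁ := hm.comparison x x a b
  have h₂ := dist_triangle x (m x x) (m a b)
  rw [hm.dist_self] at h₂
  linarith

theorem continuous (hm : IsUniformMidpoint m) : Continuous fun p : Y × Y => m p.1 p.2 := by
  rw [Metric.continuous_iff]
  intro p ε hε
  refine ⟨ε, hε, fun q hq => ?_⟩
  have h := hm.comparison q.1 q.2 p.1 p.2
  rw [Prod.dist_eq, max_lt_iff] at hq
  linarith [hq.1, hq.2]

theorem midClosed_closure (hm : IsUniformMidpoint m) {C : Set Y} (hC : MidClosed m C) :
    MidClosed m (closure C) := by
  intro a ha b hb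
  exact map_mem_closure₂ hm.continuous ha hb hC

/-- Two points that are almost at distance `r` from `x`, and whose midpoint is not much closer to
`x`, are close to each other. -/
theorem exists_small (hm : IsUniformMidpoint m) {r ε : ℝ} (hr : 0 ≤ r) (hε : 0 < ε) :
    ∃ η : ℝ, 0 < η ∧ ∀ x u v : Y, dist x u ≤ r + η → dist x v ≤ r + η →
      r - η ≤ dist x (m u v) → dist u v ≤ ε := by
  rcases hr.eq_or_lt with rfl | hr
  · refine ⟨ε / 2, half_pos hε, fun x u v hu hv _ => ?_⟩
    have := dist_triangle_left u v x
    linarith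
  · obtain ⟨δ, hδ, H⟩ := hm.uniform (ε / (r + 1)) (by positivity)
    refine ⟨min 1 (δ * r / 4), by positivity, fun x u v hu hv huv => ?_⟩
    set η := min 1 (δ * r / 4)
    have hη0 : 0 < η := by positivity
    have hη1 : η ≤ 1 := min_le_left _ _
    have hη2 : η ≤ δ * r / 4 := min_le_right _ _
    by_contra! hlt
    have h₁ : ε / (r + 1) * (r + η) ≤ dist u v := by
      refine le_trans ?_ hlt.le
      rw [div_mul_eq_mul_div, div_le_iff₀ (by positivity)]
      gcongr
    have h₂ := H (r + η) (by positivity) x u v hu hv h₁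
    nlinarith

/-- Midpoints are unique: the midpoint of two midpoints would be too close to both ends. -/
theorem dist_eq_zero_of_isMidpoint (hm : IsUniformMidpoint m) {x y p q : Y}
    (hp : IsMidpoint p x y) (hq : IsMidpoint q x y) : dist p q = 0 := by
  refine le_antisymm (le_of_forall_pos_le_add fun ε hε => ?_) dist_nonneg
  obtain ⟨η, hη, H⟩ := hm.exists_small (r := dist x y / 2) (by positivity) hε
  rw [zero_add]
  refine H x p q (by rw [hp.1]; linarith) (by rw [hq.1]; linarith) ?_
  have h₁ := hm.dist_mid_le y p q
  have h₂ := dist_triangle_right x y (m p q)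
  rw [dist_comm y p, dist_comm y q, hp.2, hq.2] at h₁
  linarith

theorem isMidpoint (hm : IsUniformMidpoint m) (x y : Y) : IsMidpoint (m x y) x y :=
  ⟨hm.dist_left x y, hm.dist_right x y⟩

/-- A point at distance at most half the length from both ends is a midpoint. -/
theorem _root_.IsMidpoint.of_le {x y p : Y} (h₁ : dist x p ≤ dist x y / 2)
    (h₂ : dist p y ≤ dist x y / 2) : IsMidpoint p x y := by
  have := dist_triangle x p y
  exact ⟨by linarith, by linarith⟩

/-- **Weak compactness of balls**: a chain of closed convex sets that all meet a fixed ball around `x`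
has a common point, and one whose distance from `x` is at most the radius of every such ball. -/
theorem exists_mem_sInter [CompleteSpace Y] (hm : IsUniformMidpoint m) {𝒮 : Set (Set Y)}
    (hne : 𝒮.Nonempty) (hchain : IsChain (· ⊆ ·) 𝒮) (hclosed : ∀ C ∈ 𝒮, IsClosed C)
    (hmid : ∀ C ∈ 𝒮, MidClosed m C) (x : Y) {R : ℝ}
    (hR : ∀ C ∈ 𝒮, ∃ p ∈ C, dist x p ≤ R) : ∃ p, (∀ C ∈ 𝒮, p ∈ C) ∧
      ∀ R', (∀ C ∈ 𝒮, ∃ p ∈ C, dist x p ≤ R') → dist x p ≤ R' := by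
  have hnonempty : ∀ C ∈ 𝒮, C.Nonempty := fun C hC => let ⟨p, hp, _⟩ := hR C hC; ⟨p, hp⟩
  set T : Set ℝ := (fun C => Metric.infDist x C) '' 𝒮
  have hT : BddAbove T := ⟨R, by
    rintro _ ⟨C, hC, rfl⟩
    obtain ⟨p, hp, hpR⟩ := hR C hC
    exact (Metric.infDist_le_dist_of_mem hp).trans hpR⟩
  have hTne : T.Nonempty := hne.image _
  set r := sSup T
  have hle : ∀ C ∈ 𝒮, Metric.infDist x C ≤ r := fun C hC => le_csSup hT ⟨C, hC, rfl⟩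
  have hr : 0 ≤ r := let ⟨C, hC⟩ := hne; Metric.infDist_nonneg.trans (hle C hC)
  have hpos : ∀ k : ℕ, (0 : ℝ) < 1 / (k + 1) := fun k => by positivity
  have hex : ∀ k : ℕ, ∃ C ∈ 𝒮, r - 1 / (k + 1) < Metric.infDist x C := fun k => by
    obtain ⟨_, ⟨C, hC, rfl⟩, h⟩ := exists_lt_of_lt_csSup hTne (sub_lt_self r (hpos k))
    exact ⟨C, hC, h⟩
  choose C hC hCr using hex
  have hpt : ∀ D ∈ 𝒮, ∀ k : ℕ, ∃ p ∈ D, dist x p < r + 1 / (k + 1) := fun D hD k =>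
    (Metric.infDist_lt_iff (hnonempty D hD)).1 ((hle D hD).trans_lt (lt_add_of_pos_right _ (hpos k)))
  have : Nonempty Y := ⟨x⟩
  choose! q hqmem hq using hpt
  -- Almost nearest points in two members of the chain are close to each other.
  have hclose : ∀ ε : ℝ, 0 < ε → ∃ N : ℕ, ∀ k ≥ N, ∀ D ∈ 𝒮, ∀ E ∈ 𝒮, ∀ u ∈ D, ∀ v ∈ E,
      r - 1 / (N + 1) < Metric.infDist x D → r - 1 / (N + 1) < Metric.infDist x E →
      dist x u ≤ r + 1 / (N + 1) → dist x v ≤ r + 1 / (k + 1) → dist u v ≤ ε := by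
    intro ε hε
    obtain ⟨η, hη, H⟩ := hm.exists_small hr hε
    obtain ⟨N, hN⟩ := exists_nat_one_div_lt hη
    refine ⟨N, fun k hk D hD E hE u hu v hv hrD hrE hxu hxv => ?_⟩
    have hkN : (1 : ℝ) / (k + 1) ≤ 1 / (N + 1) := by
      apply one_div_le_one_div_of_le (by positivity)
      exact_mod_cast Nat.succ_le_succ hk
    refine H x u v (by linarith) (by linarith) ?_
    rcases hchain.total hD hE with h | h
    · have := Metric.infDist_le_dist_of_mem (x := x) (hmid E hE u (h hu) v hv)
      linarith
    · have := Metric.infDist_le_dist_of_mem (x := x) (hmid D hD u hu v (h hv))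
      linarith
  have hmono : ∀ {j k : ℕ}, j ≤ k → (1 : ℝ) / (k + 1) ≤ 1 / (j + 1) := fun {j k} h => by
    apply one_div_le_one_div_of_le (by positivity)
    exact_mod_cast Nat.succ_le_succ h
  have hcauchy : CauchySeq fun k => q (C k) k := by
    rw [Metric.cauchySeq_iff']
    intro ε hε
    obtain ⟨N, hN⟩ := hclose (ε / 2) (half_pos hε)
    refine ⟨N, fun k hk => ?_⟩
    rw [dist_comm]
    refine (hN k hk _ (hC N) _ (hC k) _ (hqmem _ (hC N) N) _ (hqmem _ (hC k) k) (hCr N) ?_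
      (hq _ (hC N) N).le (hq _ (hC k) k).le).trans_lt (half_lt_self hε)
    linarith [hCr k, hmono hk]
  obtain ⟨p, hp⟩ := cauchySeq_tendsto_of_complete hcauchy
  have hxp : dist x p ≤ r := by
    refine le_of_tendsto_of_tendsto (tendsto_const_nhds.dist hp)
      (g := fun k : ℕ => r + 1 / ((k : ℝ) + 1)) ?_ (Eventually.of_forall fun k => (hq _ (hC k) k).le)
    simpa using (tendsto_one_div_add_atTop_nhds_zero_nat (𝕜 := ℝ)).const_add r
  refine ⟨p, fun D hD => ?_, fun R' hR' => hxp.trans ?_⟩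
  · -- Choose almost nearest points in `D ∩ C k`, which is `D` or `C k`.
    have hex : ∀ k : ℕ, ∃ v ∈ D, v ∈ C k ∧ dist x v ≤ r + 1 / (k + 1) := fun k => by
      rcases hchain.total hD (hC k) with h | h
      · exact ⟨q D k, hqmem D hD k, h (hqmem D hD k), (hq D hD k).le⟩
      · exact ⟨q (C k) k, h (hqmem _ (hC k) k), hqmem _ (hC k) k, (hq _ (hC k) k).le⟩
    choose v hvD hvC hv using hex
    refine (hclosed D hD).mem_of_tendsto (f := v) (b := atTop) ?_ (Eventually.of_forall hvD)
    rw [Metric.tendsto_atTop]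
    intro ε hε
    obtain ⟨N, hN⟩ := hclose (ε / 3) (by positivity)
    obtain ⟨M, hM⟩ := Metric.tendsto_atTop.1 hp (ε / 3) (by positivity)
    refine ⟨max N M, fun k hk => ?_⟩
    have hkN := (le_max_left N M).trans hk
    have h₁ := hN k hkN _ (hC k) _ (hC k) _ (hqmem _ (hC k) k) _ (hvC k)
      (by linarith [hCr k, hmono hkN]) (by linarith [hCr k, hmono hkN])
      (by linarith [hq _ (hC k) k, hmono hkN]) (hv k)
    have h₂ := hM k ((le_max_right N M).trans hk)
    have h₃ := dist_triangle_left (v k) p (q (C k) k)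
    linarith
  · refine csSup_le hTne ?_
    rintro _ ⟨C, hC, rfl⟩
    obtain ⟨p, hp, hpR⟩ := hR' C hC
    exact (Metric.infDist_le_dist_of_mem hp).trans hpR

/-- A nonempty closed convex set contains a point nearest to `x`. -/
theorem exists_nearest [CompleteSpace Y] (hm : IsUniformMidpoint m) {C : Set Y}
    (hne : C.Nonempty) (hC : IsClosed C) (hmC : MidClosed m C) (x : Y) :
    ∃ p ∈ C, ∀ q ∈ C, dist x p ≤ dist x q := by
  obtain ⟨p, hp, hle⟩ := hm.exists_mem_sInter (𝒮 := {C}) (singleton_nonempty _)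
    (IsChain.singleton) (by simpa using hC) (by simpa using hmC) x
    (R := dist x hne.some) (by simpa using ⟨_, hne.some_mem, le_rfl⟩)
  refine ⟨p, hp C rfl, fun q hq => hle _ ?_⟩
  simpa using ⟨q, hq, le_rfl⟩

/-- **Circumcenters**: a nonempty bounded set that is covered by each of its images under a family
of isometries has a center that these isometries fix. -/
theorem exists_circumcenter [CompleteSpace Y] (hm : IsUniformMidpoint m) {S : Set Y}
    (hne : S.Nonempty) (hS : Bornology.IsBounded S) :
    ∃ z, ∀ g : Y → Y, Isometry g → S ⊆ g '' S → dist (g z) z = 0 := by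
  obtain ⟨s₀, hs₀⟩ := hne
  obtain ⟨R, hR⟩ := hS.subset_closedBall s₀
  set T : Set ℝ := {s | ∃ z, S ⊆ Metric.closedBall z s}
  have hTne : T.Nonempty := ⟨R, s₀, hR⟩
  have hT0 : ∀ s ∈ T, 0 ≤ s := by
    rintro s ⟨z, hz⟩
    exact dist_nonneg.trans (hz hs₀)
  set r := sInf T
  have hr : 0 ≤ r := le_csInf hTne hT0
  set E : ℝ → Set Y := fun η => {z | ∀ s ∈ S, dist s z ≤ r + η}
  obtain ⟨z, hz, -⟩ := hm.exists_mem_sInter (𝒮 := E '' Ioi 0) (nonempty_Ioi.image E) (by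
      rintro _ ⟨a, ha, rfl⟩ _ ⟨b, hb, rfl⟩ -
      rcases le_total a b with h | h
      · exact Or.inl fun z hz s hs => (hz s hs).trans (by gcongr)
      · exact Or.inr fun z hz s hs => (hz s hs).trans (by gcongr))
    (by
      rintro _ ⟨a, ha, rfl⟩
      simp only [E, ofPred_forall]
      exact isClosed_biInter fun s _ => isClosed_le (continuous_const.dist continuous_id)
        continuous_const)
    (by
      rintro _ ⟨a, ha, rfl⟩ u hu v hv s hs
      have := hm.dist_mid_le s u v
      linarith [hu s hs, hv s hs]) s₀ (R := r + 1) (by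
      rintro _ ⟨a, ha, rfl⟩
      obtain ⟨s, ⟨z, hz⟩, hsr⟩ := exists_lt_of_csInf_lt hTne
        (lt_add_of_pos_right r (lt_min one_pos (mem_Ioi.1 ha)))
      refine ⟨z, fun t ht => ?_, ?_⟩
      · exact (Metric.mem_closedBall.1 (hz ht)).trans (hsr.le.trans (by gcongr; exact min_le_right _ _))
      · exact (Metric.mem_closedBall.1 (hz hs₀)).trans
          (hsr.le.trans (by gcongr; exact min_le_left _ _)))
  have hz' : ∀ s ∈ S, dist s z ≤ r := fun s hs => le_of_forall_pos_le_add fun η hη =>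
    hz _ ⟨η, hη, rfl⟩ s hs
  refine ⟨z, fun g hg hgS => ?_⟩
  have hgz : ∀ s ∈ S, dist s (g z) ≤ r := by
    intro s hs
    obtain ⟨t, ht, rfl⟩ := hgS hs
    rw [hg.dist_eq]
    exact hz' t ht
  refine le_antisymm (le_of_forall_pos_le_add fun ε hε => ?_) dist_nonneg
  obtain ⟨η, hη, H⟩ := hm.exists_small hr hε
  obtain ⟨s, hs, hsr⟩ : ∃ s ∈ S, r - η < dist s (m (g z) z) := by
    by_contra! hcon
    have : r ≤ r - η := csInf_le ⟨0, hT0⟩ ⟨m (g z) z, hcon⟩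
    linarith
  rw [zero_add]
  exact H s _ _ ((hgz s hs).trans (by linarith)) ((hz' s hs).trans (by linarith)) hsr.le

end IsUniformMidpoint

end Midpoint

section MetricMidpoint

variable {Z : Type*} [MetricSpace Z] {m : Z → Z → Z}

namespace IsUniformMidpoint

theorem eq_mid (hm : IsUniformMidpoint m) {x y p : Z} (hp : IsMidpoint p x y) : p = m x y :=
  dist_eq_zero.1 (hm.dist_eq_zero_of_isMidpoint hp (hm.isMidpoint x y))

theorem mid_comm (hm : IsUniformMidpoint m) (x y : Z) : m x y = m y x := by
  refine hm.eq_mid ⟨?_, ?_⟩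
  · rw [dist_comm, hm.dist_right, dist_comm]
  · rw [dist_comm, hm.dist_left, dist_comm]

theorem map_mid (hm : IsUniformMidpoint m) {g : Z → Z} (hg : Isometry g) (x y : Z) :
    g (m x y) = m (g x) (g y) := by
  refine hm.eq_mid ⟨?_, ?_⟩
  · rw [hg.dist_eq, hg.dist_eq, hm.dist_left]
  · rw [hg.dist_eq, hg.dist_eq, hm.dist_right]

/-- In a parallelogram the midpoints of two opposite sides are no farther apart than the ends of
each of the other two sides, and the smaller quadrilateral is again a parallelogram. -/
theorem parallelogram_step (hm : IsUniformMidpoint m) {a b c d : Z}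
    (h₁ : dist a b = dist c d) (h₂ : dist a b = dist (m a c) (m b d)) :
    dist (m a b) (m c d) ≤ dist b d ∧ dist a (m a b) = dist c (m c d) ∧
      dist a (m a b) = dist (m a c) (m (m a b) (m c d)) := by
  -- The two diagonals bisect each other.
  have hz : m a d = m (m a c) (m b d) := by
    refine hm.eq_mid (IsMidpoint.of_le ?_ ?_)
    · have := hm.comparison a c a d
      rw [_root_.dist_self] at this
      linarith
    · have := hm.comparison a d b d
      rw [_root_.dist_self] at this
      linarith
  have hz' : m c b = m (m a c) (m b d) := by
    refine hm.eq_mid (IsMidpoint.of_le ?_ ?_)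
    · have := hm.comparison a c b c
      rw [_root_.dist_self, hm.mid_comm b c] at this
      linarith
    · have := hm.comparison c b d b
      rw [_root_.dist_self, hm.mid_comm d b] at this
      linarith
  have key : dist (m a b) (m c d) ≤ dist b d := by
    have k₁ := hm.comparison a b a d
    have k₂ := hm.comparison c b c d
    have k₃ := dist_triangle (m a b) (m a d) (m c d)
    rw [_root_.dist_self] at k₁ k₂
    rw [hz, ← hz'] at k₃
    rw [hz, ← hz'] at k₁
    linarith
  refine ⟨key, by rw [hm.dist_left, hm.dist_left, h₁], ?_⟩
  have k₁ := hm.comparison a c (m a b) (m c d)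
  have k₂ := hm.comparison (m a b) (m c d) b d
  have k₃ := dist_triangle (m a c) (m (m a b) (m c d)) (m b d)
  rw [hm.dist_left, hm.dist_left] at k₁
  rw [hm.dist_right, hm.dist_right] at k₂
  rw [hm.dist_left]
  linarith

/-- The sides `b d` and `a c` are compared by iterating `parallelogram_step`: the side opposite to
`a c` never gets longer, while it tends to `a c`. -/
theorem parallelogram_le (hm : IsUniformMidpoint m) {a b c d : Z}
    (h₁ : dist a b = dist c d) (h₂ : dist a b = dist (m a c) (m b d)) :
    dist a c ≤ dist b d := by
  have key : ∀ k : ℕ, ∃ b' d', dist a b' = dist a b / 2 ^ k ∧ dist c d' = dist a b / 2 ^ k ∧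
      dist b' d' ≤ dist b d ∧ dist a b' = dist c d' ∧ dist a b' = dist (m a c) (m b' d') := by
    intro k
    induction k with
    | zero => exact ⟨b, d, by simp, by simp [h₁], le_rfl, h₁, h₂⟩
    | succ k ih =>
      obtain ⟨b', d', e₁, e₂, hle, p₁, p₂⟩ := ih
      obtain ⟨s₁, s₂, s₃⟩ := hm.parallelogram_step p₁ p₂
      refine ⟨m a b', m c d', ?_, ?_, s₁.trans hle, s₂, s₃⟩
      · rw [hm.dist_left, e₁, pow_succ]; ring
      · rw [hm.dist_left, e₂, pow_succ]; ring
  have hlim : Tendsto (fun k : ℕ => dist b d + 2 * (dist a b * (1 / 2) ^ k)) atTop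
      (𝓝 (dist b d + 2 * (dist a b * 0))) :=
    ((tendsto_pow_atTop_nhds_zero_of_lt_one (by norm_num) (by norm_num)).const_mul _).const_mul _
      |>.const_add _
  refine le_trans (ge_of_tendsto hlim (Eventually.of_forall fun k => ?_)) (by simp)
  obtain ⟨b', d', e₁, e₂, hle, -, -⟩ := key k
  have t := dist_triangle4 a b' d' c
  rw [dist_comm d' c, e₁, e₂, div_eq_mul_one_div, ← one_div_pow] at t
  linarith

/-- If two segments have the same length as the segment joining the midpoints of `a, c` and `b, d`
then the other two sides of the quadrilateral have equal lengths. -/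
theorem parallelogram (hm : IsUniformMidpoint m) {a b c d : Z}
    (h₁ : dist a b = dist c d) (h₂ : dist a b = dist (m a c) (m b d)) : dist a c = dist b d :=
  le_antisymm (hm.parallelogram_le h₁ h₂) (hm.parallelogram_le (by rw [dist_comm, h₁, dist_comm])
    (by rw [dist_comm, h₂, dist_comm]))

/-- A closed midpoint closed set is geodesically convex. -/
theorem geodesicallyConvex (hm : IsUniformMidpoint m) {C : Set Z} (hC : IsClosed C)
    (hmC : MidClosed m C) : GeodesicallyConvex C := by
  intro c hc h0 h1 t ht
  set D := dist (c 0) (c 1)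
  have hcont : ContinuousOn c (Icc 0 1) := by
    refine (LipschitzOnWith.of_dist_le_mul (K := D.toNNReal) fun s hs t ht => ?_).continuousOn
    rw [hc s hs t ht, Real.coe_toNNReal _ dist_nonneg, Real.dist_eq, mul_comm]
  set S : Set ℝ := Icc 0 1 ∩ c ⁻¹' C
  have hS : IsClosed S := hcont.preimage_isClosed_of_isClosed isClosed_Icc hC
  have h0S : (0 : ℝ) ∈ S := ⟨by simp, h0⟩
  have h1S : (1 : ℝ) ∈ S := ⟨by simp, h1⟩
  have hmidS : ∀ a ∈ S, ∀ b ∈ S, (a + b) / 2 ∈ S := by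
    rintro a ⟨ha, haC⟩ b ⟨hb, hbC⟩
    have hab : (a + b) / 2 ∈ Icc (0 : ℝ) 1 := ⟨by linarith [ha.1, hb.1], by linarith [ha.2, hb.2]⟩
    refine ⟨hab, ?_⟩
    have : c ((a + b) / 2) = m (c a) (c b) := by
      refine hm.eq_mid ⟨?_, ?_⟩
      · rw [hc a ha _ hab, hc a ha b hb, show a - (a + b) / 2 = (a - b) / 2 by ring, abs_div,
          abs_two]
        ring
      · rw [hc _ hab b hb, hc a ha b hb, show (a + b) / 2 - b = (a - b) / 2 by ring, abs_div,
          abs_two]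
        ring
    rw [mem_preimage, this]
    exact hmC _ haC _ hbC
  by_contra htC
  have htS : t ∉ S := fun h => htC h.2
  -- The gap of `S` around `t` has end points in `S`, but its midpoint is not in `S`.
  have hL : (S ∩ Iic t).Nonempty := ⟨0, h0S, ht.1⟩
  have hU : (S ∩ Ici t).Nonempty := ⟨1, h1S, ht.2⟩
  have hLb : BddAbove (S ∩ Iic t) := ⟨t, fun _ h => h.2⟩
  have hUb : BddBelow (S ∩ Ici t) := ⟨t, fun _ h => h.2⟩
  have ha := (hS.inter isClosed_Iic).csSup_mem hL hLb
  have hb := (hS.inter isClosed_Ici).csInf_mem hU hUb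
  set a := sSup (S ∩ Iic t)
  set b := sInf (S ∩ Ici t)
  have hat : a < t := lt_of_le_of_ne ha.2 fun h => htS (h ▸ ha.1)
  have hbt : t < b := lt_of_le_of_ne hb.2 fun h => htS (h ▸ hb.1)
  have hmem := hmidS a ha.1 b hb.1
  rcases le_total ((a + b) / 2) t with h | h
  · have := le_csSup hLb ⟨hmem, h⟩
    change (a + b) / 2 ≤ a at this
    linarith
  · have := csInf_le hUb ⟨hmem, h⟩
    change b ≤ (a + b) / 2 at this
    linarith

end IsUniformMidpoint

end MetricMidpoint

/-! ### Clifford isometries -/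

section BNPC

variable {X : Type*} [MetricSpace X]

/-- In a uniformly convex Busemann space the midpoints of geodesics are the values of a uniformly
convex midpoint map. -/
theorem IsBNPC.exists_isUniformMidpoint (hX : IsBNPC X) (hUC : IsUniformlyConvex X) :
    ∃ m : X → X → X, IsUniformMidpoint m := by
  choose c hc h0 h1 using hX.exists_geodesic
  have hhalf : (1 / 2 : ℝ) ∈ Icc (0 : ℝ) 1 := by constructor <;> norm_num
  have hz : (0 : ℝ) ∈ Icc (0 : ℝ) 1 := by simp
  have ho : (1 : ℝ) ∈ Icc (0 : ℝ) 1 := by simp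
  have hl : ∀ x y, dist x (c x y (1 / 2)) = dist x y / 2 := fun x y => by
    have := hc x y 0 hz (1 / 2) hhalf
    rw [h0, h1] at this
    rw [this, zero_sub, abs_neg, abs_of_pos (by norm_num)]
    ring
  have hr : ∀ x y, dist (c x y (1 / 2)) y = dist x y / 2 := fun x y => by
    have := hc x y (1 / 2) hhalf 1 ho
    rw [h0, h1] at this
    rw [this, show (1 / 2 - 1 : ℝ) = -(1 / 2) by norm_num, abs_neg, abs_of_pos (by norm_num)]
    ring
  refine ⟨fun x y => c x y (1 / 2), hl, hr, fun a b a' b' => ?_, fun ε hε => ?_⟩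
  · have := (hX.convex_dist _ _ (hc a b) (hc a' b')).2 hz ho
      (show (0 : ℝ) ≤ 1 / 2 by norm_num) (show (0 : ℝ) ≤ 1 / 2 by norm_num) (by norm_num)
    simp only [smul_eq_mul, mul_zero, mul_one, zero_add, h0, h1] at this
    linarith
  · obtain ⟨δ, hδ, H⟩ := hUC ε hε
    refine ⟨δ, hδ, fun r hr' x y₁ y₂ d₁ d₂ d₃ => ?_⟩
    have := H r hr' x y₁ y₂ _ ⟨hl y₁ y₂, hr y₁ y₂⟩ d₁ d₂ d₃
    linarith

end BNPC

section Clifford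

variable {Z : Type*} [MetricSpace Z] {m : Z → Z → Z}

theorem IsClifford.symm {T : Z ≃ᵢ Z} (hT : IsClifford T) : IsClifford T⁻¹ := by
  have key : ∀ x, dist x (T⁻¹ x) = dist (T⁻¹ x) (T (T⁻¹ x)) := fun x => by
    rw [IsometryEquiv.apply_inv_self, dist_comm]
  intro x y
  rw [key x, key y]
  exact hT _ _

/-- The displacement of the square of a Clifford isometry is twice its displacement. -/
theorem IsClifford.dist_apply_apply {T : Z ≃ᵢ Z} (hm : IsUniformMidpoint m) (hT : IsClifford T)
    (x : Z) : dist x (T (T x)) = 2 * dist x (T x) := by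
  have h₁ := hm.comparison x (T x) (T (T x)) (T x)
  rw [hm.mid_comm (T (T x)), ← hm.map_mid T.isometry x (T x), dist_self, ← hT x] at h₁
  have h₂ := dist_triangle x (T x) (T (T x))
  rw [T.dist_eq] at h₂
  linarith

/-- The midpoints of an orbit of a Clifford isometry lie on the same geodesic line as the orbit. -/
theorem IsClifford.isMidpoint_apply {T : Z ≃ᵢ Z} (hm : IsUniformMidpoint m) (hT : IsClifford T)
    (x : Z) : T x = m (m x (T x)) (T (m x (T x))) := by
  refine hm.eq_mid (IsMidpoint.of_le ?_ ?_)
  · rw [hm.dist_right, hT x (m x (T x))]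
  · rw [T.dist_eq, hm.dist_left, hT x (m x (T x))]

/-- A Clifford isometry has a square root among the Clifford isometries. -/
theorem IsClifford.exists_sqrt {T : Z ≃ᵢ Z} (hm : IsUniformMidpoint m) (hT : IsClifford T) :
    ∃ R : Z ≃ᵢ Z, IsClifford R ∧ ∀ x, R x = m x (T x) := by
  have hiso : Isometry fun x => m x (T x) := Isometry.of_dist_eq fun x y => by
    have h₁ := hm.comparison x (T x) y (T y)
    have h₂ := hm.comparison (m x (T x)) (T (m x (T x))) (m y (T y)) (T (m y (T y)))
    rw [← hT.isMidpoint_apply hm, ← hT.isMidpoint_apply hm, T.dist_eq, T.dist_eq] at h₂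
    rw [T.dist_eq] at h₁
    linarith
  have hinv : ∀ x, m (m x (T⁻¹ x)) (T (m x (T⁻¹ x))) = x := fun x => by
    rw [hm.map_mid T.isometry, IsometryEquiv.apply_inv_self]
    have := hT.symm.isMidpoint_apply hm (T x)
    rw [IsometryEquiv.inv_apply_self, hm.map_mid T⁻¹.isometry, IsometryEquiv.inv_apply_self] at this
    rw [hm.mid_comm, ← this]
  refine ⟨IsometryEquiv.mk' _ _ hinv hiso, fun x y => ?_, fun x => rfl⟩
  change dist x (m x (T x)) = dist y (m y (T y))
  rw [hm.dist_left, hm.dist_left, hT x y]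

/-- Moving one end by a Clifford isometry moves the midpoint by its square root. -/
theorem mid_apply_of_sqrt {T : Z ≃ᵢ Z} (hm : IsUniformMidpoint m) {R : Z ≃ᵢ Z}
    (hR : ∀ x, R x = m x (T x)) (x y : Z) : m x (T y) = R (m x y) := by
  rw [hm.map_mid R.isometry]
  refine hm.eq_mid (IsMidpoint.of_le ?_ ?_)
  · have := hm.comparison x (T x) x (T y)
    rw [dist_self, T.dist_eq] at this
    rw [R.dist_eq, hR]
    linarith
  · have := hm.comparison x (T y) y (T y)
    rw [dist_self] at this
    rw [R.dist_eq, hR]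
    linarith

theorem IsClifford.pow_two_pow {T : Z ≃ᵢ Z} (hm : IsUniformMidpoint m) (hT : IsClifford T) (k : ℕ) :
    IsClifford (T ^ 2 ^ k) ∧ ∀ x, dist x ((T ^ 2 ^ k) x) = 2 ^ k * dist x (T x) := by
  induction k with
  | zero => simpa using hT
  | succ k ih =>
    have h : ∀ x, (T ^ 2 ^ (k + 1)) x = (T ^ 2 ^ k) ((T ^ 2 ^ k) x) := fun x => by
      rw [pow_succ, mul_two, pow_add]; rfl
    have hd : ∀ x, dist x ((T ^ 2 ^ (k + 1)) x) = 2 ^ (k + 1) * dist x (T x) := fun x => by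
      rw [h, ih.1.dist_apply_apply hm, ih.2, pow_succ]; ring
    exact ⟨fun x y => by rw [hd, hd, hT x y], hd⟩

theorem dist_pow_apply_le (T : Z ≃ᵢ Z) (x : Z) (k : ℕ) :
    dist x ((T ^ k) x) ≤ k * dist x (T x) := by
  induction k with
  | zero => simp
  | succ k ih =>
    have h₁ := dist_triangle x ((T ^ k) x) ((T ^ (k + 1)) x)
    rw [show (T ^ (k + 1)) x = (T ^ k) (T x) by rw [pow_succ]; rfl, IsometryEquiv.dist_eq] at h₁
    rw [show (T ^ (k + 1)) x = (T ^ k) (T x) by rw [pow_succ]; rfl]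
    push_cast
    linarith

/-- The orbits of a Clifford isometry are evenly spaced points of geodesic lines. -/
theorem IsClifford.dist_pow_apply {T : Z ≃ᵢ Z} (hm : IsUniformMidpoint m) (hT : IsClifford T)
    (x : Z) (k : ℕ) : dist x ((T ^ k) x) = k * dist x (T x) := by
  refine le_antisymm (dist_pow_apply_le T x k) ?_
  have hk : k ≤ 2 ^ k := Nat.lt_two_pow_self.le
  have h₁ := (hT.pow_two_pow hm k).2 x
  have h₂ := dist_triangle x ((T ^ k) x) ((T ^ 2 ^ k) x)
  have h₃ : (T ^ 2 ^ k) x = (T ^ (2 ^ k - k)) ((T ^ k) x) := by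
    rw [← IsometryEquiv.mul_apply, ← pow_add, Nat.sub_add_cancel hk]
  have h₄ := dist_pow_apply_le T ((T ^ k) x) (2 ^ k - k)
  rw [← h₃, hT ((T ^ k) x) x, Nat.cast_sub hk] at h₄
  push_cast at h₄
  linarith

theorem IsClifford.dist_zpow_apply {T : Z ≃ᵢ Z} (hm : IsUniformMidpoint m) (hT : IsClifford T)
    (x : Z) (k : ℤ) : dist x ((T ^ k) x) = |(k : ℝ)| * dist x (T x) := by
  obtain ⟨n, rfl | rfl⟩ := k.eq_nat_or_neg
  · simpa using hT.dist_pow_apply hm x n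
  · rw [zpow_neg, zpow_natCast, ← (T ^ n).dist_eq, IsometryEquiv.apply_inv_self, dist_comm,
      hT.dist_pow_apply hm]
    simp

end Clifford

/-- A midpoint convex function on the integers that grows sublinearly is constant. -/
theorem eq_of_midconvex_of_sublinear {f : ℤ → ℝ} (hf : ∀ k, 2 * f k ≤ f (k - 1) + f (k + 1))
    (hs : ∀ ε : ℝ, 0 < ε → ∃ M : ℝ, ∀ k : ℤ, f k ≤ ε * |(k : ℝ)| + M) (k : ℤ) :
    f (k + 1) = f k := by
  set s := f (k + 1) - f k with hsdef
  have hup : ∀ n : ℕ, s ≤ f (k + n + 1) - f (k + n) := fun n => by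
    induction n with
    | zero => simp [hsdef]
    | succ n ih =>
      have := hf (k + n + 1)
      push_cast
      rw [show k + (n : ℤ) + 1 - 1 = k + n by ring] at this
      rw [← add_assoc]
      linarith
  have hdown : ∀ n : ℕ, f (k - n + 1) - f (k - n) ≤ s := fun n => by
    induction n with
    | zero => simp [hsdef]
    | succ n ih =>
      have := hf (k - n)
      push_cast
      rw [show k - ((n : ℤ) + 1) + 1 = k - n by ring, show k - ((n : ℤ) + 1) = k - n - 1 by ring]
      linarith
  have hup' : ∀ n : ℕ, f k + n * s ≤ f (k + n) := fun n => by
    induction n with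
    | zero => simp
    | succ n ih =>
      have := hup n
      push_cast
      rw [← add_assoc]
      linarith
  have hdown' : ∀ n : ℕ, f k - n * s ≤ f (k - n) := fun n => by
    induction n with
    | zero => simp
    | succ n ih =>
      have := hdown (n + 1)
      push_cast at this ⊢
      rw [show k - ((n : ℤ) + 1) + 1 = k - n by ring] at this
      linarith
  have hbound : ∀ n : ℕ, f k + n * |s| ≤ max (f (k + n)) (f (k - n)) := fun n => by
    rcases abs_cases s with ⟨h, _⟩ | ⟨h, _⟩ <;> rw [h]
    · exact (hup' n).trans (le_max_left _ _)
    · refine le_trans ?_ ((hdown' n).trans (le_max_right _ _))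
      linarith
  have hs0 : |s| ≤ 0 := by
    by_contra! hpos
    obtain ⟨M, hM⟩ := hs (|s| / 2) (half_pos hpos)
    obtain ⟨n, hn⟩ := exists_nat_gt ((|s| / 2 * |(k : ℝ)| + M - f k) / (|s| / 2))
    rw [div_lt_iff₀ (half_pos hpos)] at hn
    have habs : ∀ j : ℤ, |(j : ℝ)| ≤ |(k : ℝ)| + n → f j ≤ |s| / 2 * (|(k : ℝ)| + n) + M :=
      fun j hj => (hM j).trans (by gcongr)
    have h₁ : max (f (k + n)) (f (k - n)) ≤ |s| / 2 * (|(k : ℝ)| + n) + M := by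
      refine max_le (habs _ ?_) (habs _ ?_)
      · push_cast
        exact (abs_add_le _ _).trans (by simp)
      · push_cast
        exact (abs_sub _ _).trans (by simp)
    linarith [hbound n]
  have := abs_eq_zero.1 (le_antisymm hs0 (abs_nonneg s))
  linarith

namespace CliffordQuotient

variable {X : Type*} [MetricSpace X] {m : X → X → X}

theorem mem_cliffordGroup (hCL : CliffordFormGroup X) {T : X ≃ᵢ X} :
    T ∈ cliffordGroup X ↔ IsClifford T := by
  rw [← SetLike.mem_coe, hCL.coe_cliffordGroup]; rfl

theorem mk_eq_iff_isClifford (hCL : CliffordFormGroup X) {x y : X} :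
    mk x = mk y ↔ ∃ T : X ≃ᵢ X, IsClifford T ∧ T x = y := by
  simp only [mk_eq_iff, mem_cliffordGroup hCL]

/-- The orbit of a midpoint depends only on the orbits of the ends. -/
theorem mk_mid_congr (hCL : CliffordFormGroup X) (hm : IsUniformMidpoint m) {x x' y y' : X}
    (hx : mk x = mk x') (hy : mk y = mk y') : mk (m x y) = mk (m x' y') := by
  have key : ∀ x y y' : X, mk y = mk y' → mk (m x y) = mk (m x y') := by
    intro x y y' h
    obtain ⟨T, hT, rfl⟩ := (mk_eq_iff_isClifford hCL).1 h
    obtain ⟨R, hRc, hR⟩ := hT.exists_sqrt hm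
    exact (mk_eq_iff_isClifford hCL).2 ⟨R, hRc, (mid_apply_of_sqrt hm hR x y).symm⟩
  rw [key x y y' hy, hm.mid_comm, key y' x x' hx, hm.mid_comm]

/-- The midpoint map of the orbit space, computed on representatives. -/
def mid (m : X → X → X) (a b : CliffordQuotient X) : CliffordQuotient X :=
  mk (m (Function.surjInv mk_surjective a) (Function.surjInv mk_surjective b))

theorem mid_mk (hCL : CliffordFormGroup X) (hm : IsUniformMidpoint m) (x y : X) :
    mid m (mk x) (mk y) = mk (m x y) :=
  mk_mid_congr hCL hm (Function.surjInv_eq mk_surjective _) (Function.surjInv_eq mk_surjective _)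

theorem exists_lift_dist_lt (a b : CliffordQuotient X) {ε : ℝ} (hε : 0 < ε) :
    ∃ x y, mk x = a ∧ mk y = b ∧ dist x y < dist a b + ε := by
  obtain ⟨x, rfl⟩ := mk_surjective a
  obtain ⟨y, hy, h⟩ := exists_dist_lt x b hε
  exact ⟨x, y, rfl, hy, h⟩

/-- The orbit space is again uniformly convex in the sense of Busemann, since all conditions can be
checked on representatives at almost the distance of the orbits. -/
theorem isUniformMidpoint_mid (hCL : CliffordFormGroup X) (hm : IsUniformMidpoint m) :
    IsUniformMidpoint (mid m) := by
  have hle : ∀ a b, dist a (mid m a b) ≤ dist a b / 2 ∧ dist (mid m a b) b ≤ dist a b / 2 := by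
    intro a b
    constructor <;>
    · refine le_of_forall_pos_le_add fun ε hε => ?_
      obtain ⟨x, y, rfl, rfl, h⟩ := exists_lift_dist_lt a b hε
      rw [mid_mk hCL hm]
      refine (dist_mk_le _ _).trans ?_
      simp only [hm.dist_left, hm.dist_right]
      linarith
  have htri : ∀ a b, dist a b ≤ dist a (mid m a b) + dist (mid m a b) b :=
    fun a b => dist_triangle _ _ _
  refine ⟨fun a b => ?_, fun a b => ?_, fun a b c d => ?_, fun ε hε => ?_⟩
  · linarith [hle a b, htri a b]
  · linarith [hle a b, htri a b]
  · refine le_of_forall_pos_le_add fun ε hε => ?_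
    obtain ⟨x, y, rfl, rfl, h⟩ := exists_lift_dist_lt a c hε
    obtain ⟨z, w, rfl, rfl, h'⟩ := exists_lift_dist_lt b d hε
    rw [mid_mk hCL hm, mid_mk hCL hm]
    refine (dist_mk_le _ _).trans ((hm.comparison _ _ _ _).trans ?_)
    linarith
  · obtain ⟨δ, hδ, H⟩ := hm.uniform (ε / 2) (half_pos hε)
    refine ⟨δ, hδ, fun r hr a b₁ b₂ h₁ h₂ h₁₂ => ?_⟩
    have hlim : Tendsto (fun η : ℝ => (1 - δ) * (r + η)) (𝓝[>] 0) (𝓝 ((1 - δ) * (r + 0))) :=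
      Tendsto.mono_left (Continuous.tendsto (by fun_prop) 0) nhdsWithin_le_nhds
    rw [add_zero] at hlim
    refine ge_of_tendsto hlim ?_
    filter_upwards [Ioc_mem_nhdsGT hr] with η hη
    obtain ⟨x, rfl⟩ := mk_surjective a
    obtain ⟨y₁, rfl, k₁⟩ := exists_dist_lt x b₁ hη.1
    obtain ⟨y₂, rfl, k₂⟩ := exists_dist_lt x b₂ hη.1
    rw [mid_mk hCL hm]
    refine (dist_mk_le _ _).trans (H (r + η) (by linarith [hη.1]) x y₁ y₂ (by linarith)
      (by linarith) ?_)
    have := dist_mk_le y₁ y₂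
    nlinarith [hη.2]

/-- The orbits of the group of Clifford isometries are closed: if `T k y₀` converges, then so does
`T k x` for all `x`, because `(T j)⁻¹ * T k` has constant displacement, and the pointwise limit is
again a Clifford isometry. -/
theorem isClosed_fiber [CompleteSpace X] (hCL : CliffordFormGroup X) (a : CliffordQuotient X) :
    IsClosed {x : X | mk x = a} := by
  obtain ⟨y₀, rfl⟩ := mk_surjective a
  refine IsSeqClosed.isClosed fun u y hu hy => ?_
  have hu' : ∀ k, ∃ T : X ≃ᵢ X, IsClifford T ∧ T y₀ = u k := fun k =>
    (mk_eq_iff_isClifford hCL).1 (hu k).symm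
  choose T hT hTu using hu'
  have hgrp : ∀ j k, IsClifford ((T j)⁻¹ * T k) := fun j k => by
    rw [← mem_cliffordGroup hCL]
    exact mul_mem (inv_mem ((mem_cliffordGroup hCL).2 (hT j))) ((mem_cliffordGroup hCL).2 (hT k))
  have hd : ∀ j k x, dist (T j x) (T k x) = dist (u j) (u k) := fun j k x => by
    have h := hgrp j k x y₀
    rw [← (T j).dist_eq, ← (T j).dist_eq y₀] at h
    simpa only [IsometryEquiv.mul_apply, IsometryEquiv.apply_inv_self, hTu] using h
  have hdi : ∀ j k x, dist ((T j)⁻¹ x) ((T k)⁻¹ x) = dist (u j) (u k) := fun j k x => by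
    rw [← hd j k ((T j)⁻¹ x), IsometryEquiv.apply_inv_self, dist_comm, ← (T k).dist_eq,
      IsometryEquiv.apply_inv_self]
  have hcau := hy.cauchySeq
  have hlim : ∀ x, ∃ z, Tendsto (fun k => T k x) atTop (𝓝 z) := fun x =>
    cauchySeq_tendsto_of_complete (Metric.cauchySeq_iff.2 fun ε hε => by
      simpa only [hd] using Metric.cauchySeq_iff.1 hcau ε hε)
  have hlimi : ∀ x, ∃ z, Tendsto (fun k => (T k)⁻¹ x) atTop (𝓝 z) := fun x =>
    cauchySeq_tendsto_of_complete (Metric.cauchySeq_iff.2 fun ε hε => by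
      simpa only [hdi] using Metric.cauchySeq_iff.1 hcau ε hε)
  choose F hF using hlim
  choose F' hF' using hlimi
  have hiso : Isometry F := Isometry.of_dist_eq fun x z =>
    tendsto_nhds_unique ((hF x).dist (hF z)) (by simp only [IsometryEquiv.dist_eq]; exact tendsto_const_nhds)
  have hinv : ∀ x, F (F' x) = x := fun x => by
    refine tendsto_nhds_unique (hF (F' x)) (tendsto_iff_dist_tendsto_zero.2 ?_)
    have : ∀ k, dist (T k (F' x)) x = dist ((T k)⁻¹ x) (F' x) := fun k => by
      rw [← (T k).dist_eq ((T k)⁻¹ x), IsometryEquiv.apply_inv_self, dist_comm]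
    simp only [this]
    exact tendsto_iff_dist_tendsto_zero.1 (hF' x)
  refine ((mk_eq_iff_isClifford hCL).2 ⟨IsometryEquiv.mk' F F' hinv hiso, fun x z => ?_, ?_⟩).symm
  · refine tendsto_nhds_unique (tendsto_const_nhds.dist (hF x)) ?_
    simp only [hT _ x z]
    exact tendsto_const_nhds.dist (hF z)
  · refine tendsto_nhds_unique (hF y₀) ?_
    simpa only [hTu] using hy

theorem midClosed_fiber (hCL : CliffordFormGroup X) (hm : IsUniformMidpoint m)
    (a : CliffordQuotient X) : MidClosed m {x : X | mk x = a} := by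
  rintro x rfl y hy
  have h := mk_mid_congr hCL hm (x := x) rfl (show mk y = mk x from hy)
  have hx : m x x = x := (dist_eq_zero.1 (hm.dist_self x)).symm
  rwa [hx] at h

/-- Every orbit contains a point that realizes the distance to a given point. -/
theorem exists_dist_eq [CompleteSpace X] (hCL : CliffordFormGroup X) (hm : IsUniformMidpoint m)
    (x : X) (b : CliffordQuotient X) : ∃ y, mk y = b ∧ dist x y = dist (mk x) b := by
  obtain ⟨y, hy, hle⟩ := hm.exists_nearest (C := {y | mk y = b}) (mk_surjective b)
    (isClosed_fiber hCL b) (midClosed_fiber hCL hm b) x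
  refine ⟨y, hy, le_antisymm (le_of_forall_pos_le_add fun ε hε => ?_) ?_⟩
  · obtain ⟨z, hz, h⟩ := exists_dist_lt x b hε
    exact (hle z hz).trans h.le
  · rw [← show mk y = b from hy]
    exact dist_mk_le x y

/-- The point of an orbit that realizes the distance to `x` is unique. -/
theorem eq_of_dist_eq [CompleteSpace X] (hCL : CliffordFormGroup X) (hm : IsUniformMidpoint m)
    {x y z : X} (hyz : mk y = mk z) (hy : dist x y = dist (mk x) (mk y))
    (hz : dist x z = dist (mk x) (mk y)) : y = z := by
  refine dist_le_zero.1 (le_of_forall_pos_le_add fun ε hε => ?_)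
  obtain ⟨η, hη, H⟩ := hm.exists_small (r := dist (mk x) (mk y)) dist_nonneg hε
  rw [zero_add]
  refine H x y z (by linarith) (by linarith) ?_
  have h : mk (m y z) = mk y := midClosed_fiber hCL hm (mk y) y rfl z hyz.symm
  have := dist_mk_le x (m y z)
  rw [h] at this
  linarith

theorem eq_of_dist_eq_zero [CompleteSpace X] (hCL : CliffordFormGroup X)
    (hm : IsUniformMidpoint m) {a b : CliffordQuotient X} (h : dist a b = 0) : a = b := by
  obtain ⟨x, rfl⟩ := mk_surjective a
  obtain ⟨y, rfl, hy⟩ := exists_dist_eq hCL hm x b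
  rw [h] at hy
  rw [dist_eq_zero.1 hy]

/-- The orbit space is a metric space, and not just a pseudometric space, if `X` is complete. -/
abbrev metricSpace [CompleteSpace X] (hCL : CliffordFormGroup X) (hm : IsUniformMidpoint m) :
    MetricSpace (CliffordQuotient X) where
  eq_of_dist_eq_zero := eq_of_dist_eq_zero hCL hm

/-- A rapidly convergent sequence of orbits lifts to a Cauchy sequence of points. -/
theorem completeSpace [CompleteSpace X] : CompleteSpace (CliffordQuotient X) := by
  refine Metric.complete_of_convergent_controlled_sequences (fun k => (1 / 2 : ℝ) ^ k)
    (fun k => by positivity) fun u hu => ?_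
  have step : ∀ (k : ℕ) (x : X), mk x = u k → ∃ y, mk y = u (k + 1) ∧ dist x y < (1 / 2) ^ k := by
    rintro k x hx
    obtain ⟨y, hy, h⟩ := exists_dist_lt x (u (k + 1))
      (sub_pos.2 (hu k k (k + 1) le_rfl k.le_succ))
    exact ⟨y, hy, by rw [hx] at h; linarith⟩
  obtain ⟨x₀, hx₀⟩ := mk_surjective (u 0)
  let v : ∀ k : ℕ, {x : X // mk x = u k} := fun k => Nat.rec ⟨x₀, hx₀⟩
    (fun k x => ⟨(step k x.1 x.2).choose, (step k x.1 x.2).choose_spec.1⟩) k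
  have hv : ∀ k, dist (v k).1 (v (k + 1)).1 ≤ 1 * (1 / 2) ^ k := fun k => by
    rw [one_mul]
    exact (step k (v k).1 (v k).2).choose_spec.2.le
  obtain ⟨x, hx⟩ := cauchySeq_tendsto_of_complete (cauchySeq_of_le_geometric _ _ (by norm_num) hv)
  refine ⟨mk x, tendsto_iff_dist_tendsto_zero.2 (squeeze_zero (fun _ => dist_nonneg) (fun k => ?_)
    (tendsto_iff_dist_tendsto_zero.1 hx))⟩
  have := dist_mk_le (v k).1 x
  rwa [(v k).2] at this

/-- **The orbit space has no Clifford isometries.** A Clifford isometry `T'` of the orbit space is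
lifted to `X` by moving each point to the nearest point of the image orbit. The orbits of the lift
`T` are geodesic lines, so that `dist (T ^ k x) (T ^ k y)` is convex in `k`; by uniform convexity it
grows sublinearly. Hence it is constant, and `T` is a Clifford isometry of `X`. -/
theorem eq_self_of_isometry_of_dist_const [CompleteSpace X] (hCL : CliffordFormGroup X)
    (hm : IsUniformMidpoint m) (T' : CliffordQuotient X ≃ᵢ CliffordQuotient X)
    (hT' : ∀ a b, dist a (T' a) = dist b (T' b)) (a : CliffordQuotient X) : T' a = a := by
  let := metricSpace hCL hm
  have hm' := isUniformMidpoint_mid hCL hm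
  have hcl : IsClifford T' := hT'
  set e := dist a (T' a) with he
  have hee : ∀ b, dist b (T' b) = e := fun b => hT' b a
  choose near hnear hdist using fun (x : X) b => exists_dist_eq hCL hm x b
  have hinv : ∀ b, dist b (T'⁻¹ b) = e := fun b => by
    rw [← hee (T'⁻¹ b), IsometryEquiv.apply_inv_self, dist_comm]
  let T : Equiv.Perm X :=
    { toFun := fun x => near x (T' (mk x))
      invFun := fun x => near x (T'⁻¹ (mk x))
      left_inv := fun x => by
        refine eq_of_dist_eq hCL hm (x := near x (T' (mk x))) ?_ ?_ ?_
        · rw [hnear, hnear, IsometryEquiv.inv_apply_self]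
        · rw [hdist, hnear]
          dsimp only
          rw [hnear, hnear]
        · rw [dist_comm, hdist, hnear, hnear, hnear, IsometryEquiv.inv_apply_self, dist_comm]
      right_inv := fun x => by
        refine eq_of_dist_eq hCL hm (x := near x (T'⁻¹ (mk x))) ?_ ?_ ?_
        · rw [hnear, hnear, IsometryEquiv.apply_inv_self]
        · rw [hdist, hnear]
          dsimp only
          rw [hnear, hnear]
        · rw [dist_comm, hdist, hnear, hnear, hnear, IsometryEquiv.apply_inv_self, dist_comm] }
  have hTd : ∀ x, dist x (T x) = e := fun x => (hdist x _).trans (hee _)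
  have hTmk : ∀ x, mk (T x) = T' (mk x) := fun x => hnear x _
  have hzsucc : ∀ (k : ℤ) x, (T ^ (k + 1)) x = T ((T ^ k) x) := fun k x => by
    rw [add_comm, zpow_one_add]; rfl
  have hzpred : ∀ (k : ℤ) x, (T ^ k) x = T ((T ^ (k - 1)) x) := fun k x => by
    rw [← hzsucc, sub_add_cancel]
  have hzmk : ∀ (k : ℤ) x, mk ((T ^ k) x) = (T' ^ k) (mk x) := fun k x => by
    have hs : ∀ (k : ℤ) b, (T' ^ (k + 1)) b = T' ((T' ^ k) b) := fun k b => by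
      rw [add_comm, zpow_one_add]; rfl
    induction k using Int.induction_on with
    | zero => rfl
    | succ k ih => rw [hzsucc, hTmk, ih, hs]
    | pred k ih =>
      apply T'.injective
      rw [← hs, ← hTmk, ← hzsucc, sub_add_cancel, ih]
  -- The orbit of `x` under `T` lies over a geodesic line and its steps are no longer than the steps
  -- below, so it lies on a geodesic line itself.
  have hlow : ∀ (k : ℤ) x, dist (mk x) (mk ((T ^ k) x)) = |(k : ℝ)| * e := fun k x => by
    rw [hzmk, hcl.dist_zpow_apply hm', hee]
  have hup : ∀ (k : ℤ) x, dist x ((T ^ k) x) ≤ |(k : ℝ)| * e := fun k x => by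
    induction k using Int.induction_on with
    | zero => simp
    | succ k ih =>
      have h := dist_triangle x ((T ^ (k : ℤ)) x) ((T ^ ((k : ℤ) + 1)) x)
      rw [hzsucc, hTd] at h
      rw [hzsucc]
      push_cast at ih ⊢
      rw [abs_of_nonneg (by positivity)] at ih ⊢
      linarith
    | pred k ih =>
      have h := dist_triangle x ((T ^ (-(k : ℤ))) x) ((T ^ (-(k : ℤ) - 1)) x)
      rw [hzpred (-(k : ℤ)), dist_comm (T _), hTd, ← hzpred] at h
      push_cast at ih ⊢
      rw [abs_of_nonpos (by linarith [(Nat.cast_nonneg k : (0 : ℝ) ≤ k)])] at ih ⊢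
      linarith
  have hconv : ∀ (k : ℤ) x, (T ^ k) x = m ((T ^ (k - 1)) x) ((T ^ (k + 1)) x) := fun k x => by
    have h₁ : dist ((T ^ (k - 1)) x) ((T ^ k) x) = e := by rw [hzpred k, hTd]
    have h₂ : dist ((T ^ k) x) ((T ^ (k + 1)) x) = e := by rw [hzsucc, hTd]
    have h₃ := hlow 2 ((T ^ (k - 1)) x)
    have h₄ : (T ^ (2 : ℤ)) ((T ^ (k - 1)) x) = (T ^ (k + 1)) x := by
      rw [← Equiv.Perm.mul_apply, ← zpow_add]; congr 2; ring
    rw [h₄] at h₃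
    have h₅ := dist_mk_le ((T ^ (k - 1)) x) ((T ^ (k + 1)) x)
    rw [h₃] at h₅
    norm_num at h₅
    exact hm.eq_mid (IsMidpoint.of_le (by linarith) (by linarith))
  have hconst : ∀ x y, dist (T x) (T y) = dist x y := fun x y => by
    have h := eq_of_midconvex_of_sublinear (f := fun k : ℤ => dist ((T ^ k) x) ((T ^ k) y))
      (fun k => by
        rw [hconv k x, hconv k y]
        linarith [hm.comparison ((T ^ (k - 1)) x) ((T ^ (k + 1)) x) ((T ^ (k - 1)) y)
          ((T ^ (k + 1)) y)])
      (fun ε hε => by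
        have he0 : 0 ≤ e := dist_nonneg
        set R := dist (mk x) (mk y)
        set M := dist x y + R + 1
        have hR : 0 ≤ R := dist_nonneg
        have hM : 0 < M := by have := dist_nonneg (x := x) (y := y); positivity
        obtain ⟨δ, hδ, H⟩ := hm.uniform (ε / (e + 1)) (by positivity)
        refine ⟨ε / (e + 1) * M + 2 * (M / δ) + R + 1, fun k => ?_⟩
        -- `w` is a point of the orbit of `T ^ k x` that is close to `T ^ k y`.
        obtain ⟨w, hw, hlt⟩ := exists_dist_lt ((T ^ k) y) (mk ((T ^ k) x)) one_pos
        rw [hzmk, hzmk, IsometryEquiv.dist_eq, dist_comm (mk y)] at hlt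
        -- Both `T ^ k x` and `w` lie within `r` of `x`, and all points of their orbit are at distance
        -- at least `|k| * e = r - M` from `x`.
        set r := |(k : ℝ)| * e + M
        have hr : 0 < r := by positivity
        have hxw : dist x w ≤ r := by
          have := dist_triangle4 x y ((T ^ k) y) w
          linarith [hup k y]
        have hxk : dist x ((T ^ k) x) ≤ r := (hup k x).trans (by linarith)
        have hmw : |(k : ℝ)| * e ≤ dist x (m ((T ^ k) x) w) := by
          rw [← hlow k x, ← show mk (m ((T ^ k) x) w) = mk ((T ^ k) x) from
            midClosed_fiber hCL hm _ _ rfl _ hw]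
          exact dist_mk_le _ _
        have hkw : dist ((T ^ k) x) w ≤ ε / (e + 1) * r + 2 * (M / δ) := by
          by_cases hc : ε / (e + 1) * r ≤ dist ((T ^ k) x) w
          · have h₁ := H r hr x _ w hxk hxw hc
            have h₂ : r ≤ M / δ := by rw [le_div_iff₀ hδ]; nlinarith
            have h₃ := dist_triangle_left ((T ^ k) x) w x
            have : 0 ≤ ε / (e + 1) * r := by positivity
            linarith
          · have : 0 ≤ M / δ := by positivity
            linarith
        have hεe : ε / (e + 1) * e ≤ ε := by
          rw [div_mul_eq_mul_div, div_le_iff₀ (by positivity)]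
          nlinarith
        have h₁ := dist_triangle_right ((T ^ k) x) ((T ^ k) y) w
        have h₂ : ε / (e + 1) * r ≤ ε * |(k : ℝ)| + ε / (e + 1) * M := by
          have := mul_le_mul_of_nonneg_left hεe (abs_nonneg (k : ℝ))
          calc ε / (e + 1) * r = |(k : ℝ)| * (ε / (e + 1) * e) + ε / (e + 1) * M := by ring
            _ ≤ _ := by linarith
        linarith) 0
    simpa using h
  obtain ⟨x, rfl⟩ := mk_surjective a
  rw [← hTmk]
  refine ((mk_eq_iff_isClifford hCL).2
    ⟨⟨T, Isometry.of_dist_eq hconst⟩, fun x y => ?_, rfl⟩).symm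
  exact (hTd x).trans (hTd y).symm

end CliffordQuotient

/-! ### Fundamental domains of uniform lattices -/

section Domain

open MeasureTheory
open scoped ENNReal Pointwise

variable {G : Type*} [Group G] [TopologicalSpace G] [MeasurableSpace G]

/-- A relatively compact measurable strict fundamental domain for the left translations by a
discrete subgroup `Γ`; discreteness is expressed by the finiteness of `Γ ∩ K` for compact `K`. -/
structure IsCocompactDomain (Γ : Subgroup G) (F : Set G) : Prop where
  measurableSet : MeasurableSet F
  existsUnique : ∀ x : G, ∃! γ : Γ, γ • x ∈ F
  exists_compact : ∃ K, IsCompact K ∧ F ⊆ K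
  finite : ∀ K : Set G, IsCompact K → {γ : Γ | (γ : G) ∈ K}.Finite

variable {Γ : Subgroup G} {F : Set G}

namespace IsCocompactDomain

theorem countable [SigmaCompactSpace G] (hF : IsCocompactDomain Γ F) : Countable Γ := by
  rw [← Set.countable_univ_iff]
  refine (countable_iUnion fun n => (hF.finite _ (isCompact_compactCovering G n)).countable).mono
    fun γ _ => ?_
  obtain ⟨n, hn⟩ := exists_mem_compactCovering (γ : G)
  exact mem_iUnion.2 ⟨n, hn⟩

/-- The element of `Γ` that moves `x` into the fundamental domain. -/
def toDomain (hF : IsCocompactDomain Γ F) (x : G) : Γ := (hF.existsUnique x).choose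

variable (hF : IsCocompactDomain Γ F)
include hF

theorem toDomain_smul_mem (x : G) : hF.toDomain x • x ∈ F :=
  (hF.existsUnique x).choose_spec.1

theorem eq_toDomain {x : G} {γ : Γ} (h : γ • x ∈ F) : γ = hF.toDomain x :=
  (hF.existsUnique x).choose_spec.2 γ h

theorem toDomain_of_mem {x : G} (h : x ∈ F) : hF.toDomain x = 1 :=
  (hF.eq_toDomain (by rwa [one_smul])).symm

theorem toDomain_smul (γ : Γ) (x : G) : hF.toDomain (γ • x) = hF.toDomain x * γ⁻¹ :=
  (hF.eq_toDomain (by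
    rw [mul_smul, inv_smul_smul]
    exact hF.toDomain_smul_mem x)).symm

/-- A compact set meets finitely many translates of the fundamental domain. -/
theorem finite_toDomain [IsTopologicalGroup G] {K : Set G} (hK : IsCompact K) : (hF.toDomain '' K).Finite := by
  obtain ⟨L, hL, hFL⟩ := hF.exists_compact
  refine (hF.finite (L * K⁻¹) (hL.mul hK.inv)).subset ?_
  rintro _ ⟨x, hx, rfl⟩
  refine ⟨_, hFL (hF.toDomain_smul_mem x), x⁻¹, Set.inv_mem_inv.2 hx, ?_⟩
  simp [Subgroup.smul_def]

theorem isFundamentalDomain (μ : Measure G) : IsFundamentalDomain Γ F μ :=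
  IsFundamentalDomain.mk' hF.measurableSet.nullMeasurableSet hF.existsUnique

theorem measure_lt_top (μ : Measure G) [IsFiniteMeasureOnCompacts μ] : μ F < ∞ :=
  let ⟨_, hK, hFK⟩ := hF.exists_compact
  (measure_mono hFK).trans_lt hK.measure_lt_top

variable [IsTopologicalGroup G] [BorelSpace G]

/-- Right translates of the fundamental domain are fundamental domains. -/
theorem mul_right (μ : Measure G) (g : G) :
    IsFundamentalDomain Γ ((fun x => x * g⁻¹) ⁻¹' F) μ := by
  refine IsFundamentalDomain.mk' ((measurable_mul_const g⁻¹) hF.measurableSet).nullMeasurableSet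
    fun x => ?_
  simpa only [mem_preimage, Subgroup.smul_def, smul_eq_mul, mul_assoc] using
    hF.existsUnique (x * g⁻¹)

variable [SecondCountableTopology G]

/-- Integrals of `Γ`-invariant functions over the fundamental domain are invariant under right
translations. -/
theorem setLIntegral_mul_right [Countable Γ] (μ : Measure G) [μ.IsMulLeftInvariant]
    [μ.IsMulRightInvariant] {f : G → ℝ≥0∞} (hf : ∀ (γ : Γ) x, f (γ • x) = f x) (g : G) :
    ∫⁻ x in F, f (x * g) ∂μ = ∫⁻ x in F, f x ∂μ := by
  rw [← (hF.mul_right μ g).setLIntegral_eq (hF.isFundamentalDomain μ) f hf,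
    ← lintegral_indicator hF.measurableSet,
    ← lintegral_indicator ((measurable_mul_const g⁻¹) hF.measurableSet),
    ← lintegral_mul_right_eq_self (((fun x => x * g⁻¹) ⁻¹' F).indicator f) g]
  congr 1 with x
  by_cases hx : x ∈ F
  · rw [indicator_of_mem hx, indicator_of_mem (by simpa using hx)]
  · rw [indicator_of_notMem hx, indicator_of_notMem (by simpa using hx)]

/-- A locally compact group with a uniform lattice is unimodular: the right translates of a
fundamental domain are fundamental domains, and hence of the same finite measure. -/
theorem isMulRightInvariant [Countable Γ] [LocallyCompactSpace G] (μ : Measure G)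
    [μ.IsHaarMeasure] : μ.IsMulRightInvariant := by
  refine ⟨fun g => ?_⟩
  have hmap := Measure.map_right_mul_eq_modularCharacterFun_smul μ g
  rw [hmap]
  have h₁ := congrArg (fun ν : Measure G => ν ((fun x => x * g⁻¹) ⁻¹' F)) hmap
  have hms : MeasurableSet ((fun x => x * g⁻¹) ⁻¹' F) := measurable_mul_const g⁻¹ hF.measurableSet
  simp only [Measure.smul_apply] at h₁
  rw [Measure.map_apply (measurable_mul_const g) hms, ← preimage_comp,
    (hF.mul_right μ g).measure_eq (hF.isFundamentalDomain μ)] at h₁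
  have h₂ : (fun x => x * g⁻¹) ∘ (fun x => x * g) = id := by ext x; simp
  rw [h₂, preimage_id] at h₁
  have h0 : μ F ≠ 0 := (hF.isFundamentalDomain μ).measure_ne_zero (NeZero.ne μ)
  have htop : μ F ≠ ∞ := (hF.measure_lt_top μ).ne
  have h₃ : (Measure.modularCharacterFun g : ℝ≥0∞) = 1 := by
    rw [ENNReal.smul_def, smul_eq_mul] at h₁
    exact ((ENNReal.mul_eq_right h0 htop).1 h₁.symm)
  rw [ENNReal.coe_eq_one] at h₃
  rw [h₃, one_smul]

end IsCocompactDomain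

/-- A uniform lattice has a relatively compact measurable fundamental domain. It is the union of
small sets covering a compact set of representatives, where from each of them the orbits that meet
the previous ones have been removed. -/
theorem exists_isCocompactDomain [IsTopologicalGroup G] [BorelSpace G] [LocallyCompactSpace G]
    {K V : Set G} (hK : IsCompact K) (hKΓ : ∀ x : G, ∃ γ : Γ, γ • x ∈ K) (hV : V ∈ 𝓝 (1 : G))
    (hVΓ : ∀ γ : Γ, ∀ v ∈ V, ∀ w ∈ V, (γ : G) = v * w⁻¹ → γ = 1) :
    ∃ F : Set G, IsCocompactDomain Γ F := by
  have hnhds : ∀ {W : Set G}, W ∈ 𝓝 (1 : G) → ∀ x : G, (fun y => y * x⁻¹) ⁻¹' W ∈ 𝓝 x :=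
    fun hW x => (continuous_mul_const x⁻¹).continuousAt.preimage_mem_nhds (by simpa using hW)
  have huniq : ∀ (x y : G) (γ γ' : Γ), (γ • y) * x⁻¹ ∈ V → (γ' • y) * x⁻¹ ∈ V → γ = γ' := by
    intro x y γ γ' h h'
    rw [← mul_inv_eq_one]
    refine hVΓ _ _ h _ h' ?_
    simp [Subgroup.smul_def, mul_assoc]
  obtain ⟨C, hC, hC1⟩ := exists_compact_mem_nhds (1 : G)
  set W := interior (V ∩ C)
  have hW : W ∈ 𝓝 (1 : G) := interior_mem_nhds.2 (Filter.inter_mem hV hC1)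
  have hWV : W ⊆ V := interior_subset.trans inter_subset_left
  have hWC : W ⊆ C := interior_subset.trans inter_subset_right
  obtain ⟨t, -, ht⟩ := hK.elim_nhds_subcover (fun x => (fun y => y * x⁻¹) ⁻¹' W) fun x _ => hnhds hW x
  let e := t.equivFin.symm
  let U : Fin t.card → Set G := fun k => (fun y => y * (e k : G)⁻¹) ⁻¹' W
  have hUopen : ∀ k, IsOpen (U k) := fun k => isOpen_interior.preimage (continuous_mul_const _)
  let S : Fin t.card → Set G := fun k => ⋃ γ : Γ, (fun y => γ • y) ⁻¹' U k
  have hSopen : ∀ k, IsOpen (S k) := fun k => isOpen_iUnion fun γ =>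
    (hUopen k).preimage (continuous_const_mul (γ : G))
  have hS : ∀ k y, y ∈ S k ↔ ∃ γ : Γ, γ • y ∈ U k := fun k y => by simp [S]
  have hSsmul : ∀ k (γ : Γ) y, γ • y ∈ S k ↔ y ∈ S k := fun k γ y => by
    rw [hS, hS]
    exact ⟨fun ⟨δ, h⟩ => ⟨δ * γ, by rwa [mul_smul]⟩, fun ⟨δ, h⟩ => ⟨δ * γ⁻¹, by
      rwa [mul_smul, inv_smul_smul]⟩⟩
  refine ⟨⋃ k, (U k \ ⋃ j : {j // j < k}, S j), ?_, fun x => ?_, ?_, fun L hL => ?_⟩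
  · exact MeasurableSet.iUnion fun k => (hUopen k).measurableSet.diff
      (isOpen_iUnion fun j : {j // j < k} => hSopen j).measurableSet
  · have hne : {k | x ∈ S k}.Nonempty := by
      obtain ⟨γ, hγ⟩ := hKΓ x
      obtain ⟨z, hz, hγz⟩ := mem_iUnion₂.1 (ht hγ)
      refine ⟨t.equivFin ⟨z, hz⟩, (hS _ _).2 ⟨γ, ?_⟩⟩
      simpa [U, e] using hγz
    obtain ⟨k, hk, hmin⟩ := wellFounded_lt.has_min _ hne
    have hmin' : ∀ j, x ∈ S j → k ≤ j := fun j hj => not_lt.1 (hmin j hj)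
    have hmem : ∀ (γ : Γ), γ • x ∈ ⋃ k, (U k \ ⋃ j : {j // j < k}, S j) ↔ γ • x ∈ U k := by
      intro γ
      simp only [mem_iUnion, Set.mem_sdiff, hSsmul, not_exists, Subtype.forall]
      refine ⟨fun ⟨i, hi, hi'⟩ => ?_, fun h => ⟨k, h, fun j hj hxj => absurd (hmin' j hxj)
        (not_le.2 hj)⟩⟩
      have hki : k ≤ i := hmin' i ((hS _ _).2 ⟨γ, hi⟩)
      rcases hki.lt_or_eq with h | rfl
      · exact absurd hk (hi' k h)
      · exact hi
    obtain ⟨γ, hγ⟩ := (hS _ _).1 hk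
    exact ⟨γ, (hmem γ).2 hγ, fun γ' hγ' => huniq _ _ _ _ (hWV ((hmem γ').1 hγ')) (hWV hγ)⟩
  · refine ⟨C * (t : Set G), hC.mul t.finite_toSet.isCompact, ?_⟩
    refine iUnion_subset fun k => sdiff_subset.trans fun y hy => ?_
    exact ⟨_, hWC hy, _, (e k).2, by simp⟩
  · obtain ⟨s, -, hs⟩ := hL.elim_nhds_subcover (fun x => (fun y => y * x⁻¹) ⁻¹' V) fun x _ => hnhds hV x
    refine ((s.finite_toSet.biUnion (t := fun x => {γ : Γ | (γ : G) * x⁻¹ ∈ V}) fun x _ =>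
      Set.Subsingleton.finite fun γ hγ γ' hγ' => huniq x 1 γ γ' ?_ ?_)).subset fun γ hγ => ?_
    · simpa [Subgroup.smul_def] using hγ
    · simpa [Subgroup.smul_def] using hγ'
    · obtain ⟨x, hx, h⟩ := mem_iUnion₂.1 (hs hγ)
      exact mem_iUnion₂.2 ⟨x, hx, h⟩

end Domain

/-! ### Square integrable equivariant maps -/

section EquivariantMaps

open MeasureTheory
open scoped ENNReal Pointwise

variable {G : Type*} [Group G] [MeasurableSpace G] {Γ : Subgroup G}
  {Z : Type*} [MetricSpace Z]

theorem MeasureTheory.MemLp.toReal_eLpNorm_two_sq {α : Type*} [MeasurableSpace α] {ν : Measure α}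
    {u : α → ℝ} (hu : MemLp u 2 ν) : (eLpNorm u 2 ν).toReal ^ 2 = ∫ x, u x ^ 2 ∂ν := by
  have h0 : 0 ≤ ∫ x, u x ^ 2 ∂ν := integral_nonneg fun x => sq_nonneg _
  rw [hu.eLpNorm_eq_integral_rpow_norm two_ne_zero ENNReal.ofNat_ne_top]
  simp only [ENNReal.toReal_ofNat, Real.rpow_ofNat, Real.norm_eq_abs, sq_abs]
  rw [ENNReal.toReal_ofReal (by positivity), ← Real.rpow_natCast, ← Real.rpow_mul h0]
  norm_num

/-- The maps `G → Z` that are equivariant under the left translations by `Γ` and square integrable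
with respect to `ν`, which will be the restriction of a Haar measure to a fundamental domain for
`Γ`. They are genuine maps, equivariant at every point, and not classes of maps. -/
structure EquivariantL2 (ρ : Γ →* (Z ≃ᵢ Z)) (ν : Measure G) where
  toFun : G → Z
  equivariant' : ∀ (γ : Γ) x, toFun (γ • x) = ρ γ (toFun x)
  stronglyMeasurable' : StronglyMeasurable toFun
  memLp' : ∀ z, MemLp (fun x => dist (toFun x) z) 2 ν

namespace EquivariantL2

variable {ρ : Γ →* (Z ≃ᵢ Z)} {ν : Measure G}

instance : CoeFun (EquivariantL2 ρ ν) fun _ => G → Z := ⟨toFun⟩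

variable (φ ψ χ : EquivariantL2 ρ ν)

theorem equivariant (γ : Γ) (x : G) : φ (γ • x) = ρ γ (φ x) := φ.equivariant' γ x

theorem stronglyMeasurable : StronglyMeasurable φ := φ.stronglyMeasurable'

theorem memLp (z : Z) : MemLp (fun x => dist (φ x) z) 2 ν := φ.memLp' z

theorem memLp_dist : MemLp (fun x => dist (φ x) (ψ x)) 2 ν := by
  refine MemLp.of_le ((φ.memLp (φ 1)).add (ψ.memLp (φ 1)))
    (φ.stronglyMeasurable.dist ψ.stronglyMeasurable).aestronglyMeasurable
    (Eventually.of_forall fun x => ?_)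
  simp only [Pi.add_apply]
  rw [Real.norm_of_nonneg dist_nonneg, Real.norm_of_nonneg (by positivity)]
  exact dist_triangle_right _ _ _

/-- The distance is the `L²` norm of the pointwise distance. It is a pseudometric only, since maps
that agree almost everywhere are not identified. -/
instance : PseudoMetricSpace (EquivariantL2 ρ ν) where
  dist φ ψ := (eLpNorm (fun x => dist (φ x) (ψ x)) 2 ν).toReal
  dist_self φ := by simp
  dist_comm φ ψ := by simp only [dist_comm]
  dist_triangle φ ψ χ := by
    rw [← ENNReal.toReal_add (memLp_dist φ ψ).eLpNorm_ne_top (memLp_dist ψ χ).eLpNorm_ne_top]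
    refine ENNReal.toReal_mono (ENNReal.add_ne_top.2
      ⟨(memLp_dist φ ψ).eLpNorm_ne_top, (memLp_dist ψ χ).eLpNorm_ne_top⟩) ?_
    refine le_trans (eLpNorm_mono_real (g := (fun x => dist (φ x) (ψ x)) + fun x => dist (ψ x) (χ x))
      fun x => ?_) (eLpNorm_add_le (memLp_dist φ ψ).1 (memLp_dist ψ χ).1 one_le_two)
    rw [Real.norm_of_nonneg dist_nonneg]
    exact dist_triangle _ _ _

theorem dist_eq : dist φ ψ = (eLpNorm (fun x => dist (φ x) (ψ x)) 2 ν).toReal := rfl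

theorem dist_sq : dist φ ψ ^ 2 = ∫ x, dist (φ x) (ψ x) ^ 2 ∂ν :=
  (memLp_dist φ ψ).toReal_eLpNorm_two_sq

theorem integrable_dist_sq : Integrable (fun x => dist (φ x) (ψ x) ^ 2) ν :=
  (memLp_dist φ ψ).integrable_sq

theorem dist_eq_zero_iff : dist φ ψ = 0 ↔ ∀ᵐ x ∂ν, φ x = ψ x := by
  rw [dist_eq, ENNReal.toReal_eq_zero_iff, or_iff_left (memLp_dist φ ψ).eLpNorm_ne_top,
    eLpNorm_eq_zero_iff (memLp_dist φ ψ).1 two_ne_zero]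
  exact eventually_congr (Eventually.of_forall fun x => by simp)

/-- The distance of two maps at a constant distance from each other. -/
theorem dist_eq_of_ae_const [IsFiniteMeasure ν] {c : ℝ} (hc : 0 ≤ c)
    (h : ∀ᵐ x ∂ν, dist (φ x) (ψ x) = c) : dist φ ψ = c * Real.sqrt (ν.real univ) := by
  have h₁ := dist_sq φ ψ
  rw [integral_congr_ae (g := fun _ => c ^ 2) (h.mono fun x hx => by simp only [hx]), integral_const,
    smul_eq_mul] at h₁
  rw [← Real.sqrt_sq (dist_nonneg (x := φ)), h₁, mul_comm, Real.sqrt_mul (sq_nonneg c), Real.sqrt_sq hc]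

/-! The space of equivariant maps inherits uniform convexity from the target. -/

variable {m : Z → Z → Z}

/-- The pointwise midpoint. -/
def mid (hm : IsUniformMidpoint m) (φ ψ : EquivariantL2 ρ ν) : EquivariantL2 ρ ν where
  toFun x := m (φ x) (ψ x)
  equivariant' γ x := by rw [φ.equivariant, ψ.equivariant, hm.map_mid (ρ γ).isometry]
  stronglyMeasurable' :=
    hm.continuous.comp_stronglyMeasurable (φ.stronglyMeasurable.prodMk ψ.stronglyMeasurable)
  memLp' z := by
    refine MemLp.of_le ((φ.memLp z).add (ψ.memLp z))
      ((hm.continuous.comp_stronglyMeasurable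
        (φ.stronglyMeasurable.prodMk ψ.stronglyMeasurable)).dist
          stronglyMeasurable_const).aestronglyMeasurable (Eventually.of_forall fun x => ?_)
    simp only [Pi.add_apply]
    rw [Real.norm_of_nonneg dist_nonneg, Real.norm_of_nonneg (by positivity), dist_comm,
      dist_comm (φ x), dist_comm (ψ x)]
    have h₁ := hm.dist_mid_le z (φ x) (ψ x)
    have h₂ := dist_nonneg (x := z) (y := φ x)
    have h₃ := dist_nonneg (x := z) (y := ψ x)
    linarith

theorem mid_apply (hm : IsUniformMidpoint m) (x : G) : mid hm φ ψ x = m (φ x) (ψ x) := rfl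

/-- Uniform convexity in terms of squares of distances, in a form that can be integrated. -/
theorem _root_.IsUniformMidpoint.exists_quadratic (hm : IsUniformMidpoint m) {ε : ℝ} (hε : 0 < ε) :
    ∃ δ : ℝ, 0 < δ ∧ ∀ x y₁ y₂ : Z, dist x (m y₁ y₂) ^ 2 ≤
      (dist x y₁ ^ 2 + dist x y₂ ^ 2) / 2 -
        δ * (dist y₁ y₂ ^ 2 - ε ^ 2 * (dist x y₁ ^ 2 + dist x y₂ ^ 2)) := by
  obtain ⟨δ₁, hδ₁, H⟩ := hm.uniform ε hε
  obtain ⟨δ₀, hδ₀, hδ₀1, hδ₀₁⟩ : ∃ δ₀ : ℝ, 0 < δ₀ ∧ δ₀ ≤ 1 ∧ δ₀ ≤ δ₁ :=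
    ⟨min 1 δ₁, by positivity, min_le_left _ _, min_le_right _ _⟩
  refine ⟨δ₀ ^ 2 / 64, by positivity, fun x y₁ y₂ => ?_⟩
  have hwab := hm.dist_mid_le x y₁ y₂
  have huab := dist_triangle_left y₁ y₂ x
  have hHM := fun hM => H (max (dist x y₁) (dist x y₂)) hM x y₁ y₂ (le_max_left _ _) (le_max_right _ _)
  -- `M` and `s` are the larger and the smaller of the two distances to `x`. If they are almost equal,
  -- uniform convexity applies; if not, convexity of the square yields the required gain.
  rw [← max_add_min] at hwab huab
  have hMs2 : max (dist x y₁) (dist x y₂) ^ 2 + min (dist x y₁) (dist x y₂) ^ 2 =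
      dist x y₁ ^ 2 + dist x y₂ ^ 2 := by
    rcases le_total (dist x y₁) (dist x y₂) with h | h
    · rw [max_eq_right h, min_eq_left h]; ring
    · rw [max_eq_left h, min_eq_right h]
  rw [← hMs2]
  have hs0 : 0 ≤ min (dist x y₁) (dist x y₂) := le_min dist_nonneg dist_nonneg
  have hsM : min (dist x y₁) (dist x y₂) ≤ max (dist x y₁) (dist x y₂) := min_le_max
  have hw : 0 ≤ dist x (m y₁ y₂) := dist_nonneg
  have hu : 0 ≤ dist y₁ y₂ := dist_nonneg
  generalize max (dist x y₁) (dist x y₂) = M at *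
  generalize min (dist x y₁) (dist x y₂) = s at *
  generalize dist x (m y₁ y₂) = w at *
  generalize dist y₁ y₂ = u at *
  clear hMs2 H
  have hM0 : 0 ≤ M := hs0.trans hsM
  have hw2 : w ^ 2 ≤ (M ^ 2 + s ^ 2) / 2 - (M - s) ^ 2 / 4 := by nlinarith
  by_cases hc : ε * M ≤ u ∧ 0 < M
  · obtain ⟨hc, hMpos⟩ := hc
    have hwM : w ≤ (1 - δ₀) * M := (hHM hMpos hc).trans (by gcongr)
    have key : w ^ 2 ≤ (M ^ 2 + s ^ 2) / 2 - δ₀ ^ 2 / 16 * ((M ^ 2 + s ^ 2) / 2) := by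
      by_cases hη : (1 - δ₀ / 2) * M ≤ s
      · have h₁ : w ^ 2 ≤ (1 - δ₀) * M ^ 2 := by
          have : w ^ 2 ≤ ((1 - δ₀) * M) ^ 2 := pow_le_pow_left₀ hw hwM 2
          nlinarith [mul_nonneg (mul_nonneg hδ₀.le (sub_nonneg.2 hδ₀1)) (sq_nonneg M)]
        have h₂ : (1 - δ₀ / 2) ^ 2 * M ^ 2 ≤ s ^ 2 := by
          rw [← mul_pow]
          exact pow_le_pow_left₀ (mul_nonneg (by linarith) hM0) hη 2
        have h₃ : (1 - δ₀ / 2) * M ^ 2 ≤ (M ^ 2 + s ^ 2) / 2 := by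
          nlinarith [sq_nonneg (δ₀ * M)]
        have h₄ : (1 - δ₀) * M ^ 2 ≤ (1 - δ₀ ^ 2 / 16) * ((1 - δ₀ / 2) * M ^ 2) := by
          have : 1 - δ₀ ≤ (1 - δ₀ ^ 2 / 16) * (1 - δ₀ / 2) := by
            nlinarith [mul_nonneg hδ₀.le (sub_nonneg.2 hδ₀1), pow_pos hδ₀ 3]
          nlinarith [mul_le_mul_of_nonneg_right this (sq_nonneg M)]
        nlinarith [mul_le_mul_of_nonneg_left h₃ (show 0 ≤ 1 - δ₀ ^ 2 / 16 by nlinarith)]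
      · have h₁ : δ₀ / 2 * M ≤ M - s := by linarith
        have h₂ : (δ₀ / 2 * M) ^ 2 ≤ (M - s) ^ 2 := pow_le_pow_left₀ (by positivity) h₁ 2
        have h₃ : (M ^ 2 + s ^ 2) / 2 ≤ M ^ 2 := by nlinarith
        have h₄ := mul_le_mul_of_nonneg_left h₃ (sq_nonneg δ₀)
        linarith
    have hu2 : u ^ 2 ≤ 2 * (M ^ 2 + s ^ 2) := by
      have := pow_le_pow_left₀ hu huab 2
      linarith [sq_nonneg (M - s)]
    have h₁ := mul_le_mul_of_nonneg_left hu2 (sq_nonneg δ₀)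
    have h₂ : 0 ≤ δ₀ ^ 2 * (ε ^ 2 * (M ^ 2 + s ^ 2)) := by positivity
    linarith
  · have h₁ : u ≤ ε * M := by
      rcases hM0.lt_or_eq with hM' | hM'
      · exact (not_le.1 fun h => hc ⟨h, hM'⟩).le
      · have : 0 ≤ ε * M := by positivity
        linarith
    have h₂ : u ^ 2 ≤ ε ^ 2 * (M ^ 2 + s ^ 2) := by
      have h₃ : u ^ 2 ≤ (ε * M) ^ 2 := pow_le_pow_left₀ hu h₁ 2
      have h₄ : 0 ≤ ε ^ 2 * s ^ 2 := by positivity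
      linarith
    have h₃ := mul_nonneg (sq_nonneg δ₀) (sub_nonneg.2 h₂)
    linarith [sq_nonneg (M - s)]

/-- Comparison follows from Minkowski's inequality, and uniform convexity from the integral of
`IsUniformMidpoint.exists_quadratic`. -/
theorem isUniformMidpoint_mid (hm : IsUniformMidpoint m) :
    IsUniformMidpoint (mid hm : EquivariantL2 ρ ν → _ → _) := by
  have half : ∀ (φ ψ χ χ' : EquivariantL2 ρ ν),
      (∀ x, dist (χ x) (χ' x) = dist (φ x) (ψ x) / 2) → dist χ χ' = dist φ ψ / 2 := by
    intro φ ψ χ χ' h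
    have h₁ : dist χ χ' ^ 2 = (dist φ ψ / 2) ^ 2 := by
      rw [dist_sq, div_pow, dist_sq, ← integral_div]
      simp only [h, div_pow]
    exact (pow_left_inj₀ dist_nonneg (by positivity) two_ne_zero).1 h₁
  refine ⟨fun φ ψ => half φ ψ _ _ fun x => hm.dist_left _ _,
    fun φ ψ => half φ ψ _ _ fun x => hm.dist_right _ _, fun a b c d => ?_, fun ε hε => ?_⟩
  · have hhalf : ∀ u : G → ℝ, (fun x => u x / 2) = (1 / 2 : ℝ) • u := fun u => by
      ext x; simp [div_eq_inv_mul]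
    have h₁ : eLpNorm (fun x => dist (mid hm a b x) (mid hm c d x)) 2 ν ≤
        eLpNorm ((1 / 2 : ℝ) • ((fun x => dist (a x) (c x)) + fun x => dist (b x) (d x))) 2 ν := by
      refine eLpNorm_mono_real fun x => ?_
      rw [Real.norm_of_nonneg dist_nonneg]
      refine (hm.comparison _ _ _ _).trans_eq ?_
      simp only [Pi.smul_apply, Pi.add_apply, smul_eq_mul]
      ring
    rw [eLpNorm_const_smul] at h₁
    have h₂ := h₁.trans (mul_le_mul_right (eLpNorm_add_le (memLp_dist a c).1 (memLp_dist b d).1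
      one_le_two) _)
    have hne := ENNReal.add_ne_top.2
      ⟨(memLp_dist a c).eLpNorm_ne_top, (memLp_dist b d).eLpNorm_ne_top⟩
    have h₃ := ENNReal.toReal_mono (ENNReal.mul_ne_top (by simp) hne) h₂
    rw [ENNReal.toReal_mul, ENNReal.toReal_add (memLp_dist a c).eLpNorm_ne_top
      (memLp_dist b d).eLpNorm_ne_top] at h₃
    simp only [toReal_enorm, Real.norm_eq_abs] at h₃
    rw [abs_of_pos (by norm_num)] at h₃
    refine h₃.trans_eq ?_
    rw [dist_eq a c, dist_eq b d]
    ring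
  · obtain ⟨δ, hδ, H⟩ := hm.exists_quadratic (half_pos hε)
    refine ⟨δ * ε ^ 2 / 4, by positivity, fun r hr φ ψ₁ ψ₂ h₁ h₂ h₁₂ => ?_⟩
    have key : dist φ (mid hm ψ₁ ψ₂) ^ 2 ≤ (dist φ ψ₁ ^ 2 + dist φ ψ₂ ^ 2) / 2 -
        δ * (dist ψ₁ ψ₂ ^ 2 - (ε / 2) ^ 2 * (dist φ ψ₁ ^ 2 + dist φ ψ₂ ^ 2)) := by
      have i₁ := integrable_dist_sq φ ψ₁
      have i₂ := integrable_dist_sq φ ψ₂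
      have i₃ := integrable_dist_sq ψ₁ ψ₂
      set c := 1 / 2 + δ * (ε / 2) ^ 2 with hc
      have hint : ∫ x, (c * dist (φ x) (ψ₁ x) ^ 2 + c * dist (φ x) (ψ₂ x) ^ 2 -
          δ * dist (ψ₁ x) (ψ₂ x) ^ 2) ∂ν =
          c * dist φ ψ₁ ^ 2 + c * dist φ ψ₂ ^ 2 - δ * dist ψ₁ ψ₂ ^ 2 := by
        rw [integral_sub (f := fun x => c * dist (φ x) (ψ₁ x) ^ 2 + c * dist (φ x) (ψ₂ x) ^ 2)
          ((i₁.const_mul c).add (i₂.const_mul c)) (i₃.const_mul δ),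
          integral_add (i₁.const_mul c) (i₂.const_mul c), integral_const_mul, integral_const_mul,
          integral_const_mul, dist_sq, dist_sq, dist_sq]
      have hmono := integral_mono (integrable_dist_sq φ (mid hm ψ₁ ψ₂))
        (((i₁.const_mul c).add (i₂.const_mul c)).sub (i₃.const_mul δ))
        fun x => (H (φ x) (ψ₁ x) (ψ₂ x)).trans_eq (show _ = c * dist (φ x) (ψ₁ x) ^ 2 +
          c * dist (φ x) (ψ₂ x) ^ 2 - δ * dist (ψ₁ x) (ψ₂ x) ^ 2 by rw [hc]; ring)
      rw [← dist_sq] at hmono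
      refine (hmono.trans_eq hint).trans_eq ?_
      rw [hc]
      ring
    have e₁ : dist φ ψ₁ ^ 2 ≤ r ^ 2 := pow_le_pow_left₀ dist_nonneg h₁ 2
    have e₂ : dist φ ψ₂ ^ 2 ≤ r ^ 2 := pow_le_pow_left₀ dist_nonneg h₂ 2
    have e₃ : (ε * r) ^ 2 ≤ dist ψ₁ ψ₂ ^ 2 := pow_le_pow_left₀ (by positivity) h₁₂ 2
    have e₄ : dist φ (mid hm ψ₁ ψ₂) ^ 2 ≤ (1 - δ * ε ^ 2 / 2) * r ^ 2 := by
      have := mul_le_mul_of_nonneg_left e₃ hδ.le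
      have := mul_le_mul_of_nonneg_left (add_le_add e₁ e₂) (mul_nonneg hδ.le (sq_nonneg ε))
      nlinarith
    have e₅ : 0 ≤ 1 - δ * ε ^ 2 / 2 := by
      by_contra! h
      nlinarith [sq_nonneg (dist φ (mid hm ψ₁ ψ₂)), mul_neg_of_neg_of_pos h (pow_pos hr 2)]
    refine abs_le_of_sq_le_sq' ?_ (mul_nonneg (by linarith) hr.le) |>.2
    nlinarith [mul_nonneg (sq_nonneg (δ * ε ^ 2 / 4)) (sq_nonneg r)]

end EquivariantL2

end EquivariantMaps

/-! ### Right translations of equivariant maps -/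

section EquivariantTranslation

open MeasureTheory
open scoped ENNReal Pointwise

/-- The Kuratowski embedding `z ↦ dist z · - dist z₀ ·` into the bounded continuous functions. -/
def kuratowskiMap {Z : Type*} [MetricSpace Z] (z₀ z : Z) : BoundedContinuousFunction Z ℝ :=
  BoundedContinuousFunction.ofNormedAddCommGroup (fun w => dist z w - dist z₀ w) (by fun_prop)
    (dist z z₀) fun w => abs_dist_sub_le z z₀ w

theorem isometry_kuratowskiMap {Z : Type*} [MetricSpace Z] (z₀ : Z) :
    Isometry (kuratowskiMap z₀) := by
  refine Isometry.of_dist_eq fun x y => le_antisymm ?_ ?_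
  · refine (BoundedContinuousFunction.dist_le dist_nonneg).2 fun w => ?_
    change dist (dist x w - dist z₀ w) (dist y w - dist z₀ w) ≤ _
    rw [dist_sub_right]
    exact abs_dist_sub_le x y w
  · have h := BoundedContinuousFunction.dist_coe_le_dist (f := kuratowskiMap z₀ x)
      (g := kuratowskiMap z₀ y) y
    change dist (dist x y - dist z₀ y) (dist y y - dist z₀ y) ≤ _ at h
    rw [dist_sub_right, dist_self, Real.dist_eq, sub_zero, abs_of_nonneg dist_nonneg] at h
    exact h

theorem norm_kuratowskiMap {Z : Type*} [MetricSpace Z] (z₀ z : Z) :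
    ‖kuratowskiMap z₀ z‖ = dist z z₀ := by
  have h : kuratowskiMap z₀ z₀ = 0 := by
    ext w
    exact sub_self _
  rw [← dist_zero_right, ← h, (isometry_kuratowskiMap z₀).dist_eq]

variable {G : Type*} [Group G] [TopologicalSpace G] [MeasurableSpace G] {Γ : Subgroup G}
  {F : Set G} {Z : Type*} [MetricSpace Z] {ρ : Γ →* (Z ≃ᵢ Z)}

namespace IsCocompactDomain

/-- The equivariant extension of a map on a fundamental domain. -/
def extend (hF : IsCocompactDomain Γ F) (ρ : Γ →* (Z ≃ᵢ Z)) (f : G → Z) (x : G) : Z :=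
  ρ (hF.toDomain x)⁻¹ (f (hF.toDomain x • x))

variable (hF : IsCocompactDomain Γ F)
include hF

theorem extend_smul (f : G → Z) (γ : Γ) (x : G) :
    hF.extend ρ f (γ • x) = ρ γ (hF.extend ρ f x) := by
  simp only [extend, hF.toDomain_smul, mul_smul, inv_smul_smul, mul_inv_rev, inv_inv, map_mul,
    IsometryEquiv.mul_apply]

theorem extend_of_mem (f : G → Z) {x : G} (hx : x ∈ F) : hF.extend ρ f x = f x := by
  simp [extend, hF.toDomain_of_mem hx]

theorem stronglyMeasurable_extend [IsTopologicalGroup G] [BorelSpace G] [Countable Γ] {f : G → Z}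
    (hf : StronglyMeasurable f) : StronglyMeasurable (hF.extend ρ f) := by
  borelize Z
  have hγ : ∀ γ : Γ, StronglyMeasurable fun x : G => ρ γ⁻¹ (f (γ • x)) := fun γ =>
    (ρ γ⁻¹).continuous.comp_stronglyMeasurable
      (hf.comp_measurable (measurable_const_mul (γ : G)))
  refine stronglyMeasurable_iff_measurable_separable.2 ⟨fun s hs => ?_, ?_⟩
  · have : hF.extend ρ f ⁻¹' s =
        ⋃ γ : Γ, ((fun x => γ • x) ⁻¹' F ∩ (fun x : G => ρ γ⁻¹ (f (γ • x))) ⁻¹' s) := by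
      ext x
      simp only [mem_preimage, mem_iUnion, mem_inter_iff]
      constructor
      · exact fun h => ⟨hF.toDomain x, hF.toDomain_smul_mem x, h⟩
      · rintro ⟨γ, hγ, h⟩
        obtain rfl := hF.eq_toDomain hγ
        exact h
    rw [this]
    exact MeasurableSet.iUnion fun γ =>
      ((measurable_const_mul (γ : G)) hF.measurableSet).inter ((hγ γ).measurable hs)
  · refine (TopologicalSpace.IsSeparable.iUnion fun γ => (hγ γ).isSeparable_range).mono ?_
    rintro _ ⟨x, rfl⟩
    exact mem_iUnion.2 ⟨hF.toDomain x, x, rfl⟩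

end IsCocompactDomain

namespace EquivariantL2

variable [IsTopologicalGroup G] [BorelSpace G] [Countable Γ] {μ : Measure G} [μ.IsHaarMeasure]

/-- The equivariant map with given values on the fundamental domain. -/
def ofDomain (hF : IsCocompactDomain Γ F) (ρ : Γ →* (Z ≃ᵢ Z)) (f : G → Z)
    (hf : StronglyMeasurable f) {z₀ : Z}
    (hz : MemLp (fun x => dist (f x) z₀) 2 (μ.restrict F)) : EquivariantL2 ρ (μ.restrict F) where
  toFun := hF.extend ρ f
  equivariant' γ x := hF.extend_smul f γ x
  stronglyMeasurable' := hF.stronglyMeasurable_extend hf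
  memLp' z := by
    have : IsFiniteMeasure (μ.restrict F) := ⟨by simpa using hF.measure_lt_top μ⟩
    refine MemLp.of_le (hz.add (memLp_const (dist z₀ z)))
      ((hF.stronglyMeasurable_extend hf).dist stronglyMeasurable_const).aestronglyMeasurable ?_
    filter_upwards [ae_restrict_mem hF.measurableSet] with x hx
    rw [hF.extend_of_mem f hx]
    simp only [Pi.add_apply]
    rw [Real.norm_of_nonneg dist_nonneg, Real.norm_of_nonneg (by positivity)]
    exact dist_triangle _ _ _

/-- The equivariant map that is constant on the fundamental domain. -/
def base (hF : IsCocompactDomain Γ F) (ρ : Γ →* (Z ≃ᵢ Z)) (z₀ : Z) :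
    EquivariantL2 ρ (μ.restrict F) :=
  ofDomain hF ρ (fun _ => z₀) stronglyMeasurable_const (z₀ := z₀) (by simp)

theorem base_of_mem (hF : IsCocompactDomain Γ F) {z₀ : Z} {x : G} (hx : x ∈ F) :
    (base hF ρ z₀ : EquivariantL2 ρ (μ.restrict F)) x = z₀ :=
  hF.extend_of_mem (fun _ => z₀) hx

/-- The map `base` is bounded on compact sets. -/
theorem exists_dist_base_le (hF : IsCocompactDomain Γ F) (z₀ : Z) {K : Set G} (hK : IsCompact K) :
    ∃ C : ℝ, 0 ≤ C ∧ ∀ x ∈ K, dist ((base hF ρ z₀ : EquivariantL2 ρ (μ.restrict F)) x) z₀ ≤ C := by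
  obtain ⟨C, hC⟩ := ((hF.finite_toDomain hK).image fun γ => dist (ρ γ⁻¹ z₀) z₀).bddAbove
  refine ⟨max C 0, le_max_right _ _, fun x hx => le_max_of_le_left (hC ?_)⟩
  exact ⟨_, ⟨x, hx, rfl⟩, rfl⟩

theorem ae_ofDomain_eq (hF : IsCocompactDomain Γ F) {f : G → Z}
    (hf : StronglyMeasurable f) {z₀ : Z}
    (hz : MemLp (fun x => dist (f x) z₀) 2 (μ.restrict F)) :
    ∀ᵐ x ∂μ.restrict F, ofDomain hF ρ f hf hz x = f x := by
  filter_upwards [ae_restrict_mem hF.measurableSet] with x hx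
  exact hF.extend_of_mem f hx

theorem memLp_kuratowskiMap {ν : Measure G} (φ : EquivariantL2 ρ ν) (z₀ : Z) :
    MemLp (fun x => kuratowskiMap z₀ (φ x)) 2 ν := by
  refine (φ.memLp z₀).of_le ((isometry_kuratowskiMap z₀).continuous.comp_stronglyMeasurable
    φ.stronglyMeasurable).aestronglyMeasurable (Eventually.of_forall fun x => ?_)
  rw [norm_kuratowskiMap, Real.norm_of_nonneg dist_nonneg]

theorem eLpNorm_kuratowskiMap_sub {ν : Measure G} (φ ψ : EquivariantL2 ρ ν) (z₀ : Z) :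
    eLpNorm (fun x => kuratowskiMap z₀ (φ x) - kuratowskiMap z₀ (ψ x)) 2 ν =
      eLpNorm (fun x => dist (φ x) (ψ x)) 2 ν := by
  refine eLpNorm_congr_norm_ae (Eventually.of_forall fun x => ?_)
  rw [← dist_eq_norm, (isometry_kuratowskiMap z₀).dist_eq, Real.norm_of_nonneg dist_nonneg]

/-- Postcomposition with the Kuratowski embedding of `Z` into a Banach space embeds the space of
equivariant maps into an `L²` space. The limit of a Cauchy sequence there is the image of an almost
everywhere limit of a subsequence. -/
theorem completeSpace [CompleteSpace Z] (hF : IsCocompactDomain Γ F) :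
    CompleteSpace (EquivariantL2 ρ (μ.restrict F)) := by
  refine Metric.complete_of_cauchySeq_tendsto fun u hu => ?_
  set z₀ : Z := u 0 1
  set J : EquivariantL2 ρ (μ.restrict F) → Lp (BoundedContinuousFunction Z ℝ) 2 (μ.restrict F) :=
    fun φ => (φ.memLp_kuratowskiMap z₀).toLp _
  have hJ : Isometry J := Isometry.of_dist_eq fun φ ψ => by
    rw [Lp.dist_def, dist_eq, ← eLpNorm_kuratowskiMap_sub φ ψ z₀]
    congr 1
    exact eLpNorm_congr_ae ((MemLp.coeFn_toLp _).sub (MemLp.coeFn_toLp _))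
  obtain ⟨f, hf⟩ := cauchySeq_tendsto_of_complete (hJ.uniformContinuous.comp_cauchySeq hu)
  obtain ⟨ns, -, hns⟩ := (tendstoInMeasure_of_tendsto_Lp hf).exists_seq_tendsto_ae
  have : Nonempty Z := ⟨z₀⟩
  set g : G → Z := fun x => limUnder atTop fun k => u (ns k) x
  have hg : StronglyMeasurable g := StronglyMeasurable.limUnder fun k => (u (ns k)).stronglyMeasurable
  have hgf : ∀ᵐ x ∂μ.restrict F, kuratowskiMap z₀ (g x) = f x := by
    have hcoe : ∀ᵐ x ∂μ.restrict F, ∀ k, (J (u (ns k)) : G → _) x = kuratowskiMap z₀ (u (ns k) x) :=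
      ae_all_iff.2 fun k => MemLp.coeFn_toLp _
    filter_upwards [hns, hcoe] with x hx hc
    have hx' : Tendsto (fun k => kuratowskiMap z₀ (u (ns k) x)) atTop (𝓝 (f x)) := by
      refine hx.congr fun k => ?_
      exact hc k
    have hcau : CauchySeq fun k => u (ns k) x :=
      Metric.cauchySeq_iff.2 fun ε hε => by
        simpa only [(isometry_kuratowskiMap z₀).dist_eq] using
          Metric.cauchySeq_iff.1 hx'.cauchySeq ε hε
    obtain ⟨z, hz⟩ := cauchySeq_tendsto_of_complete hcau
    have hgz : g x = z := hz.limUnder_eq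
    rw [hgz]
    exact tendsto_nhds_unique (((isometry_kuratowskiMap z₀).continuous.tendsto z).comp hz) hx'
  have hmem : MemLp (fun x => dist (g x) z₀) 2 (μ.restrict F) := by
    refine (Lp.memLp f).of_le (hg.dist stronglyMeasurable_const).aestronglyMeasurable ?_
    filter_upwards [hgf] with x hx
    rw [← hx, norm_kuratowskiMap, Real.norm_of_nonneg dist_nonneg]
  refine ⟨ofDomain hF ρ g hg hmem, hJ.isUniformInducing.isInducing.tendsto_nhds_iff.2 ?_⟩
  convert! hf
  refine Lp.ext ?_
  filter_upwards [MemLp.coeFn_toLp ((ofDomain hF ρ g hg hmem).memLp_kuratowskiMap z₀),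
    ae_ofDomain_eq (ρ := ρ) hF hg hmem, hgf] with x h₁ h₂ h₃
  rw [← h₃, ← h₂]
  exact h₁

/-! The right translations act by isometries. -/

section Translate

variable [SecondCountableTopology G] [LocallyCompactSpace G] [μ.IsMulRightInvariant]

/-- The `L²` norm over the fundamental domain of a `Γ`-invariant function is invariant under right
translations. -/
theorem _root_.IsCocompactDomain.eLpNorm_mul_right (hF : IsCocompactDomain Γ F) {u : G → ℝ}
    (hu : ∀ (γ : Γ) x, u (γ • x) = u x) (g : G) :
    eLpNorm (fun x => u (x * g)) 2 (μ.restrict F) = eLpNorm u 2 (μ.restrict F) := by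
  rw [eLpNorm_eq_lintegral_rpow_enorm_toReal two_ne_zero ENNReal.ofNat_ne_top,
    eLpNorm_eq_lintegral_rpow_enorm_toReal two_ne_zero ENNReal.ofNat_ne_top,
    hF.setLIntegral_mul_right μ (f := fun x => ‖u x‖ₑ ^ (2 : ℝ≥0∞).toReal) (fun γ x => by rw [hu]) g]

theorem dist_smul_smul {ν : Measure G} (φ ψ : EquivariantL2 ρ ν) (γ : Γ) (x : G) :
    dist (φ (γ • x)) (ψ (γ • x)) = dist (φ x) (ψ x) := by
  rw [φ.equivariant, ψ.equivariant, IsometryEquiv.dist_eq]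

/-- The right translate `x ↦ φ (x * g)` of `φ`. -/
def translate (hF : IsCocompactDomain Γ F) (g : G) (φ : EquivariantL2 ρ (μ.restrict F)) :
    EquivariantL2 ρ (μ.restrict F) where
  toFun x := φ (x * g)
  equivariant' γ x := by rw [← φ.equivariant, Subgroup.smul_def, Subgroup.smul_def, smul_mul_assoc]
  stronglyMeasurable' := φ.stronglyMeasurable.comp_measurable (measurable_mul_const g)
  memLp' z := by
    have : IsFiniteMeasure (μ.restrict F) := ⟨by simpa using hF.measure_lt_top μ⟩
    set e : EquivariantL2 ρ (μ.restrict F) := base hF ρ z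
    obtain ⟨K, hK, hFK⟩ := hF.exists_compact
    obtain ⟨C, hC0, hC⟩ := exists_dist_base_le (μ := μ) (ρ := ρ) hF z (hK.mul (isCompact_singleton (x := g)))
    have hm := measurable_mul_const g
    have h₁ : MemLp (fun x => dist (φ (x * g)) (e (x * g))) 2 (μ.restrict F) := by
      refine ⟨((φ.stronglyMeasurable.comp_measurable hm).dist
        (e.stronglyMeasurable.comp_measurable hm)).aestronglyMeasurable, ?_⟩
      rw [hF.eLpNorm_mul_right (u := fun x => dist (φ x) (e x)) (dist_smul_smul φ e) g]
      exact (memLp_dist φ e).2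
    refine MemLp.of_le (h₁.add (memLp_const C))
      ((φ.stronglyMeasurable.comp_measurable hm).dist stronglyMeasurable_const).aestronglyMeasurable
      ?_
    filter_upwards [ae_restrict_mem hF.measurableSet] with x hx
    simp only [Pi.add_apply]
    rw [Real.norm_of_nonneg dist_nonneg, Real.norm_of_nonneg (by positivity)]
    have := hC (x * g) (Set.mul_mem_mul (hFK hx) rfl)
    have := dist_triangle (φ (x * g)) (e (x * g)) z
    linarith

variable (hF : IsCocompactDomain Γ F)

theorem translate_apply (g : G) (φ : EquivariantL2 ρ (μ.restrict F)) (x : G) :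
    translate hF g φ x = φ (x * g) := rfl

theorem translate_translate (g h : G) (φ : EquivariantL2 ρ (μ.restrict F)) :
    translate hF g (translate hF h φ) = translate hF (g * h) φ := by
  simp only [translate, mul_assoc]

theorem translate_one (φ : EquivariantL2 ρ (μ.restrict F)) : translate hF 1 φ = φ := by
  simp only [translate, mul_one]

theorem translate_mid {m : Z → Z → Z} (hm : IsUniformMidpoint m) (g : G)
    (φ ψ : EquivariantL2 ρ (μ.restrict F)) :
    translate hF g (mid hm φ ψ) = mid hm (translate hF g φ) (translate hF g ψ) := rfl

theorem isometry_translate (g : G) :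
    Isometry (translate hF g : EquivariantL2 ρ (μ.restrict F) → _) :=
  Isometry.of_dist_eq fun φ ψ => by
    rw [dist_eq, dist_eq]
    congr 1
    exact hF.eLpNorm_mul_right (u := fun x => dist (φ x) (ψ x)) (dist_smul_smul φ ψ) g

/-- The displacement of `base` is bounded over compact sets. -/
theorem exists_dist_translate_base_le (z₀ : Z) {L : Set G} (hL : IsCompact L) :
    ∃ M : ℝ, ∀ g ∈ L, dist (base hF ρ z₀ : EquivariantL2 ρ (μ.restrict F))
      (translate hF g (base hF ρ z₀)) ≤ M := by
  have : IsFiniteMeasure (μ.restrict F) := ⟨by simpa using hF.measure_lt_top μ⟩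
  obtain ⟨K, hK, hFK⟩ := hF.exists_compact
  obtain ⟨C, hC0, hC⟩ := exists_dist_base_le (μ := μ) (ρ := ρ) hF z₀ (hK.mul hL)
  refine ⟨_, fun g hg => ENNReal.toReal_mono ?_ (eLpNorm_le_of_ae_bound (C := C) ?_)⟩
  · exact ENNReal.mul_ne_top (ENNReal.rpow_ne_top_of_nonneg (by positivity) (measure_ne_top _ _))
      ENNReal.ofReal_ne_top
  · filter_upwards [ae_restrict_mem hF.measurableSet] with x hx
    rw [Real.norm_of_nonneg dist_nonneg, base_of_mem hF hx, translate_apply, dist_comm]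
    exact hC _ (Set.mul_mem_mul (hFK hx) hg)

/-- Equivariant maps are square integrable on compact sets. -/
theorem integrableOn_dist_sq (hF : IsCocompactDomain Γ F) (φ : EquivariantL2 ρ (μ.restrict F)) (z : Z) {Q : Set G}
    (hQ : IsCompact Q) : IntegrableOn (fun x => dist (φ x) z ^ 2) Q μ := by
  have hcov : Q ⊆ ⋃ γ ∈ hF.toDomain '' Q, (fun x : G => (γ : G) * x) ⁻¹' F := fun x hx =>
    mem_iUnion₂.2 ⟨_, mem_image_of_mem _ hx, hF.toDomain_smul_mem x⟩
  refine IntegrableOn.mono_set ((integrableOn_finite_biUnion (hF.finite_toDomain hQ)).2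
    fun γ _ => ?_) hcov
  have h := ((measurePreserving_mul_left μ (γ : G)).integrableOn_comp_preimage
    (measurableEmbedding_mulLeft (γ : G)) (f := fun x => dist (φ (γ⁻¹ • x)) z ^ 2) (s := F)).2 (by
      have := (φ.memLp (ρ γ z)).integrable_sq
      refine this.congr (Eventually.of_forall fun x => ?_)
      simp only [φ.equivariant, map_inv]
      rw [← (ρ γ).dist_eq _ z, IsometryEquiv.apply_inv_self])
  refine h.congr (Eventually.of_forall fun x => ?_)
  change dist (φ (γ⁻¹ • γ • x)) z ^ 2 = _
  rw [inv_smul_smul]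

/-- Right translation is continuous at the identity. The maps are compared with their restrictions to
a compact set, as elements of an `L²` space with values in a Banach space. -/
theorem tendsto_translate [μ.Regular] (φ : EquivariantL2 ρ (μ.restrict F)) :
    Tendsto (fun g => translate hF g φ) (𝓝 1) (𝓝 φ) := by
  obtain ⟨K, hK, hFK⟩ := hF.exists_compact
  obtain ⟨W, hW, hW1⟩ := exists_compact_mem_nhds (1 : G)
  set z₀ := φ 1
  set Q : Set G := closure (K * W)
  have hQ : IsCompact Q := (hK.mul hW).closure
  have hQm : MeasurableSet Q := isClosed_closure.measurableSet
  have hFW : ∀ x ∈ F, ∀ g ∈ W, x * g ∈ Q := fun x hx g hg =>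
    subset_closure (Set.mul_mem_mul (hFK hx) hg)
  have hFQ : ∀ x ∈ F, x ∈ Q := fun x hx => by simpa using hFW x hx 1 (mem_of_mem_nhds hW1)
  set f : G → BoundedContinuousFunction Z ℝ := Q.indicator fun x => kuratowskiMap z₀ (φ x)
  have hfm : StronglyMeasurable f := ((isometry_kuratowskiMap z₀).continuous.comp_stronglyMeasurable
    φ.stronglyMeasurable).indicator hQm
  have hf : MemLp f 2 μ := by
    refine (memLp_indicator_iff_restrict hQm).2 ((memLp_two_iff_integrable_sq_norm
      ((isometry_kuratowskiMap z₀).continuous.comp_stronglyMeasurable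
        φ.stronglyMeasurable).aestronglyMeasurable).2 ?_)
    simpa only [norm_kuratowskiMap, IntegrableOn] using φ.integrableOn_dist_sq hF z₀ hQ
  have hpres : ∀ g : G, MeasurePreserving (fun x => x * g) μ μ := fun g =>
    measurePreserving_mul_right μ g
  let R : G → C(G, G) := fun g => ⟨fun x => x * g, continuous_mul_const g⟩
  have hR : Continuous R := ContinuousMap.continuous_of_continuous_uncurry _
    (by exact continuous_snd.mul continuous_fst)
  have hlim := (tendsto_const_nhds (x := hf.toLp f) (f := 𝓝 (1 : G))).compMeasurePreservingLp
    (hR.tendsto 1) hpres (hpres 1) ENNReal.ofNat_ne_top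
  have hone : Lp.compMeasurePreserving (R 1) (hpres 1) (hf.toLp f) = hf.toLp f := by
    refine Lp.ext ?_
    filter_upwards [Lp.coeFn_compMeasurePreserving (hf.toLp f) (hpres 1)] with x hx
    refine hx.trans ?_
    simp
  rw [hone] at hlim
  refine tendsto_iff_dist_tendsto_zero.2 (squeeze_zero' (Eventually.of_forall fun g => dist_nonneg) ?_
    (tendsto_iff_dist_tendsto_zero.1 hlim))
  filter_upwards [hW1] with g hg
  rw [Lp.dist_def, dist_eq, ← eLpNorm_kuratowskiMap_sub _ φ z₀]
  refine ENNReal.toReal_mono ?_ ?_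
  · rw [eLpNorm_congr_ae (Lp.coeFn_sub _ _).symm]
    exact Lp.eLpNorm_ne_top _
  · refine (eLpNorm_congr_ae ?_).le.trans (eLpNorm_mono_measure _ (Measure.restrict_le_self (s := F)))
    have h₁ := ae_restrict_of_ae (s := F) (Lp.coeFn_compMeasurePreserving (hf.toLp f) (hpres g))
    have h₂ := ae_restrict_of_ae (s := F) ((hpres g).quasiMeasurePreserving.ae hf.coeFn_toLp)
    have h₃ := ae_restrict_of_ae (s := F) hf.coeFn_toLp
    filter_upwards [h₁, h₂, h₃, ae_restrict_mem hF.measurableSet] with x h₁ h₂ h₃ hx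
    change _ = (Lp.compMeasurePreserving (R g) (hpres g) (hf.toLp f) : G → _) x - hf.toLp f x
    rw [h₃, show (Lp.compMeasurePreserving (R g) (hpres g) (hf.toLp f) : G → _) x = f (x * g) from
      h₁.trans h₂]
    have hfQ : ∀ y ∈ Q, f y = kuratowskiMap z₀ (φ y) := fun y hy => indicator_of_mem hy _
    rw [hfQ _ (hFW x hx g hg), hfQ _ (hFQ x hx), translate_apply]

/-! Linear growth of the displacement passes from `Z` to the space of equivariant maps. -/

theorem ofReal_dist_sq {ν : Measure G} (φ ψ : EquivariantL2 ρ ν) :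
    ENNReal.ofReal (dist φ ψ ^ 2) = ∫⁻ x, edist (φ x) (ψ x) ^ 2 ∂ν := by
  rw [dist_sq, ofReal_integral_eq_lintegral_ofReal (integrable_dist_sq φ ψ)
    (Eventually.of_forall fun x => sq_nonneg _)]
  simp only [edist_dist, ENNReal.ofReal_pow dist_nonneg]

theorem _root_.edist_sq_le {Z : Type*} [PseudoEMetricSpace Z] (a b c : Z) :
    edist a c ^ 2 ≤ 4 * edist a b ^ 2 + 4 * edist b c ^ 2 := by
  have h : edist a c ≤ 2 * max (edist a b) (edist b c) := by
    rw [two_mul]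
    exact (edist_triangle a b c).trans (add_le_add (le_max_left _ _) (le_max_right _ _))
  calc edist a c ^ 2 ≤ (2 * max (edist a b) (edist b c)) ^ 2 := by gcongr
    _ = 4 * max (edist a b) (edist b c) ^ 2 := by rw [mul_pow]; norm_num
    _ ≤ _ := by
      rcases le_total (edist a b) (edist b c) with h | h
      · rw [max_eq_right h]; exact le_add_self
      · rw [max_eq_left h]; exact le_self_add

/-- The values of `φ` on `F` and on `σ • F` are close on average if `φ` is moved little by
`F⁻¹ σ F`. -/
theorem lintegral_edist_sq_le {L : Set G} (hL : MeasurableSet L) (σ : Γ)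
    (hFL : ∀ x ∈ F, ∀ y ∈ F, x⁻¹ * (σ * y) ∈ L) (φ : EquivariantL2 ρ (μ.restrict F)) {s : ℝ}
    (hs : ∀ g ∈ L, dist φ (translate hF g φ) ≤ s) :
    ∫⁻ x in F, ∫⁻ y in F, edist (φ x) (φ (σ • y)) ^ 2 ∂μ ∂μ ≤ ENNReal.ofReal (s ^ 2) * μ L := by
  have hmeas : StronglyMeasurable fun p : G × G => edist (φ p.1) (φ (p.1 * p.2)) ^ 2 := by
    have h := (φ.stronglyMeasurable.comp_measurable measurable_fst).dist
      (φ.stronglyMeasurable.comp_measurable (measurable_fst.mul measurable_snd) :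
        StronglyMeasurable fun p : G × G => φ (p.1 * p.2))
    simp only [edist_dist]
    exact (h.measurable.ennreal_ofReal.pow_const 2).stronglyMeasurable
  have hin : ∀ x ∈ F, ∫⁻ y in F, edist (φ x) (φ (σ • y)) ^ 2 ∂μ ≤
      ∫⁻ g in L, edist (φ x) (φ (x * g)) ^ 2 ∂μ := by
    intro x hx
    rw [← lintegral_indicator hF.measurableSet, ← lintegral_indicator hL,
      ← lintegral_mul_left_eq_self (L.indicator _) (x⁻¹ * σ)]
    refine lintegral_mono fun y => ?_
    by_cases hy : y ∈ F
    · rw [indicator_of_mem hy, indicator_of_mem (by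
        simpa only [mul_assoc] using hFL x hx y hy)]
      rw [Subgroup.smul_def, smul_eq_mul, mul_assoc, mul_inv_cancel_left]
    · rw [indicator_of_notMem hy]
      exact zero_le
  calc ∫⁻ x in F, ∫⁻ y in F, edist (φ x) (φ (σ • y)) ^ 2 ∂μ ∂μ
      ≤ ∫⁻ x in F, ∫⁻ g in L, edist (φ x) (φ (x * g)) ^ 2 ∂μ ∂μ :=
        setLIntegral_mono' hF.measurableSet hin
    _ = ∫⁻ g in L, ∫⁻ x in F, edist (φ x) (φ (x * g)) ^ 2 ∂μ ∂μ :=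
        lintegral_lintegral_swap hmeas.measurable.aemeasurable
    _ = ∫⁻ g in L, ENNReal.ofReal (dist φ (translate hF g φ) ^ 2) ∂μ :=
        lintegral_congr fun g => (ofReal_dist_sq φ (translate hF g φ)).symm
    _ ≤ ∫⁻ _ in L, ENNReal.ofReal (s ^ 2) ∂μ := by
        refine setLIntegral_mono' hL fun g hg => ENNReal.ofReal_le_ofReal ?_
        exact pow_le_pow_left₀ dist_nonneg (hs g hg) 2
    _ = _ := by rw [setLIntegral_const]

/-- If the displacement of a finite set grows linearly on `Z`, then the displacement of a suitable
compact set of right translations grows linearly on the space of equivariant maps. -/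
theorem exists_compact_coercive (S : Finset Γ) {l M : ℝ} (hl : 0 < l) {z₀ : Z}
    (hS : ∀ z, l * dist z z₀ ≤ displacement ρ S z + M) :
    ∃ L : Set G, IsCompact L ∧ ∃ c : ℝ, 0 ≤ c ∧ ∀ (φ : EquivariantL2 ρ (μ.restrict F)) (s : ℝ), 0 ≤ s →
      (∀ g ∈ L, dist φ (translate hF g φ) ≤ s) → dist φ (base hF ρ z₀) ≤ c * (s + 1) := by
  have : IsFiniteMeasure (μ.restrict F) := ⟨by simpa using hF.measure_lt_top μ⟩
  obtain ⟨K, hK, hFK⟩ := hF.exists_compact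
  set D : Γ → Set G := fun σ => closure (K⁻¹ * ({(σ : G)} * K))
  have hD : ∀ σ, IsCompact (D σ) := fun σ => (hK.inv.mul (isCompact_singleton.mul hK)).closure
  have hFD : ∀ σ : Γ, ∀ x ∈ F, ∀ y ∈ F, x⁻¹ * (σ * y) ∈ D σ := fun σ x hx y hy => subset_closure
    (mul_mem_mul (inv_mem_inv.2 (hFK hx)) (mul_mem_mul rfl (hFK hy)))
  have hDm : ∀ σ, MeasurableSet (D σ) := fun σ => isClosed_closure.measurableSet
  refine ⟨D 1 ∪ ⋃ σ ∈ S, D σ⁻¹, (hD 1).union (S.finite_toSet.isCompact_biUnion fun σ _ => hD _), ?_⟩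
  have hF0 : μ F ≠ 0 := (hF.isFundamentalDomain μ).measure_ne_zero (NeZero.ne μ)
  have hFt : μ F ≠ ⊤ := (hF.measure_lt_top μ).ne
  -- The mean square displacement of `σ` on `F`, by comparison of both points with all of `F`.
  have hσ : ∀ σ ∈ S, ∀ (φ : EquivariantL2 ρ (μ.restrict F)) (s : ℝ),
      (∀ g ∈ D 1 ∪ ⋃ σ ∈ S, D σ⁻¹, dist φ (translate hF g φ) ≤ s) →
      ∫⁻ x in F, edist (ρ σ (φ x)) (φ x) ^ 2 ∂μ ≤
        4 * (μ F)⁻¹ * (μ (D σ⁻¹) + μ (D 1)) * ENNReal.ofReal (s ^ 2) := by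
    intro σ hσS φ s hs
    have h₁ := φ.lintegral_edist_sq_le hF (hDm σ⁻¹) σ⁻¹ (hFD σ⁻¹)
      fun g hg => hs g (Or.inr (mem_iUnion₂.2 ⟨σ, hσS, hg⟩))
    have h₂ := φ.lintegral_edist_sq_le hF (hDm 1) 1 (hFD 1) fun g hg => hs g (Or.inl hg)
    simp only [one_smul] at h₂
    have hφ : ∀ x, Measurable fun y => edist (φ x) (φ y) ^ 2 := fun x => by
      simp only [edist_dist]
      exact ((stronglyMeasurable_const.dist φ.stronglyMeasurable).measurable.ennreal_ofReal.pow_const 2)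
    have key : μ F * ∫⁻ x in F, edist (ρ σ (φ x)) (φ x) ^ 2 ∂μ ≤
        4 * ∫⁻ x in F, ∫⁻ y in F, edist (φ x) (φ (σ⁻¹ • y)) ^ 2 ∂μ ∂μ +
        4 * ∫⁻ x in F, ∫⁻ y in F, edist (φ x) (φ y) ^ 2 ∂μ ∂μ := by
      have hint : Measurable fun x => ∫⁻ y in F, edist (φ x) (φ y) ^ 2 ∂μ := by
        refine Measurable.lintegral_prod_right' (f := fun p : G × G => edist (φ p.1) (φ p.2) ^ 2) ?_
        simp only [edist_dist]
        exact (((φ.stronglyMeasurable.comp_measurable measurable_fst).dist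
          (φ.stronglyMeasurable.comp_measurable measurable_snd)).measurable.ennreal_ofReal.pow_const 2)
      rw [← lintegral_const_mul' _ _ hFt, ← lintegral_const_mul' _ _ ENNReal.ofNat_ne_top,
        ← lintegral_const_mul' _ _ ENNReal.ofNat_ne_top, ← lintegral_add_right _ (hint.const_mul 4)]
      refine lintegral_mono fun x => ?_
      rw [← lintegral_const_mul' _ _ ENNReal.ofNat_ne_top, ← lintegral_const_mul' _ _ ENNReal.ofNat_ne_top,
        ← lintegral_add_right _ ((hφ x).const_mul 4), mul_comm, ← setLIntegral_const]
      refine lintegral_mono fun y => ?_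
      rw [φ.equivariant, map_inv, ← (ρ σ).edist_eq (φ x) ((ρ σ)⁻¹ _), IsometryEquiv.apply_inv_self,
        edist_comm (φ x) (φ y)]
      exact edist_sq_le _ _ _
    calc ∫⁻ x in F, edist (ρ σ (φ x)) (φ x) ^ 2 ∂μ
        = (μ F)⁻¹ * (μ F * ∫⁻ x in F, edist (ρ σ (φ x)) (φ x) ^ 2 ∂μ) := by
          rw [← mul_assoc, ENNReal.inv_mul_cancel hF0 hFt, one_mul]
      _ ≤ (μ F)⁻¹ * (4 * (ENNReal.ofReal (s ^ 2) * μ (D σ⁻¹)) + 4 * (ENNReal.ofReal (s ^ 2) * μ (D 1))) := by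
          gcongr
          exact key.trans (by gcongr)
      _ = _ := by ring
  set A : ℝ≥0∞ := ∑ σ ∈ S, 4 * (μ F)⁻¹ * (μ (D σ⁻¹) + μ (D 1))
  have hA : A ≠ ⊤ := by
    refine ENNReal.sum_ne_top.2 fun σ _ => ENNReal.mul_ne_top (ENNReal.mul_ne_top
      ENNReal.ofNat_ne_top (ENNReal.inv_ne_top.2 hF0)) (ENNReal.add_ne_top.2
        ⟨(hD _).measure_ne_top, (hD _).measure_ne_top⟩)
  have hdisp : ∀ z, (displacement ρ S z : ℝ) ^ 2 ≤ ∑ σ ∈ S, dist (ρ σ z) z ^ 2 := by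
    intro z
    rcases S.eq_empty_or_nonempty with rfl | hne
    · simp [displacement]
    · obtain ⟨σ, hσS, h⟩ := S.exists_mem_eq_sup hne fun σ => nndist (ρ σ z) z
      rw [displacement, h, coe_nndist]
      exact Finset.single_le_sum (f := fun σ => dist (ρ σ z) z ^ 2) (fun _ _ => sq_nonneg _) hσS
  have hpt : ∀ z, ENNReal.ofReal (l ^ 2) * edist z z₀ ^ 2 ≤
      2 * ∑ σ ∈ S, edist (ρ σ z) z ^ 2 + ENNReal.ofReal (2 * M ^ 2) := by
    intro z
    have h₁ : (l * dist z z₀) ^ 2 ≤ 2 * ∑ σ ∈ S, dist (ρ σ z) z ^ 2 + 2 * M ^ 2 := by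
      have h₂ := pow_le_pow_left₀ (mul_nonneg hl.le dist_nonneg) (hS z) 2
      have h₃ := hdisp z
      nlinarith [sq_nonneg ((displacement ρ S z : ℝ) - M)]
    have h₂ := ENNReal.ofReal_le_ofReal h₁
    have h0 : 0 ≤ ∑ σ ∈ S, dist (ρ σ z) z ^ 2 := Finset.sum_nonneg fun _ _ => sq_nonneg _
    rw [mul_pow, ENNReal.ofReal_mul (sq_nonneg l), ENNReal.ofReal_add (by positivity) (by positivity),
      ENNReal.ofReal_mul zero_le_two, ENNReal.ofReal_sum_of_nonneg fun _ _ => sq_nonneg _] at h₂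
    simpa only [edist_dist, ENNReal.ofReal_pow dist_nonneg, ENNReal.ofReal_ofNat] using h₂
  have hle : ∀ (φ : EquivariantL2 ρ (μ.restrict F)) (s : ℝ),
      (∀ g ∈ D 1 ∪ ⋃ σ ∈ S, D σ⁻¹, dist φ (translate hF g φ) ≤ s) →
      ENNReal.ofReal (l ^ 2) * ENNReal.ofReal (dist φ (base hF ρ z₀) ^ 2) ≤
        2 * (A * ENNReal.ofReal (s ^ 2)) + ENNReal.ofReal (2 * M ^ 2) * μ F := by
    intro φ s hs
    have hm : ∀ σ ∈ S, Measurable fun x => edist (ρ σ (φ x)) (φ x) ^ 2 := fun σ _ => by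
      simp only [edist_dist]
      exact ((((ρ σ).continuous.comp_stronglyMeasurable φ.stronglyMeasurable).dist
        φ.stronglyMeasurable).measurable.ennreal_ofReal.pow_const 2)
    rw [ofReal_dist_sq, ← lintegral_const_mul' _ _ ENNReal.ofReal_ne_top]
    calc ∫⁻ x in F, ENNReal.ofReal (l ^ 2) * edist (φ x) (base hF ρ z₀ x) ^ 2 ∂μ
        ≤ ∫⁻ x in F, (2 * ∑ σ ∈ S, edist (ρ σ (φ x)) (φ x) ^ 2 + ENNReal.ofReal (2 * M ^ 2)) ∂μ := by
          refine setLIntegral_mono' hF.measurableSet fun x hx => ?_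
          rw [base_of_mem hF hx]
          exact hpt _
      _ = 2 * ∑ σ ∈ S, ∫⁻ x in F, edist (ρ σ (φ x)) (φ x) ^ 2 ∂μ + ENNReal.ofReal (2 * M ^ 2) * μ F := by
          rw [lintegral_add_right _ measurable_const, lintegral_const_mul' _ _ ENNReal.ofNat_ne_top,
            lintegral_finsetSum _ hm, setLIntegral_const]
      _ ≤ _ := by
          rw [Finset.sum_mul]
          gcongr with σ hσS
          exact hσ σ hσS φ s hs
  refine ⟨Real.sqrt ((2 * A.toReal + 2 * M ^ 2 * μ.real F) / l ^ 2), Real.sqrt_nonneg _,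
    fun φ s hs0 hs => ?_⟩
  have h := ENNReal.toReal_mono (ENNReal.add_ne_top.2 ⟨ENNReal.mul_ne_top ENNReal.ofNat_ne_top
    (ENNReal.mul_ne_top hA ENNReal.ofReal_ne_top), ENNReal.mul_ne_top ENNReal.ofReal_ne_top hFt⟩)
    (hle φ s hs)
  rw [ENNReal.toReal_add (ENNReal.mul_ne_top ENNReal.ofNat_ne_top
    (ENNReal.mul_ne_top hA ENNReal.ofReal_ne_top)) (ENNReal.mul_ne_top ENNReal.ofReal_ne_top hFt)] at h
  simp only [ENNReal.toReal_mul, ENNReal.toReal_ofReal (sq_nonneg _), ENNReal.toReal_ofNat,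
    ENNReal.toReal_ofReal (show 0 ≤ 2 * M ^ 2 by positivity)] at h
  have hAr : 0 ≤ A.toReal := ENNReal.toReal_nonneg
  have hFr : 0 ≤ μ.real F := ENNReal.toReal_nonneg
  refine abs_le_of_sq_le_sq' ?_ (by positivity) |>.2
  rw [mul_pow, Real.sq_sqrt (by positivity), div_mul_eq_mul_div, le_div_iff₀ (by positivity)]
  change l ^ 2 * _ ≤ _ + 2 * M ^ 2 * μ.real F at h
  have h₁ : 2 * (A.toReal * s ^ 2) ≤ 2 * A.toReal * (s + 1) ^ 2 := by nlinarith
  have h₂ : 2 * M ^ 2 * μ.real F ≤ 2 * M ^ 2 * μ.real F * (s + 1) ^ 2 :=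
    le_mul_of_one_le_right (by positivity) (by nlinarith)
  linarith

end Translate

end EquivariantL2

end EquivariantTranslation

/-! ### Ergodicity of the irreducible lattice -/

section Ergodicity

open MeasureTheory
open scoped Pointwise symmDiff

/-- The idempotent endomorphisms `pA` and `pB` exhibit `G` as the product of their commuting
images. -/
structure IsProductDecomposition {G : Type*} [Group G] (pA pB : G →* G) : Prop where
  mul_eq : ∀ g, pA g * pB g = g
  commute : ∀ g h, pA g * pB h = pB h * pA g
  idem : ∀ g, pA (pA g) = pA g

namespace IsProductDecomposition

variable {G : Type*} [Group G] {pA pB : G →* G} (h : IsProductDecomposition pA pB)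
include h

/-- The image of `pA` is a normal subgroup. -/
theorem apply_conj (x a : G) : pA (x⁻¹ * pA a * x) = x⁻¹ * pA a * x := by
  have hx : x⁻¹ * pA a * x = (pA x)⁻¹ * pA a * pA x := by
    have hx : x = pB x * pA x := by rw [← h.commute, h.mul_eq]
    have hxi : x⁻¹ = (pA x)⁻¹ * (pB x)⁻¹ := by rw [← mul_inv_rev, ← hx]
    calc x⁻¹ * pA a * x = (pA x)⁻¹ * (pB x)⁻¹ * pA a * (pB x * pA x) := by rw [← hxi, ← hx]
      _ = (pA x)⁻¹ * (pB x)⁻¹ * (pA a * pB x) * pA x := by group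
      _ = _ := by rw [h.commute]; group
  rw [hx, map_mul, map_mul, map_inv, h.idem, h.idem]

end IsProductDecomposition

variable {G : Type*} [Group G] [TopologicalSpace G] [IsTopologicalGroup G] [MeasurableSpace G]
  [BorelSpace G] [LocallyCompactSpace G] [SecondCountableTopology G]
  {Γ : Subgroup G} {μ : Measure G} [μ.IsHaarMeasure]

/-- An invariant property that holds almost everywhere on a fundamental domain holds almost
everywhere. -/
theorem IsCocompactDomain.ae_of_ae_restrict {F : Set G} (hF : IsCocompactDomain Γ F) {p : G → Prop}
    (hp : ∀ (γ : Γ) x, p (γ • x) → p x) (h : ∀ᵐ x ∂μ.restrict F, p x) : ∀ᵐ x ∂μ, p x := by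
  have := hF.countable
  have h' : ∀ᵐ x ∂μ, x ∈ F → p x := (ae_restrict_iff' hF.measurableSet).1 h
  have h'' : ∀ᵐ x ∂μ, ∀ γ : Γ, γ • x ∈ F → p (γ • x) := ae_all_iff.2 fun γ =>
    (measurePreserving_mul_left μ (γ : G)).quasiMeasurePreserving.ae h'
  filter_upwards [h''] with x hx
  exact hp _ x (hx _ (hF.toDomain_smul_mem x))

variable [μ.IsMulRightInvariant]

/-- A measurable function that is invariant under the right translations by the image of `pA` is
invariant under the left translations by it, since this image is normal. -/
theorem ae_left_invariant_of_right {pA pB : G →* G} (hAB : IsProductDecomposition pA pB)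
    (hpA : Continuous pA) {u : G → ℝ} (hu : Measurable u)
    (hA : ∀ g, ∀ᵐ x ∂μ, u (x * pA g) = u x) (a : G) : ∀ᵐ x ∂μ, u (pA a * x) = u x := by
  have hmeas : MeasurableSet {p : G × G | u (p.2 * pA p.1) = u p.2} :=
    measurableSet_eq_fun (hu.comp (measurable_snd.mul (hpA.measurable.comp measurable_fst)))
      (hu.comp measurable_snd)
  have h₁ : ∀ᵐ x ∂μ, ∀ᵐ g ∂μ, u (x * pA g) = u x :=
    (Measure.ae_ae_comm hmeas).1 (Eventually.of_forall hA)
  have h₂ := (measurePreserving_mul_left μ (pA a)).quasiMeasurePreserving.ae h₁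
  filter_upwards [h₁, h₂] with x hx hax
  have hx' := (measurePreserving_mul_left μ (x⁻¹ * pA a * x)).quasiMeasurePreserving.ae hx
  obtain ⟨g, hg, hg'⟩ := (hax.and hx').exists
  rw [map_mul, hAB.apply_conj, show x * (x⁻¹ * pA a * x * pA g) = pA a * x * pA g by group] at hg'
  rw [← hg, hg']

/-- **Ergodicity** of the action of the image of `pA` on `Γ \ G`, for `Γ * pA G` dense in `G`. An
invariant function is also invariant under left translations by a dense set, and hence by all of `G`,
because left translation is continuous in measure. -/
theorem exists_ae_eq_const [μ.Regular] {pA pB : G →* G} (hAB : IsProductDecomposition pA pB)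
    (hpA : Continuous pA) (hdense : Dense {g : G | ∃ γ : Γ, ∃ a, g = γ * pA a})
    {u : G → ℝ} (hu : Measurable u)
    (hΓ : ∀ (γ : Γ) x, u (γ • x) = u x) (hA : ∀ g, ∀ᵐ x ∂μ, u (x * pA g) = u x) :
    ∃ c, ∀ᵐ x ∂μ, u x = c := by
  have hH : ∀ h ∈ {g : G | ∃ γ : Γ, ∃ a, g = γ * pA a}, ∀ᵐ x ∂μ, u (h * x) = u x := by
    rintro _ ⟨γ, a, rfl⟩
    filter_upwards [ae_left_invariant_of_right hAB hpA hu hA a] with x hx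
    rw [← hx, mul_assoc]
    exact hΓ γ _
  refine exists_eventuallyEq_const_of_forall_separating MeasurableSet fun U hU => ?_
  by_contra! hcon
  obtain ⟨hc₁, hc₂⟩ := hcon
  -- A set `Q` of finite positive measure on which `u` takes no value in `U`.
  obtain ⟨Q, hQm, hQu, hQ0, hQt⟩ : ∃ Q, MeasurableSet Q ∧ (∀ x ∈ Q, u x ∉ U) ∧ μ Q ≠ 0 ∧ μ Q ≠ ⊤ := by
    obtain ⟨Q, hQ, hQm, hQ0⟩ := Measure.exists_subset_measure_lt_top (μ := μ) (r := 0)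
      (s := {x | u x ∉ U}) (hu hU.compl) (by
        rw [pos_iff_ne_zero]
        intro h
        refine hc₁ ?_
        rw [ae_iff]
        simpa using h)
    exact ⟨Q, hQ, fun x hx => hQm hx, hQ0.1.ne', hQ0.2.ne⟩
  have hzero : ∀ h : G, μ {x | x ∈ Q ∧ u (h * x) ∈ U} = 0 := by
    intro h
    have hpre : ∀ k : G, μ {x | x ∈ Q ∧ u (k * x) ∈ U} = μ {y | k⁻¹ * y ∈ Q ∧ u y ∈ U} := fun k => by
      rw [← measure_preimage_mul μ k {y | k⁻¹ * y ∈ Q ∧ u y ∈ U}]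
      simp
    let R : G → C(G, G) := fun g => ⟨fun x => g⁻¹ * x, continuous_const_mul g⁻¹⟩
    have hR : Continuous R := ContinuousMap.continuous_of_continuous_uncurry _
      (by exact continuous_fst.inv.mul continuous_snd)
    have hlim := tendsto_measure_symmDiff_preimage_nhds_zero (μ := μ) (ν := μ) (s := Q) (hR.tendsto h)
      (Eventually.of_forall fun g => measurePreserving_mul_left μ g⁻¹)
      (measurePreserving_mul_left μ h⁻¹) hQm.nullMeasurableSet hQt
    refine le_antisymm (le_of_forall_pos_le_add fun ε hε => ?_) zero_le
    obtain ⟨k, hk, hkh⟩ := (mem_closure_iff_frequently.1 (hdense h)).and_eventually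
      ((tendsto_order.1 hlim).2 ε hε) |>.exists
    have hk0 : μ {x | x ∈ Q ∧ u (k * x) ∈ U} = 0 := by
      rw [← nonpos_iff_eq_zero, ← ae_iff.1 (hH k hk)]
      refine measure_mono fun x hx hx' => ?_
      exact hQu x hx.1 (hx' ▸ hx.2)
    rw [hpre] at hk0 ⊢
    calc μ {y | h⁻¹ * y ∈ Q ∧ u y ∈ U}
        ≤ μ ({y | k⁻¹ * y ∈ Q ∧ u y ∈ U} ∪ ((R k ⁻¹' Q) ∆ (R h ⁻¹' Q))) := by
          refine measure_mono fun y hy => ?_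
          by_cases hyk : k⁻¹ * y ∈ Q
          · exact Or.inl ⟨hyk, hy.2⟩
          · exact Or.inr (Or.inr ⟨hy.1, hyk⟩)
      _ ≤ 0 + ε := by
          refine (measure_union_le _ _).trans ?_
          rw [hk0]
          gcongr
  have hm : MeasurableSet {p : G × G | p.2 ∈ Q → u (p.1 * p.2) ∉ U} := by
    have h₁ : MeasurableSet {p : G × G | p.2 ∈ Q} := measurable_snd hQm
    have h₂ : MeasurableSet {p : G × G | u (p.1 * p.2) ∈ U} :=
      (hu.comp (measurable_fst.mul measurable_snd)) hU
    exact h₁.imp h₂.compl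
  have hae : ∀ᵐ x ∂μ, ∀ᵐ h ∂μ, x ∈ Q → u (h * x) ∉ U :=
    (Measure.ae_ae_comm hm).1 (Eventually.of_forall fun h => by
      rw [ae_iff]
      simpa using hzero h)
  have : ∃ x ∈ Q, ∀ᵐ h ∂μ, u (h * x) ∉ U := by
    by_contra! hno
    refine hQ0 (measure_mono_null (fun x hx => ?_) (ae_iff.1 hae))
    intro hx'
    exact hno x hx (hx'.mono fun h hh => hh hx)
  obtain ⟨x, -, hx⟩ := this
  refine hc₂ ?_
  have := (measurePreserving_mul_right μ x⁻¹).quasiMeasurePreserving.ae hx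
  simpa using this

end Ergodicity

/-! ### Parallel families of equivariant maps -/

section Parallel

open MeasureTheory
open scoped ENNReal

/-- The closure of a countable set under midpoints is countable. -/
theorem exists_countable_midClosed {Y : Type*} (m : Y → Y → Y) {S : Set Y} (hS : S.Countable) :
    ∃ P, S ⊆ P ∧ P.Countable ∧ MidClosed m P ∧ ∀ C, MidClosed m C → S ⊆ C → P ⊆ C := by
  let A : ℕ → Set Y := fun k => Nat.rec S (fun _ T => T ∪ image2 m T T) k
  have hsucc : ∀ k, A (k + 1) = A k ∪ image2 m (A k) (A k) := fun _ => rfl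
  have hmono : Monotone A := monotone_nat_of_le_succ fun k => by
    rw [hsucc]
    exact subset_union_left
  refine ⟨⋃ k, A k, subset_iUnion A 0, countable_iUnion fun k => ?_, ?_, fun C hC hSC => ?_⟩
  · induction k with
    | zero => exact hS
    | succ k ih => exact ih.union (ih.image2 ih m)
  · intro a ha b hb
    obtain ⟨i, hi⟩ := mem_iUnion.1 ha
    obtain ⟨j, hj⟩ := mem_iUnion.1 hb
    refine mem_iUnion.2 ⟨max i j + 1, Or.inr ⟨a, hmono (le_max_left _ _) hi, b,
      hmono (le_max_right _ _) hj, rfl⟩⟩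
  · refine iUnion_subset fun k => ?_
    induction k with
    | zero => exact hSC
    | succ k ih =>
      rintro x (hx | ⟨a, ha, b, hb, rfl⟩)
      · exact ih hx
      · exact hC a (ih ha) b (ih hb)

/-- Two dense families with the same distances in a complete space differ by an isometry. -/
theorem exists_isometryEquiv_of_denseRange {ι Z : Type*} [MetricSpace Z] [CompleteSpace Z]
    {u v : ι → Z} (hu : DenseRange u) (hv : DenseRange v)
    (h : ∀ i j, dist (u i) (u j) = dist (v i) (v j)) : ∃ T : Z ≃ᵢ Z, ∀ i, T (u i) = v i := by
  let _ : PseudoMetricSpace ι := .induced u inferInstance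
  have hui : Isometry u := Isometry.of_dist_eq fun i j => rfl
  have hvi : Isometry v := Isometry.of_dist_eq fun i j => (h i j).symm
  let U : AbstractCompletion ι := ⟨Z, u, _, inferInstance, inferInstance, hui.isUniformInducing, hu⟩
  let V : AbstractCompletion ι := ⟨Z, v, _, inferInstance, inferInstance, hvi.isUniformInducing, hv⟩
  let e : Z ≃ᵤ Z := U.compareEquiv V
  have he : ∀ i, e (u i) = v i := fun i => U.compare_coe V i
  refine ⟨⟨e.toEquiv, Isometry.of_dist_eq fun x y => ?_⟩, he⟩
  refine hu.induction_on₂ (p := fun x y => dist (e x) (e y) = dist x y) ?_ (fun i j => ?_) x y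
  · have hec : Continuous e := e.continuous
    exact isClosed_eq ((hec.comp continuous_fst).dist (hec.comp continuous_snd)) continuous_dist
  · rw [he, he, h]

variable {G : Type*} [Group G] [TopologicalSpace G] [MeasurableSpace G] {Γ : Subgroup G}
  {F : Set G} {Z : Type*} [MetricSpace Z] {ρ : Γ →* (Z ≃ᵢ Z)} {m : Z → Z → Z}

namespace EquivariantL2

/-- Equality in the comparison inequality for equivariant maps implies equality at almost every
point. -/
theorem ae_dist_eq_of_dist_mid_eq {ν : Measure G} (hm : IsUniformMidpoint m)
    {φ₁ φ₂ ψ₁ ψ₂ : EquivariantL2 ρ ν} (h₁ : dist φ₁ φ₂ = dist ψ₁ ψ₂)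
    (h₂ : dist φ₁ φ₂ = dist (mid hm φ₁ ψ₁) (mid hm φ₂ ψ₂)) : ∀ᵐ x ∂ν,
      dist (φ₁ x) (φ₂ x) = dist (ψ₁ x) (ψ₂ x) ∧
      dist (φ₁ x) (φ₂ x) = dist (m (φ₁ x) (ψ₁ x)) (m (φ₂ x) (ψ₂ x)) := by
  have hu := integrable_dist_sq φ₁ φ₂
  have hv := integrable_dist_sq ψ₁ ψ₂
  have hw := integrable_dist_sq (mid hm φ₁ ψ₁) (mid hm φ₂ ψ₂)
  have hle : ∀ x, dist (mid hm φ₁ ψ₁ x) (mid hm φ₂ ψ₂ x) ^ 2 +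
      (dist (φ₁ x) (φ₂ x) - dist (ψ₁ x) (ψ₂ x)) ^ 2 / 4 ≤
      (dist (φ₁ x) (φ₂ x) ^ 2 + dist (ψ₁ x) (ψ₂ x) ^ 2) / 2 := fun x => by
    have h := pow_le_pow_left₀ dist_nonneg (hm.comparison (φ₁ x) (ψ₁ x) (φ₂ x) (ψ₂ x)) 2
    rw [mid_apply, mid_apply]
    nlinarith
  have hint : Integrable (fun x => (dist (φ₁ x) (φ₂ x) ^ 2 + dist (ψ₁ x) (ψ₂ x) ^ 2) / 2 -
      dist (mid hm φ₁ ψ₁ x) (mid hm φ₂ ψ₂ x) ^ 2) ν := ((hu.add hv).div_const 2).sub hw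
  have hzero : ∫ x, ((dist (φ₁ x) (φ₂ x) ^ 2 + dist (ψ₁ x) (ψ₂ x) ^ 2) / 2 -
      dist (mid hm φ₁ ψ₁ x) (mid hm φ₂ ψ₂ x) ^ 2) ∂ν = 0 := by
    have h₃ : ∫ x, (dist (φ₁ x) (φ₂ x) ^ 2 + dist (ψ₁ x) (ψ₂ x) ^ 2) / 2 ∂ν = dist φ₁ φ₂ ^ 2 := by
      rw [integral_div, integral_add hu hv, ← dist_sq, ← dist_sq, ← h₁]
      ring
    refine (integral_sub ((hu.add hv).div_const 2) hw).trans ?_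
    rw [← dist_sq, ← h₂]
    exact sub_eq_zero.2 h₃
  have hnn : 0 ≤ fun x => (dist (φ₁ x) (φ₂ x) ^ 2 + dist (ψ₁ x) (ψ₂ x) ^ 2) / 2 -
      dist (mid hm φ₁ ψ₁ x) (mid hm φ₂ ψ₂ x) ^ 2 := fun x => by
    have := hle x
    have := sq_nonneg (dist (φ₁ x) (φ₂ x) - dist (ψ₁ x) (ψ₂ x))
    simp only [Pi.zero_apply]
    linarith
  filter_upwards [(integral_eq_zero_iff_of_nonneg hnn hint).1 hzero] with x hx
  have h := hle x
  simp only [Pi.zero_apply] at hx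
  have huv : dist (φ₁ x) (φ₂ x) = dist (ψ₁ x) (ψ₂ x) := by
    have : (dist (φ₁ x) (φ₂ x) - dist (ψ₁ x) (ψ₂ x)) ^ 2 ≤ 0 := by linarith
    exact sub_eq_zero.1 (pow_eq_zero_iff two_ne_zero |>.1 (le_antisymm this (sq_nonneg _)))
  refine ⟨huv, ?_⟩
  rw [← huv] at hx
  refine (pow_left_inj₀ dist_nonneg dist_nonneg two_ne_zero).1 ?_
  change _ = dist (mid hm φ₁ ψ₁ x) (mid hm φ₂ ψ₂ x) ^ 2
  linarith

variable [IsTopologicalGroup G] [BorelSpace G] [LocallyCompactSpace G] [SecondCountableTopology G]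
  [Countable Γ] {μ : Measure G} [μ.IsHaarMeasure] [μ.IsMulRightInvariant] [μ.Regular]
  {hF : IsCocompactDomain Γ F} {pA pB : G →* G}

theorem continuous_translate (φ : EquivariantL2 ρ (μ.restrict F)) :
    Continuous fun g => translate hF g φ := by
  refine continuous_iff_continuousAt.2 fun g => ?_
  have h : (fun k => translate hF k φ) = fun k => translate hF g (translate hF (g⁻¹ * k) φ) := by
    funext k
    rw [translate_translate, mul_inv_cancel_left]
  have h₁ : Tendsto (fun k => g⁻¹ * k) (𝓝 g) (𝓝 1) := by
    have := (continuous_const_mul g⁻¹).tendsto g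
    rwa [inv_mul_cancel] at this
  have h₂ := ((isometry_translate hF g).continuous.tendsto φ).comp ((tendsto_translate hF φ).comp h₁)
  rw [ContinuousAt, h]
  simpa only [inv_mul_cancel, translate_one, Function.comp_def] using h₂

/-- A set of equivariant maps on which all right translations by the image of `pA` have constant
displacement is parallel: the distance of two of its elements is almost everywhere constant.
By the parallelogram law this distance is invariant under the image of `pA`, which acts
ergodically. -/
theorem ae_dist_eq_const (hm : IsUniformMidpoint m) (hAB : IsProductDecomposition pA pB)
    (hpA : Continuous pA) (hdense : Dense {g : G | ∃ γ : Γ, ∃ a, g = γ * pA a})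
    {D : Set (EquivariantL2 ρ (μ.restrict F))} (hDm : MidClosed (mid hm) D)
    (hD : ∀ g, ∀ φ ∈ D, ∀ ψ ∈ D, dist φ (translate hF (pA g) φ) = dist ψ (translate hF (pA g) ψ))
    {φ ψ : EquivariantL2 ρ (μ.restrict F)} (hφ : φ ∈ D) (hψ : ψ ∈ D) :
    ∀ᵐ x ∂μ, dist (φ x) (ψ x) = (Real.sqrt (μ.real F))⁻¹ * dist φ ψ := by
  have : IsFiniteMeasure (μ.restrict F) := ⟨by simpa using hF.measure_lt_top μ⟩
  obtain ⟨c, hc⟩ := exists_ae_eq_const (μ := μ) (Γ := Γ) hAB hpA hdense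
    (u := fun x => dist (φ x) (ψ x)) (φ.stronglyMeasurable.dist ψ.stronglyMeasurable).measurable
    (fun γ x => dist_smul_smul φ ψ γ x) fun g => by
      refine hF.ae_of_ae_restrict (fun γ x hx => ?_) ?_
      · rw [← dist_smul_smul φ ψ γ x, ← hx, ← dist_smul_smul φ ψ γ (x * _)]
        simp only [Subgroup.smul_def, smul_eq_mul, mul_assoc]
      · filter_upwards [ae_dist_eq_of_dist_mid_eq hm (hD g φ hφ ψ hψ)
          (hD g φ hφ _ (hDm φ hφ ψ hψ))] with x hx
        exact (hm.parallelogram hx.1 hx.2).symm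
  have hc0 : 0 ≤ c := by
    obtain ⟨x, hx⟩ := hc.exists
    exact hx ▸ dist_nonneg
  have hpos : 0 < μ.real F := ENNReal.toReal_pos
    ((hF.isFundamentalDomain μ).measure_ne_zero (NeZero.ne μ)) (hF.measure_lt_top μ).ne
  have hdist := dist_eq_of_ae_const φ ψ hc0 (ae_restrict_of_ae hc)
  rw [measureReal_restrict_apply_univ] at hdist
  filter_upwards [hc] with x hx
  rw [hx, hdist, mul_comm c, inv_mul_cancel_left₀ (Real.sqrt_pos.2 hpos).ne']

/-- The displacement of the right translation by `pA g` is almost everywhere the same for all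
members of a parallel set. -/
theorem ae_dist_apply_mul (hm : IsUniformMidpoint m)
    {D : Set (EquivariantL2 ρ (μ.restrict F))} (hDm : MidClosed (mid hm) D)
    (hD : ∀ g, ∀ φ ∈ D, ∀ ψ ∈ D, dist φ (translate hF (pA g) φ) = dist ψ (translate hF (pA g) ψ))
    {φ ψ : EquivariantL2 ρ (μ.restrict F)} (hφ : φ ∈ D) (hψ : ψ ∈ D) (g : G) :
    ∀ᵐ x ∂μ, dist (φ x) (φ (x * pA g)) = dist (ψ x) (ψ (x * pA g)) := by
  refine hF.ae_of_ae_restrict (fun γ x hx => ?_) ?_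
  · simp only [Subgroup.smul_def, smul_eq_mul, mul_assoc] at hx
    simp only [← smul_eq_mul, ← Subgroup.smul_def, φ.equivariant, ψ.equivariant,
      IsometryEquiv.dist_eq] at hx
    exact hx
  · filter_upwards [ae_dist_eq_of_dist_mid_eq hm (hD g φ hφ ψ hψ)
      (hD g φ hφ _ (hDm φ hφ ψ hψ))] with x hx
    exact hx.1

/-- The alternative for a parallel set that is invariant under the right translations by the image
of `pB`: the closed convex sets that the set traces in `Z` are almost everywhere commensurated by
`Γ`. If they are bounded, so are the orbits of the image of `pB`. If they are all of `Z`, the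
translations by the image of `pA` induce isometries of constant displacement of `Z`, and a member of
the set descends to the image of `pB`. -/
theorem bounded_orbit_or_right_invariant [CompleteSpace Z] (hm : IsUniformMidpoint m)
    (hAB : IsProductDecomposition pA pB)
    (hpA : Continuous pA) (hpB : Continuous pB)
    (hdense : Dense {g : G | ∃ γ : Γ, ∃ a, g = γ * pA a})
    (hred : IsReducedAction ρ)
    (hcl : ∀ T : Z ≃ᵢ Z, (∀ a b, dist a (T a) = dist b (T b)) → ∀ a, T a = a)
    {D : Set (EquivariantL2 ρ (μ.restrict F))} (hne : D.Nonempty) (hDm : MidClosed (mid hm) D)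
    (hDB : ∀ g, ∀ φ ∈ D, translate hF (pB g) φ ∈ D)
    (hD : ∀ g, ∀ φ ∈ D, ∀ ψ ∈ D, dist φ (translate hF (pA g) φ) = dist ψ (translate hF (pA g) ψ)) :
    (∃ (φ : EquivariantL2 ρ (μ.restrict F)) (R : ℝ), ∀ g, dist φ (translate hF (pB g) φ) ≤ R) ∨
    ∃ φ : EquivariantL2 ρ (μ.restrict F), (∀ g, ∀ᵐ x ∂μ, φ (x * pA g) = φ x) ∧
      ∀ g, ∀ᵐ x ∂μ, dist (φ x) (φ (x * g)) =
        (Real.sqrt (μ.real F))⁻¹ * dist φ (translate hF g φ) := by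
  obtain ⟨φ₀, hφ₀⟩ := hne
  have hκ : 0 < (Real.sqrt (μ.real F))⁻¹ := inv_pos.2 (Real.sqrt_pos.2 (ENNReal.toReal_pos
    ((hF.isFundamentalDomain μ).measure_ne_zero (NeZero.ne μ)) (hF.measure_lt_top μ).ne))
  set κ := (Real.sqrt (μ.real F))⁻¹
  have hconst : ∀ φ ∈ D, ∀ ψ ∈ D, ∀ᵐ x ∂μ, dist (φ x) (ψ x) = κ * dist φ ψ := fun φ hφ ψ hψ =>
    ae_dist_eq_const hm hAB hpA hdense hDm hD hφ hψ
  -- A countable midpoint closed subset `P` of the parallel set, with invariant closure.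
  let d := TopologicalSpace.denseSeq G
  obtain ⟨P, hSP, hPc, hPm, hPmin⟩ := exists_countable_midClosed (mid hm)
    (countable_range fun k => translate hF (pB (d k)) φ₀)
  have hPD : P ⊆ D := hPmin D hDm (by rintro _ ⟨k, rfl⟩; exact hDB _ _ hφ₀)
  have hPcl : MidClosed (mid hm) (closure P) := (isUniformMidpoint_mid hm).midClosed_closure hPm
  have hinv : ∀ g, ∀ ψ ∈ P, translate hF (pB g) ψ ∈ closure P := by
    intro g
    refine hPmin {ψ | translate hF (pB g) ψ ∈ closure P} (fun φ hφ ψ hψ => ?_) ?_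
    · exact hPcl _ hφ _ hψ
    · rintro _ ⟨k, rfl⟩
      have hcont : Continuous fun h => translate hF (pB h) φ₀ := (continuous_translate (hF := hF) φ₀).comp hpB
      have hmem := hcont.range_subset_closure_image_dense (TopologicalSpace.denseRange_denseSeq G)
        (mem_range_self (g * d k))
      rw [← range_comp] at hmem
      simp only [mem_ofPred_eq, translate_translate, ← map_mul]
      exact closure_mono hSP hmem
  obtain ⟨ψ, rfl⟩ := hPc.exists_eq_range (by
    obtain ⟨x, hx⟩ := range_nonempty fun k => translate hF (pB (d k)) φ₀
    exact ⟨x, hSP hx⟩)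
  have hψD : ∀ k, ψ k ∈ D := fun k => hPD (mem_range_self k)
  have hpair : ∀ᵐ x ∂μ, ∀ i j, dist (ψ i x) (ψ j x) = κ * dist (ψ i) (ψ j) :=
    ae_all_iff.2 fun i => ae_all_iff.2 fun j => hconst _ (hψD i) _ (hψD j)
  let s : G → Set Z := fun x => range fun k => ψ k x
  have hsm : ∀ x, MidClosed m (s x) := by
    rintro x _ ⟨i, rfl⟩ _ ⟨j, rfl⟩
    obtain ⟨k, hk⟩ := hPm _ (mem_range_self i) _ (mem_range_self j)
    refine ⟨k, ?_⟩
    simp only [hk, mid_apply]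
  have hsγ : ∀ (γ : Γ) x, s (γ • x) = ρ γ '' s x := fun γ x => by
    simp only [s, (ψ _).equivariant, ← range_comp]
    rfl
  -- The traces of `P` are invariant under `pB` and at finite distance from their translates.
  have hB : ∀ g, ∀ᵐ x ∂μ, ∀ k, ψ k (x * pB g) ∈ closure (s x) := by
    refine fun g => ae_all_iff.2 fun k => ?_
    obtain ⟨χ, hχ, hlim⟩ := mem_closure_iff_seq_limit.1 (hinv g _ (mem_range_self k))
    filter_upwards [ae_all_iff.2 fun n => hconst (χ n) (hPD (hχ n)) _ (hDB g _ (hψD k))] with x hx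
    refine mem_closure_of_tendsto (f := fun n => χ n x) (b := atTop) ?_ (Eventually.of_forall fun n => ?_)
    · refine tendsto_iff_dist_tendsto_zero.2 ?_
      have := (tendsto_iff_dist_tendsto_zero.1 hlim).const_mul κ
      rw [mul_zero] at this
      exact this.congr fun n => (hx n).symm
    · obtain ⟨i, hi⟩ := hχ n
      exact ⟨i, by rw [← hi]⟩
  have hB0 : ∀ g, ∀ᵐ x ∂μ, Metric.hausdorffEDist (s x) (s (x * pB g)) = 0 := by
    intro g
    filter_upwards [hB g, (measurePreserving_mul_right μ (pB g)).quasiMeasurePreserving.ae (hB g⁻¹)]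
      with x h₁ h₂
    rw [Metric.hausdorffEDist_zero_iff_closure_eq_closure]
    refine subset_antisymm (closure_minimal ?_ isClosed_closure) (closure_minimal ?_ isClosed_closure)
    · rintro _ ⟨k, rfl⟩
      simpa only [map_inv, mul_inv_cancel_right] using h₂ k
    · rintro _ ⟨k, rfl⟩
      exact h₁ k
  have hpar : ∀ g, ∀ᵐ x ∂μ, ∀ k, dist (ψ k x) (ψ k (x * pA g)) = dist (ψ 0 x) (ψ 0 (x * pA g)) :=
    fun g => ae_all_iff.2 fun k => ae_dist_apply_mul hm hDm hD (hψD k) (hψD 0) g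
  have hfin : ∀ g, ∀ᵐ x ∂μ, Metric.hausdorffEDist (s x) (s (x * g)) ≠ ⊤ := by
    intro g
    filter_upwards [hpar g, (measurePreserving_mul_right μ (pA g)).quasiMeasurePreserving.ae (hB0 g)]
      with x h₁ h₂
    rw [mul_assoc, hAB.mul_eq] at h₂
    refine ne_top_of_le_ne_top ?_ (Metric.hausdorffEDist_triangle (t := s (x * pA g)))
    rw [h₂, add_zero]
    refine ne_top_of_le_ne_top (edist_ne_top (ψ 0 x) (ψ 0 (x * pA g)))
      (Metric.hausdorffEDist_le_of_mem_edist ?_ ?_)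
    · rintro _ ⟨k, rfl⟩
      exact ⟨_, mem_range_self k, by rw [edist_dist, edist_dist, h₁]⟩
    · rintro _ ⟨k, rfl⟩
      exact ⟨_, mem_range_self k, by rw [edist_comm, edist_dist, edist_dist, h₁]⟩
  -- Countability of the traces makes their Hausdorff distances measurable, so that Fubini applies.
  have hmeas : Measurable fun p : G × G => Metric.hausdorffEDist (s p.1) (s p.2) := by
    have h : ∀ i j, Measurable fun p : G × G => edist (ψ i p.1) (ψ j p.2) := fun i j => by
      simp only [edist_dist]
      exact (((ψ i).stronglyMeasurable.comp_measurable measurable_fst).dist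
        ((ψ j).stronglyMeasurable.comp_measurable measurable_snd)).measurable.ennreal_ofReal
    have h' : ∀ i j, Measurable fun p : G × G => edist (ψ i p.2) (ψ j p.1) := fun i j =>
      (h i j).comp measurable_swap
    simp only [Metric.hausdorffEDist_def, Metric.infEDist, s, iSup_range, iInf_range]
    exact (Measurable.iSup fun i => Measurable.iInf fun j => h i j).sup
      (Measurable.iSup fun i => Measurable.iInf fun j => h' i j)
  have hcomm : ∀ᵐ x ∂μ, ∀ᵐ y ∂μ, Metric.hausdorffEDist (s x) (s y) ≠ ⊤ := by
    have hms : MeasurableSet {p : G × G | Metric.hausdorffEDist (s p.2) (s (p.2 * p.1)) ≠ ⊤} :=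
      (hmeas.comp (measurable_snd.prodMk (measurable_snd.mul measurable_fst)))
        (measurableSet_singleton ⊤).compl
    filter_upwards [(Measure.ae_ae_comm (μ := μ) (ν := μ) hms).1 (Eventually.of_forall hfin)] with x hx
    have := (measurePreserving_mul_left μ x⁻¹).quasiMeasurePreserving.ae hx
    simpa only [mul_inv_cancel_left] using this
  have halt : ∀ᵐ x ∂μ, Bornology.IsBounded (s x) ∨ closure (s x) = univ := by
    filter_upwards [hcomm] with x hx
    by_contra! hcon
    refine hred ⟨closure (s x), fun hb => hcon.1 (hb.subset subset_closure), isClosed_closure,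
      hm.geodesicallyConvex isClosed_closure (hm.midClosed_closure (hsm x)), hcon.2, fun γ => ?_⟩
    have himg : ρ γ '' closure (s x) = closure (ρ γ '' s x) :=
      (ρ γ).toHomeomorph.image_closure (s x)
    rw [himg, Metric.hausdorffEDist_closure]
    obtain ⟨y, hy, hγy⟩ := (hx.and
      ((measurePreserving_mul_left μ (γ : G)).quasiMeasurePreserving.ae hx)).exists
    refine ne_top_of_le_ne_top ?_ (Metric.hausdorffEDist_triangle (t := s (γ • y)))
    refine ENNReal.add_ne_top.2 ⟨hγy, ?_⟩
    rw [hsγ, Metric.hausdorffEDist_image (ρ γ).isometry, Metric.hausdorffEDist_comm]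
    exact hy
  by_cases hall : ∀ᵐ x ∂μ, closure (s x) = univ
  · right
    -- The bijection `ψ k x ↦ ψ k (x * pA g)` extends to an isometry of `Z` of constant displacement.
    have hright : ∀ g, ∀ᵐ x ∂μ, ψ 0 (x * pA g) = ψ 0 x := by
      intro g
      have hq := (measurePreserving_mul_right μ (pA g)).quasiMeasurePreserving
      filter_upwards [hall, hq.ae hall, hpair, hq.ae hpair, hpar g] with x h₁ h₂ h₃ h₄ h₅
      have hd₁ : DenseRange fun k => ψ k x := dense_iff_closure_eq.2 h₁
      have hd₂ : DenseRange fun k => ψ k (x * pA g) := dense_iff_closure_eq.2 h₂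
      obtain ⟨T, hT⟩ := exists_isometryEquiv_of_denseRange hd₁ hd₂ fun i j => by rw [h₃, h₄]
      have hdispl : ∀ z, dist z (T z) = dist (ψ 0 x) (ψ 0 (x * pA g)) := fun z =>
        hd₁.induction_on (p := fun z => dist z (T z) = dist (ψ 0 x) (ψ 0 (x * pA g))) z
          (isClosed_eq (continuous_id.dist T.continuous) continuous_const)
          fun k => by rw [hT, h₅]
      rw [← hT 0]
      exact hcl T (fun a b => by rw [hdispl, hdispl]) _
    refine ⟨ψ 0, hright, fun g => ?_⟩
    have hg : ∀ᵐ x ∂μ, ψ 0 (x * g) = ψ 0 (x * pB g) := by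
      filter_upwards [(measurePreserving_mul_right μ (pB g)).quasiMeasurePreserving.ae (hright g)]
        with x hx
      rw [← hx, mul_assoc, ← hAB.commute, hAB.mul_eq]
    have hdg : dist (ψ 0) (translate hF g (ψ 0)) = dist (ψ 0) (translate hF (pB g) (ψ 0)) := by
      rw [dist_eq, dist_eq]
      congr 1
      refine eLpNorm_congr_ae (ae_restrict_of_ae ?_)
      filter_upwards [hg] with x hx
      rw [translate_apply, hx, translate_apply]
    filter_upwards [hg, hconst _ (hψD 0) _ (hDB g _ (hψD 0))] with x h₁ h₂
    rw [h₁, hdg, ← h₂, translate_apply]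
  · left
    obtain ⟨x, hx, hb, hp⟩ := (Filter.not_eventually.1 hall).and_eventually (halt.and hpair) |>.exists
    obtain ⟨R, hR⟩ := Metric.isBounded_iff.1 (hb.resolve_right hx)
    refine ⟨ψ 0, R / κ, fun g => ?_⟩
    have hball : range ψ ⊆ Metric.closedBall (ψ 0) (R / κ) := by
      rintro _ ⟨k, rfl⟩
      rw [Metric.mem_closedBall, le_div_iff₀ hκ, mul_comm, ← hp]
      exact hR (mem_range_self k) (mem_range_self 0)
    have := closure_minimal hball Metric.isClosed_closedBall (hinv g _ (mem_range_self 0))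
    rwa [Metric.mem_closedBall, dist_comm] at this

end EquivariantL2

end Parallel

/-! ### Minimal invariant convex sets of equivariant maps -/

section Minimal

open MeasureTheory
open scoped ENNReal

/-- Invariant closed convex sets that all meet a fixed ball contain minimal ones. -/
theorem IsUniformMidpoint.exists_minimal_invariant {Y : Type*} [PseudoMetricSpace Y]
    [CompleteSpace Y] {m : Y → Y → Y} (hm : IsUniformMidpoint m) {ι : Type*} (τ : ι → Y → Y)
    {C₀ : Set Y} (hne : C₀.Nonempty) (hcl : IsClosed C₀) (hmid : MidClosed m C₀)
    (hτ : ∀ i, ∀ y ∈ C₀, τ i y ∈ C₀) (x : Y) (R : ℝ)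
    (hR : ∀ C ⊆ C₀, C.Nonempty → IsClosed C → MidClosed m C → (∀ i, ∀ y ∈ C, τ i y ∈ C) →
      ∃ p ∈ C, dist x p ≤ R) :
    ∃ C ⊆ C₀, (C.Nonempty ∧ IsClosed C ∧ MidClosed m C ∧ ∀ i, ∀ y ∈ C, τ i y ∈ C) ∧
      ∀ C' ⊆ C, C'.Nonempty → IsClosed C' → MidClosed m C' → (∀ i, ∀ y ∈ C', τ i y ∈ C') →
        C ⊆ C' := by
  obtain ⟨C, hC, hmin⟩ := zorn_superset_nonempty {C | C ⊆ C₀ ∧ C.Nonempty ∧ IsClosed C ∧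
      MidClosed m C ∧ ∀ i, ∀ y ∈ C, τ i y ∈ C} (by
    intro 𝒮 h𝒮 hchain hne𝒮
    obtain ⟨p, hp, -⟩ := hm.exists_mem_sInter hne𝒮 hchain (fun C hC => (h𝒮 hC).2.2.1)
      (fun C hC => (h𝒮 hC).2.2.2.1) x (R := R)
      (fun C hC => hR C (h𝒮 hC).1 (h𝒮 hC).2.1 (h𝒮 hC).2.2.1 (h𝒮 hC).2.2.2.1 (h𝒮 hC).2.2.2.2)
    refine ⟨⋂₀ 𝒮, ⟨?_, ⟨p, hp⟩, isClosed_sInter fun C hC => (h𝒮 hC).2.2.1, ?_, ?_⟩,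
      fun C hC => sInter_subset_of_mem hC⟩
    · obtain ⟨C, hC⟩ := hne𝒮
      exact (sInter_subset_of_mem hC).trans (h𝒮 hC).1
    · exact fun a ha b hb C hC => (h𝒮 hC).2.2.2.1 a (ha C hC) b (hb C hC)
    · exact fun i y hy C hC => (h𝒮 hC).2.2.2.2 i y (hy C hC)) C₀ ⟨subset_rfl, hne, hcl, hmid, hτ⟩
  refine ⟨C, hC, hmin.prop.2, fun C' hC' h₁ h₂ h₃ h₄ => ?_⟩
  exact hmin.le_of_le ⟨hC'.trans hC, h₁, h₂, h₃, h₄⟩ hC'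

variable {G : Type*} [Group G] [TopologicalSpace G] [MeasurableSpace G] {Γ : Subgroup G}
  {F : Set G} {X : Type*} [MetricSpace X] {ρ : Γ →* (X ≃ᵢ X)} {m : X → X → X}
  {Z : Type*} [MetricSpace Z] {ρ' : Γ →* (Z ≃ᵢ Z)} {m' : Z → Z → Z}

namespace EquivariantL2

/-- Composition with an equivariant short map. -/
def map {ν : Measure G} (q : X → Z) (hq : LipschitzWith 1 q) (hqs : Function.Surjective q)
    (hqρ : ∀ γ x, q (ρ γ x) = ρ' γ (q x)) (φ : EquivariantL2 ρ ν) : EquivariantL2 ρ' ν where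
  toFun x := q (φ x)
  equivariant' γ x := by rw [φ.equivariant, hqρ]
  stronglyMeasurable' := hq.continuous.comp_stronglyMeasurable φ.stronglyMeasurable
  memLp' z := by
    obtain ⟨x₀, rfl⟩ := hqs z
    refine (φ.memLp x₀).of_le ((hq.continuous.comp_stronglyMeasurable φ.stronglyMeasurable).dist
      stronglyMeasurable_const).aestronglyMeasurable (Eventually.of_forall fun x => ?_)
    rw [Real.norm_of_nonneg dist_nonneg, Real.norm_of_nonneg dist_nonneg]
    simpa using hq.dist_le_mul (φ x) x₀

theorem lipschitzWith_map {ν : Measure G} {q : X → Z} (hq : LipschitzWith 1 q)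
    (hqs : Function.Surjective q) (hqρ : ∀ γ x, q (ρ γ x) = ρ' γ (q x)) :
    LipschitzWith 1 (map q hq hqs hqρ : EquivariantL2 ρ ν → EquivariantL2 ρ' ν) :=
  LipschitzWith.of_dist_le_mul fun φ ψ => by
    rw [NNReal.coe_one, one_mul]
    refine ENNReal.toReal_mono (memLp_dist φ ψ).eLpNorm_ne_top (eLpNorm_mono_real fun x => ?_)
    rw [Real.norm_of_nonneg dist_nonneg]
    have h := hq.dist_le_mul (φ x) (ψ x)
    rw [NNReal.coe_one, one_mul] at h
    exact h

variable [IsTopologicalGroup G] [BorelSpace G] [LocallyCompactSpace G] [SecondCountableTopology G]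
  [Countable Γ] {μ : Measure G} [μ.IsHaarMeasure] [μ.IsMulRightInvariant] [μ.Regular]
  {pA pB : G →* G}

theorem dist_translate_le (hF : IsCocompactDomain Γ F) (g : G) (φ ψ : EquivariantL2 ρ (μ.restrict F)) :
    dist φ (translate hF g φ) ≤ 2 * dist φ ψ + dist ψ (translate hF g ψ) := by
  have h₁ := dist_triangle4 φ ψ (translate hF g ψ) (translate hF g φ)
  rw [(isometry_translate hF g).dist_eq, dist_comm ψ φ] at h₁
  linarith

/-- If the displacement grows linearly on `X`, there is a convex set of equivariant maps to `X`,
invariant under the translations by the image of `pB`, on the image of which in the maps to the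
quotient `Z` the translations by the image of `pA` have constant displacement. -/
theorem exists_parallel_set [CompleteSpace X] (hF : IsCocompactDomain Γ F)
    (hm : IsUniformMidpoint m) (hm' : IsUniformMidpoint m')
    (hAB : IsProductDecomposition pA pB) (hpA : Continuous pA) (hpB : Continuous pB)
    {q : X → Z} (hq : LipschitzWith 1 q) (hqs : Function.Surjective q)
    (hqρ : ∀ γ x, q (ρ γ x) = ρ' γ (q x)) (hqm : ∀ x y, m' (q x) (q y) = q (m x y))
    (S : Finset Γ) {l M : ℝ} (hl : 0 < l) {z₀ : X}
    (hS : ∀ z, l * dist z z₀ ≤ displacement ρ S z + M) :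
    ∃ D : Set (EquivariantL2 ρ' (μ.restrict F)), D.Nonempty ∧ MidClosed (mid hm') D ∧
      (∀ g, ∀ φ ∈ D, translate hF (pB g) φ ∈ D) ∧
      ∀ g, ∀ φ ∈ D, ∀ ψ ∈ D, dist φ (translate hF (pA g) φ) = dist ψ (translate hF (pA g) ψ) := by
  have := completeSpace (ρ := ρ) (μ := μ) hF
  have hM := isUniformMidpoint_mid (ρ := ρ) (ν := μ.restrict F) hm
  obtain ⟨L, hL, c, hc, hcoer⟩ := exists_compact_coercive (μ := μ) hF S hl hS
  set e : EquivariantL2 ρ (μ.restrict F) := base hF ρ z₀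
  obtain ⟨MA, hMA⟩ := exists_dist_translate_base_le (ρ := ρ) (μ := μ) hF z₀ (hL.image hpA)
  obtain ⟨MB₀, hMB₀⟩ := exists_dist_translate_base_le (ρ := ρ) (μ := μ) hF z₀ (hL.image hpB)
  obtain ⟨MB, hMB0, hMB⟩ : ∃ MB : ℝ, 0 ≤ MB ∧ ∀ g ∈ L, dist e (translate hF (pB g) e) ≤ MB :=
    ⟨max MB₀ 0, le_max_right _ _, fun g hg => (hMB₀ _ (mem_image_of_mem _ hg)).trans (le_max_left _ _)⟩
  set M₁ : ℝ := max MA 0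
  let C₀ : Set (EquivariantL2 ρ (μ.restrict F)) := {φ | ∀ g ∈ L, dist φ (translate hF (pA g) φ) ≤ M₁}
  have hswap : ∀ g h (φ : EquivariantL2 ρ (μ.restrict F)), translate hF (pA g) (translate hF (pB h) φ) =
      translate hF (pB h) (translate hF (pA g) φ) := fun g h φ => by
    rw [translate_translate, translate_translate, hAB.commute]
  have hdisplA : ∀ g h (φ : EquivariantL2 ρ (μ.restrict F)), dist (translate hF (pB h) φ)
      (translate hF (pA g) (translate hF (pB h) φ)) = dist φ (translate hF (pA g) φ) := fun g h φ => by
    rw [hswap, (isometry_translate hF _).dist_eq]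
  have hC₀cl : IsClosed C₀ := by
    simp only [C₀, ofPred_forall]
    exact isClosed_biInter fun g _ =>
      isClosed_le (continuous_id.dist (isometry_translate hF (pA g)).continuous) continuous_const
  have hC₀m : MidClosed (mid hm) C₀ := fun φ hφ ψ hψ g hg => by
    have h₁ := hM.comparison φ ψ (translate hF (pA g) φ) (translate hF (pA g) ψ)
    rw [translate_mid]
    have := hφ g hg
    have := hψ g hg
    linarith
  obtain ⟨ε, hε, hcε⟩ : ∃ ε : ℝ, 0 < ε ∧ c * ε ≤ 1 / 2 := by
    refine ⟨1 / (2 * (c + 1)), by positivity, ?_⟩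
    rw [mul_one_div, div_le_div_iff₀ (by positivity) two_pos]
    linarith
  obtain ⟨δ, hδ, huc⟩ := hM.uniform ε hε
  -- A point of an invariant convex set nearest to `e` is moved little by `pB`, by uniform convexity.
  have hball : ∀ C ⊆ C₀, C.Nonempty → IsClosed C → MidClosed (mid hm) C →
      (∀ g, ∀ φ ∈ C, translate hF (pB g) φ ∈ C) →
      ∃ p ∈ C, dist e p ≤ max (MB / δ) (2 * (c * (M₁ + ε * MB + 1))) := by
    intro C hC hne hcl hmid hinv
    obtain ⟨φ, hφ, hmin⟩ := hM.exists_nearest hne hcl hmid e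
    refine ⟨φ, hφ, ?_⟩
    by_contra! hlt
    obtain ⟨hlt₁, hlt₂⟩ := max_lt_iff.1 hlt
    have hR : 0 < dist e φ := (div_nonneg hMB0 hδ.le).trans_lt hlt₁
    rw [div_lt_iff₀ hδ] at hlt₁
    have hB : ∀ g ∈ L, dist φ (translate hF (pB g) φ) ≤ ε * (dist e φ + MB) := by
      intro g hg
      by_contra! hgt
      have h₁ : dist e (translate hF (pB g) φ) ≤ dist e φ + MB := by
        have := dist_triangle e (translate hF (pB g) e) (translate hF (pB g) φ)
        rw [(isometry_translate hF _).dist_eq] at this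
        linarith [hMB g hg]
      have h₂ := huc (dist e φ + MB) (by positivity) e φ _ (by linarith) h₁ hgt.le
      have h₃ := hmin _ (hmid φ hφ _ (hinv g φ hφ))
      nlinarith [mul_nonneg hδ.le hMB0]
    have h := hcoer φ (M₁ + ε * (dist e φ + MB)) (by positivity) fun g hg => by
      have h₁ := dist_triangle φ (translate hF (pA g) φ) (translate hF (pA g) (translate hF (pB g) φ))
      rw [(isometry_translate hF _).dist_eq, translate_translate, hAB.mul_eq] at h₁
      linarith [hC hφ g hg, hB g hg]
    rw [dist_comm] at h
    nlinarith
  obtain ⟨C, hCC₀, ⟨hne, hcl, hmid, hinv⟩, hmin⟩ := hM.exists_minimal_invariant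
    (fun g => translate hF (pB g)) (C₀ := C₀)
    ⟨e, fun g hg => (hMA _ (mem_image_of_mem _ hg)).trans (le_max_left _ _)⟩ hC₀cl hC₀m
    (fun h φ hφ g hg => by rw [hdisplA]; exact hφ g hg) e _ hball
  let π : EquivariantL2 ρ (μ.restrict F) → EquivariantL2 ρ' (μ.restrict F) := map q hq hqs hqρ
  have hπc : Continuous π := (lipschitzWith_map hq hqs hqρ).continuous
  have hπm : ∀ φ ψ, mid hm' (π φ) (π ψ) = π (mid hm φ ψ) := fun φ ψ => by
    simp only [mid, π, map, hqm]
  have hπt : ∀ g φ, translate hF g (π φ) = π (translate hF g φ) := fun g φ => rfl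
  have hM' := isUniformMidpoint_mid (ρ := ρ') (ν := μ.restrict F) hm'
  -- Convex invariant functions are constant on a minimal set.
  have hle : ∀ g, ∀ φ ∈ C, ∀ ψ ∈ C, dist (π ψ) (translate hF (pA g) (π ψ)) ≤
      dist (π φ) (translate hF (pA g) (π φ)) := by
    intro g φ hφ ψ hψ
    have := hmin (C ∩ {ψ | dist (π ψ) (translate hF (pA g) (π ψ)) ≤
      dist (π φ) (translate hF (pA g) (π φ))}) inter_subset_left ⟨φ, hφ, le_refl (dist _ _)⟩
      (hcl.inter (isClosed_le (hπc.dist ((isometry_translate hF (pA g)).continuous.comp hπc))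
        continuous_const))
      (hmid.inter fun a ha b hb => by
        have h₁ := hM'.comparison (π a) (π b) (translate hF (pA g) (π a)) (translate hF (pA g) (π b))
        rw [← translate_mid, hπm] at h₁
        have := mem_ofPred.1 ha
        have := mem_ofPred.1 hb
        refine mem_ofPred.2 ?_
        linarith)
      (fun h χ hχ => ⟨hinv h χ hχ.1, by
        have h₁ := mem_ofPred.1 hχ.2
        refine mem_ofPred.2 (le_trans (le_of_eq ?_) h₁)
        rw [← hπt, translate_translate, hAB.commute, ← translate_translate,
          (isometry_translate hF _).dist_eq]⟩)
    exact (this hψ).2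
  refine ⟨π '' C, hne.image π, ?_, ?_, ?_⟩
  · rintro _ ⟨φ, hφ, rfl⟩ _ ⟨ψ, hψ, rfl⟩
    exact ⟨_, hmid φ hφ ψ hψ, (hπm φ ψ).symm⟩
  · rintro g _ ⟨φ, hφ, rfl⟩
    exact ⟨_, hinv g φ hφ, (hπt _ φ).symm⟩
  · rintro g _ ⟨φ, hφ, rfl⟩ _ ⟨ψ, hψ, rfl⟩
    exact le_antisymm (hle g ψ hψ φ hφ) (hle g φ hφ ψ hψ)

/-- A measurable equivariant map whose displacement under right translations is almost everywhere
constant agrees almost everywhere with a continuous one. -/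
theorem exists_continuous_equivariant [CompleteSpace Z]
    (φ : EquivariantL2 ρ' (μ.restrict F)) {δ : G → ℝ} (hδc : Continuous δ) (hδ1 : δ 1 = 0)
    (hA : ∀ g, ∀ᵐ x ∂μ, φ (x * pA g) = φ x)
    (hδ : ∀ g, ∀ᵐ x ∂μ, dist (φ x) (φ (x * g)) = δ g) :
    ∃ p : G → Z, Continuous p ∧ (∀ (γ : Γ) x, p (γ • x) = ρ' γ (p x)) ∧
      ∀ x g, p (x * pA g) = p x := by
  have hms : MeasurableSet {p : G × G | dist (φ p.2) (φ (p.2 * p.1)) = δ p.1} :=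
    measurableSet_eq_fun ((φ.stronglyMeasurable.comp_measurable measurable_snd).dist
      (φ.stronglyMeasurable.comp_measurable (measurable_snd.mul measurable_fst))).measurable
      (hδc.measurable.comp measurable_fst)
  set D : Set G := {x | ∀ᵐ y ∂μ, dist (φ x) (φ y) = δ (x⁻¹ * y)}
  have hDae : ∀ᵐ x ∂μ, x ∈ D := by
    filter_upwards [(Measure.ae_ae_comm (μ := μ) (ν := μ) hms).1 (Eventually.of_forall hδ)] with x hx
    have := (measurePreserving_mul_left μ x⁻¹).quasiMeasurePreserving.ae hx
    simp only [mul_inv_cancel_left] at this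
    exact this
  have hDd : Dense D := Measure.dense_of_ae hDae
  -- The relation extends from almost all to all pairs in `D`, as an inequality.
  have hle : ∀ x ∈ D, ∀ y ∈ D, dist (φ x) (φ y) ≤ δ (x⁻¹ * y) := by
    intro x hx y hy
    have hcl : IsClosed {z | dist (φ x) (φ y) ≤ δ (x⁻¹ * z) + δ (y⁻¹ * z)} :=
      isClosed_le continuous_const (by fun_prop)
    have hdense : Dense {z | dist (φ x) (φ y) ≤ δ (x⁻¹ * z) + δ (y⁻¹ * z)} := by
      refine Measure.dense_of_ae (μ := μ) ?_
      filter_upwards [hx, hy] with z h₁ h₂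
      rw [← h₁, ← h₂]
      exact dist_triangle_right _ _ _
    have : dist (φ x) (φ y) ≤ δ (x⁻¹ * y) + δ (y⁻¹ * y) := hcl.closure_subset (hdense y)
    rw [inv_mul_cancel, hδ1, add_zero] at this
    exact this
  have hdi : IsDenseInducing (Subtype.val : D → G) := hDd.isDenseInducing_val
  let f : D → Z := fun x => φ x
  have hlim : ∀ x, ∃ c, Tendsto f (comap Subtype.val (𝓝 x)) (𝓝 c) := by
    intro x
    have : (comap (Subtype.val : D → G) (𝓝 x)).NeBot := hdi.comap_nhds_neBot x
    refine CompleteSpace.complete (cauchy_map_iff'.2 (tendsto_uniformity_iff_dist_tendsto_zero.2 ?_))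
    have h₁ : Tendsto (fun p : D × D => δ ((p.1 : G)⁻¹ * p.2))
        (comap Subtype.val (𝓝 x) ×ˢ comap Subtype.val (𝓝 x)) (𝓝 0) := by
      have hc : Tendsto (fun p : G × G => δ (p.1⁻¹ * p.2)) (𝓝 x ×ˢ 𝓝 x) (𝓝 0) := by
        have := (show Continuous fun p : G × G => δ (p.1⁻¹ * p.2) by fun_prop).tendsto (x, x)
        simpa only [inv_mul_cancel, hδ1, nhds_prod_eq] using this
      exact hc.comp (tendsto_comap.prodMap tendsto_comap)
    exact squeeze_zero (fun _ => dist_nonneg) (fun p => hle _ p.1.2 _ p.2.2) h₁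
  set p : G → Z := hdi.extend f
  have hpc : Continuous p := hdi.continuous_extend hlim
  have hpD : ∀ x ∈ D, p x = φ x := by
    intro x hx
    obtain ⟨c, hc⟩ := hlim x
    have hc' : Tendsto f (𝓝 ⟨x, hx⟩) (𝓝 c) := by rwa [nhds_subtype]
    exact hdi.extend_eq_at' (a := (⟨x, hx⟩ : D)) c hc'
  have hae : ∀ᵐ x ∂μ, p x = φ x := hDae.mono hpD
  refine ⟨p, hpc, fun γ => ?_, fun x g => ?_⟩
  · refine congr_fun (Measure.eq_of_ae_eq (μ := μ) ?_ (by exact hpc.comp (continuous_const_smul γ))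
      ((ρ' γ).continuous.comp hpc))
    filter_upwards [hae, (measurePreserving_mul_left μ (γ : G)).quasiMeasurePreserving.ae hae] with x h₁ h₂
    change p (γ * x) = ρ' γ (p x)
    rw [h₂, h₁]
    exact φ.equivariant γ x
  · refine congr_fun (Measure.eq_of_ae_eq (μ := μ) (f := fun x => p (x * pA g)) ?_
      (hpc.comp (continuous_mul_const _)) hpc) x
    filter_upwards [hae, (measurePreserving_mul_right μ (pA g)).quasiMeasurePreserving.ae hae, hA g]
      with x h₁ h₂ h₃
    rw [h₂, h₃, h₁]

/-- If the right translations have bounded orbits, the action on the target has a fixed point: a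
circumcenter of an orbit is an equivariant map invariant under right translations, and hence almost
everywhere constant. -/
theorem exists_fixed_point [CompleteSpace Z] (hF : IsCocompactDomain Γ F)
    (hm' : IsUniformMidpoint m') (φ : EquivariantL2 ρ' (μ.restrict F)) {R : ℝ}
    (hR : ∀ g, dist φ (translate hF g φ) ≤ R) : ∃ z, ∀ γ, ρ' γ z = z := by
  have := completeSpace (ρ := ρ') (μ := μ) hF
  obtain ⟨ψ, hψ⟩ := (isUniformMidpoint_mid (ρ := ρ') (ν := μ.restrict F) hm').exists_circumcenter
    (S := range fun g => translate hF g φ) (range_nonempty _)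
    (Metric.isBounded_closedBall (x := φ) (r := R) |>.subset (by
      rintro _ ⟨g, rfl⟩
      rw [Metric.mem_closedBall, dist_comm]
      exact hR g))
  have hg : ∀ g, ∀ᵐ x ∂μ, dist (ψ (x * g)) (ψ x) = 0 := by
    intro g
    refine hF.ae_of_ae_restrict (fun γ x hx => ?_) ?_
    · rwa [smul_mul_assoc, ψ.equivariant, ψ.equivariant, IsometryEquiv.dist_eq] at hx
    · have := (dist_eq_zero_iff _ _).1 (hψ _ (isometry_translate hF g) (by
        rintro _ ⟨h, rfl⟩
        exact ⟨_, ⟨g⁻¹ * h, rfl⟩, by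
          simp only [translate_translate, mul_inv_cancel_left]⟩))
      filter_upwards [this] with x hx
      rw [← translate_apply hF, hx, dist_self]
  have hms : MeasurableSet {p : G × G | dist (ψ (p.2 * p.1)) (ψ p.2) = 0} :=
    measurableSet_eq_fun ((ψ.stronglyMeasurable.comp_measurable (measurable_snd.mul measurable_fst)).dist
      (ψ.stronglyMeasurable.comp_measurable measurable_snd)).measurable measurable_const
  obtain ⟨x, hx⟩ := ((Measure.ae_ae_comm (μ := μ) (ν := μ) hms).1 (Eventually.of_forall hg)).exists
  have hx' := (measurePreserving_mul_left μ x⁻¹).quasiMeasurePreserving.ae hx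
  simp only [mul_inv_cancel_left, dist_eq_zero] at hx'
  refine ⟨ψ x, fun γ => ?_⟩
  obtain ⟨y, hy, hγy⟩ := (hx'.and
    ((measurePreserving_mul_left μ (γ : G)).quasiMeasurePreserving.ae hx')).exists
  rw [← hγy]
  conv_lhs => rw [hγy, ← hy]
  exact (ψ.equivariant γ y).symm

end EquivariantL2

end Minimal

/-! ### Linear growth of the displacement -/

section Growth

variable {Γ : Type*} [Group Γ] {X : Type*}

theorem dist_le_displacement [PseudoMetricSpace X] (ρ : Γ →* (X ≃ᵢ X)) {S : Finset Γ} {σ : Γ}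
    (hσ : σ ∈ S) (x : X) : dist (ρ σ x) x ≤ displacement ρ S x := by
  rw [dist_nndist]
  exact NNReal.coe_le_coe.2 (Finset.le_sup (f := fun σ => nndist (ρ σ x) x) hσ)

theorem displacement_le [PseudoMetricSpace X] (ρ : Γ →* (X ≃ᵢ X)) {S : Finset Γ} {x : X} {r : ℝ}
    (hr : 0 ≤ r) (h : ∀ σ ∈ S, dist (ρ σ x) x ≤ r) : (displacement ρ S x : ℝ) ≤ r := by
  lift r to NNReal using hr
  exact NNReal.coe_le_coe.2 (Finset.sup_le fun σ hσ => by exact_mod_cast h σ hσ)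

theorem IsUniformMidpoint.displacement_mid_le [MetricSpace X] {m : X → X → X}
    (hm : IsUniformMidpoint m) (ρ : Γ →* (X ≃ᵢ X)) (S : Finset Γ) (x y : X) :
    (displacement ρ S (m x y) : ℝ) ≤ (displacement ρ S x + displacement ρ S y) / 2 := by
  refine displacement_le ρ (by positivity) fun σ hσ => ?_
  rw [hm.map_mid (ρ σ).isometry]
  have h := hm.comparison (ρ σ x) (ρ σ y) x y
  have h₁ := dist_le_displacement ρ hσ x
  have h₂ := dist_le_displacement ρ hσ y
  linarith

/-- By convexity, a displacement function that tends to infinity grows at least linearly. -/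
theorem IsUniformMidpoint.exists_linear_le_displacement [MetricSpace X] {m : X → X → X}
    (hm : IsUniformMidpoint m) {ρ : Γ →* (X ≃ᵢ X)} {S : Finset Γ}
    (h : DisplacementTendsToInfinity ρ S) (z₀ : X) :
    ∃ l M : ℝ, 0 < l ∧ ∀ z, l * dist z z₀ ≤ displacement ρ S z + M := by
  obtain ⟨R, hR0, hR⟩ : ∃ R : ℝ, 0 < R ∧ ∀ z, R ≤ dist z z₀ →
      (displacement ρ S z₀ : ℝ) + 1 ≤ displacement ρ S z := by
    have h₁ : ∀ᶠ z in Bornology.cobounded X, displacement ρ S z₀ + 1 ≤ displacement ρ S z :=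
      h.eventually_ge_atTop _
    obtain ⟨R, -, hR⟩ := (Metric.hasBasis_cobounded_compl_closedBall z₀).eventually_iff.1 h₁
    refine ⟨max R 0 + 1, by positivity, fun z hz => ?_⟩
    have hz' : z ∈ (Metric.closedBall z₀ R)ᶜ := fun hmem => by
      have := Metric.mem_closedBall.1 hmem
      linarith [le_max_left R 0]
    exact_mod_cast hR hz'
  have hpow : ∀ (k : ℕ) z, 2 ^ k * R ≤ dist z z₀ →
      (2 : ℝ) ^ k ≤ displacement ρ S z - displacement ρ S z₀ := by
    intro k
    induction k with
    | zero =>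
      intro z hz
      have := hR z (by simpa using hz)
      rw [pow_zero]
      linarith
    | succ k ih =>
      intro z hz
      have h₁ := ih (m z z₀) (by
        rw [hm.dist_right]
        rw [pow_succ] at hz
        linarith)
      have h₂ := hm.displacement_mid_le ρ S z z₀
      rw [pow_succ]
      linarith
  refine ⟨1 / (2 * R), 1, by positivity, fun z => ?_⟩
  have hd : (0 : ℝ) ≤ displacement ρ S z := NNReal.coe_nonneg _
  have hd₀ : (0 : ℝ) ≤ displacement ρ S z₀ := NNReal.coe_nonneg _
  rw [one_div_mul_eq_div, div_le_iff₀ (by positivity)]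
  rcases lt_or_ge (dist z z₀) R with hlt | hge
  · nlinarith
  · obtain ⟨k, hk₁, hk₂⟩ := exists_nat_pow_near ((one_le_div hR0).2 hge) one_lt_two
    rw [le_div_iff₀ hR0] at hk₁
    rw [div_lt_iff₀ hR0, pow_succ] at hk₂
    have := hpow k z hk₁
    nlinarith

end Growth

/-! ### Second countable group topologies -/

section Coarser

open scoped Pointwise

theorem isCompact_of_le {H : Type*} {t₁ t₂ : TopologicalSpace H} (h : t₁ ≤ t₂) {K : Set H}
    (hK : @IsCompact H t₁ K) : @IsCompact H t₂ K := by
  have := @IsCompact.image _ _ t₁ t₂ _ _ hK (continuous_id_of_le h)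
  rwa [image_id] at this

/-- The powers of a compact generating set exhaust the group by compact sets. -/
theorem IsCompactlyGeneratedGroup.sigmaCompactSpace {H : Type*} [Group H] [TopologicalSpace H]
    [IsTopologicalGroup H] (hH : IsCompactlyGeneratedGroup H) : SigmaCompactSpace H := by
  obtain ⟨K, hK, hKt⟩ := hH
  let A : ℕ → Set H := fun k => (K ∪ K⁻¹) ^ k
  have hA : ∀ k, IsCompact (A k) := fun k => by
    induction k with
    | zero =>
      simp only [A, pow_zero]
      exact isCompact_singleton
    | succ k ih =>
      simp only [A, pow_succ]
      exact ih.mul (hK.union hK.inv)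
  refine ⟨⟨A, hA, eq_univ_of_forall fun x => ?_⟩⟩
  have hx : x ∈ Subgroup.closure K := hKt ▸ Subgroup.mem_top x
  induction hx using Subgroup.closure_induction_right with
  | one => exact mem_iUnion.2 ⟨0, by simp [A]⟩
  | mul_right x _ y hy ih =>
    obtain ⟨k, hk⟩ := mem_iUnion.1 ih
    exact mem_iUnion.2 ⟨k + 1, by simpa only [A, pow_succ] using Set.mul_mem_mul hk (Or.inl hy)⟩
  | mul_inv_cancel x _ y hy ih =>
    obtain ⟨k, hk⟩ := mem_iUnion.1 ih
    exact mem_iUnion.2 ⟨k + 1, by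
      simpa only [A, pow_succ] using Set.mul_mem_mul hk (Or.inr (inv_mem_inv.2 hy))⟩

/-- A first countable σ-compact topological group is second countable. -/
theorem secondCountableTopology_of_sigmaCompact (H : Type*) [Group H] [TopologicalSpace H]
    [IsTopologicalGroup H] [FirstCountableTopology H] [SigmaCompactSpace H] :
    SecondCountableTopology H := by
  let u := IsTopologicalGroup.rightUniformSpace H
  have : (uniformity H).IsCountablyGenerated := by
    change (comap _ _).IsCountablyGenerated
    infer_instance
  let d := UniformSpace.pseudoMetricSpace H
  exact EMetric.secondCountable_of_sigmaCompact H

/-- A compactly generated locally compact group has coarser second countable locally compact group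
topologies, in which a given neighborhood of the identity is still a neighborhood. They need not
be Hausdorff. -/
theorem exists_coarser_secondCountable {H : Type*} [Group H] [t₀ : TopologicalSpace H]
    [IsTopologicalGroup H] [LocallyCompactSpace H] (hH : IsCompactlyGeneratedGroup H) {V : Set H}
    (hV : V ∈ 𝓝 1) : ∃ t : TopologicalSpace H, t₀ ≤ t ∧ @IsTopologicalGroup H t _ ∧
      @LocallyCompactSpace H t ∧ @SecondCountableTopology H t ∧ V ∈ @nhds H t 1 := by
  have hσ := hH.sigmaCompactSpace
  obtain ⟨K, hK, hKt⟩ := hH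
  -- The sequence of neighborhoods that defines the topology is built step by step. Since `K`
  -- generates `H`, conjugations by `K` are enough to make the topology invariant.
  have step : ∀ U : {U : Set H // U ∈ 𝓝 1}, ∃ W : {U : Set H // U ∈ 𝓝 1}, (W : Set H) ⊆ U ∧
      (W : Set H) * W ⊆ U ∧ (∀ x ∈ (W : Set H), x⁻¹ ∈ (U : Set H)) ∧
      ∀ x ∈ (W : Set H), ∀ c ∈ K ∪ K⁻¹, c * x * c⁻¹ ∈ (U : Set H) := by
    rintro ⟨U, hU⟩
    obtain ⟨W₁, hW₁o, hW₁1, hW₁⟩ := exists_open_nhds_one_mul_subset hU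
    have hconj : ∀ᶠ x in 𝓝 (1 : H), ∀ c ∈ K ∪ K⁻¹, c * x * c⁻¹ ∈ U := by
      refine (hK.union hK.inv).eventually_forall_of_forall_eventually fun c _ => ?_
      have : Tendsto (fun p : H × H => p.2 * p.1 * p.2⁻¹) (𝓝 (1, c)) (𝓝 1) := by
        have := (show Continuous fun p : H × H => p.2 * p.1 * p.2⁻¹ by fun_prop).tendsto (1, c)
        simpa only [mul_one, mul_inv_cancel] using this
      exact this hU
    have hinv : ∀ᶠ x in 𝓝 (1 : H), x⁻¹ ∈ U := by
      have := continuous_inv.tendsto (1 : H)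
      rw [inv_one] at this
      exact this hU
    refine ⟨⟨U ∩ W₁ ∩ {x | x⁻¹ ∈ U} ∩ {x | ∀ c ∈ K ∪ K⁻¹, c * x * c⁻¹ ∈ U}, ?_⟩, ?_, ?_, ?_, ?_⟩
    · exact inter_mem (inter_mem (inter_mem hU (hW₁o.mem_nhds hW₁1)) hinv) hconj
    · exact fun x hx => hx.1.1.1
    · rintro _ ⟨x, hx, y, hy, rfl⟩
      exact hW₁ (Set.mul_mem_mul hx.1.1.2 hy.1.1.2)
    · exact fun x hx => hx.1.2
    · exact fun x hx => hx.2
  choose f hf₁ hf₂ hf₃ hf₄ using step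
  obtain ⟨V₀, hV₀, hV₀V, hV₀c⟩ := local_compact_nhds hV
  let v : ℕ → {U : Set H // U ∈ 𝓝 1} := fun k => f^[k] ⟨V₀, hV₀⟩
  have hv : ∀ k, v (k + 1) = f (v k) := fun k => Function.iterate_succ_apply' f k _
  have hanti : Antitone fun k => (v k : Set H) := antitone_nat_of_succ_le fun k => by
    rw [hv]
    exact hf₁ _
  let B : GroupFilterBasis H :=
    { sets := range fun k => (v k : Set H)
      nonempty := range_nonempty _
      inter_sets := by
        rintro _ _ ⟨i, rfl⟩ ⟨j, rfl⟩
        exact ⟨_, ⟨max i j, rfl⟩, subset_inter (hanti (le_max_left _ _)) (hanti (le_max_right _ _))⟩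
      one' := by
        rintro _ ⟨i, rfl⟩
        exact mem_of_mem_nhds (v i).2
      mul' := by
        rintro _ ⟨i, rfl⟩
        exact ⟨_, ⟨i + 1, rfl⟩, by simp only [hv]; exact hf₂ _⟩
      inv' := by
        rintro _ ⟨i, rfl⟩
        exact ⟨_, ⟨i + 1, rfl⟩, by simp only [hv]; exact hf₃ _⟩
      conj' := by
        intro x
        have hx : x ∈ Subgroup.closure K := hKt ▸ Subgroup.mem_top x
        have hstep : ∀ c ∈ K ∪ K⁻¹, ∀ i, (v (i + 1) : Set H) ⊆ (fun x => c * x * c⁻¹) ⁻¹' v i :=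
          fun c hc i x hx => by
            rw [hv] at hx
            exact hf₄ _ x hx c hc
        have hcomp : ∀ x y : H, (∀ i, ∃ j, (v j : Set H) ⊆ (fun z => x * z * x⁻¹) ⁻¹' v i) →
            y ∈ K ∪ K⁻¹ → ∀ i, ∃ j, (v j : Set H) ⊆ (fun z => (x * y) * z * (x * y)⁻¹) ⁻¹' v i := by
          intro x y hx hy i
          obtain ⟨j, hj⟩ := hx i
          refine ⟨j + 1, fun z hz => ?_⟩
          have := hj (hstep y hy j hz)
          simpa only [mem_preimage, mul_inv_rev, mul_assoc] using this
        have hall : ∀ i, ∃ j, (v j : Set H) ⊆ (fun z => x * z * x⁻¹) ⁻¹' v i := by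
          induction hx using Subgroup.closure_induction_right with
          | one => exact fun i => ⟨i, by simp⟩
          | mul_right x _ y hy ih => exact hcomp x y ih (Or.inl hy)
          | mul_inv_cancel x _ y hy ih => exact hcomp x y⁻¹ ih (Or.inr (inv_mem_inv.2 hy))
        rintro _ ⟨i, rfl⟩
        obtain ⟨j, hj⟩ := hall i
        exact ⟨_, ⟨j, rfl⟩, hj⟩ }
  have hle : t₀ ≤ B.topology := by
    refine le_of_nhds_le_nhds fun x => ?_
    refine (B.nhds_hasBasis x).ge_iff.2 ?_
    rintro _ ⟨i, rfl⟩
    have := (Homeomorph.mulLeft x).isOpenMap.image_mem_nhds (v i).2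
    simp only [Homeomorph.coe_mulLeft, mul_one] at this
    exact this
  have hbasis := B.nhds_one_hasBasis
  have hmem : ∀ i, (v i : Set H) ∈ @nhds H B.topology 1 := fun i => B.mem_nhds_one ⟨i, rfl⟩
  refine ⟨B.topology, hle, inferInstance, ?_, ?_, mem_of_superset (hmem 0) hV₀V⟩
  · let _ := B.topology
    have hc : IsCompact V₀ := isCompact_of_le hle hV₀c
    exact hc.locallyCompactSpace_of_mem_nhds_of_group (hmem 0)
  · have hσ' : @SigmaCompactSpace H B.topology := by
      obtain ⟨A, hA, hAt⟩ := SigmaCompactSpace_iff_exists_compact_covering.1 hσ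
      exact (@SigmaCompactSpace_iff_exists_compact_covering H B.topology).2
        ⟨A, fun n => isCompact_of_le hle (hA n), hAt⟩
    let _ := B.topology
    have hone : (𝓝 (1 : H)).IsCountablyGenerated := by
      refine HasCountableBasis.isCountablyGenerated (ι := Set H) (p := fun U => U ∈ B) (s := id)
        ⟨hbasis, ?_⟩
      exact countable_range _
    have : FirstCountableTopology H := ⟨fun x => by
      rw [← map_mul_left_nhds_one x]
      infer_instance⟩
    exact secondCountableTopology_of_sigmaCompact H

end Coarser

/-! ### Equivariant maps from a factor -/

section Factor

open MeasureTheory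

variable {n : ℕ} {G : Fin n → Type*} [∀ i, Group (G i)]

/-- The endomorphism of a product that replaces the `i`-th coordinate by `1`. -/
def eraseCoord (i : Fin n) : (∀ i, G i) →* (∀ i, G i) where
  toFun g := Function.update g i 1
  map_one' := Function.update_eq_self i 1
  map_mul' g h := by
    ext j
    rcases eq_or_ne j i with rfl | hj
    · simp
    · simp [hj]

/-- The endomorphism of a product that replaces all coordinates but the `i`-th by `1`. -/
def keepCoord (i : Fin n) : (∀ i, G i) →* (∀ i, G i) :=
  (MonoidHom.mulSingle G i).comp (Pi.evalMonoidHom G i)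

theorem eraseCoord_apply (i : Fin n) (g : ∀ i, G i) : eraseCoord i g = Function.update g i 1 := rfl

theorem keepCoord_apply (i : Fin n) (g : ∀ i, G i) : keepCoord i g = Pi.mulSingle i (g i) := rfl

theorem isProductDecomposition_coord (i : Fin n) :
    IsProductDecomposition (eraseCoord i : (∀ i, G i) →* (∀ i, G i)) (keepCoord i) where
  mul_eq g := by
    ext j
    rcases eq_or_ne j i with rfl | hj
    · simp [eraseCoord_apply, keepCoord_apply]
    · simp [eraseCoord_apply, keepCoord_apply, hj]
  commute g h := by
    ext j
    rcases eq_or_ne j i with rfl | hj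
    · simp [eraseCoord_apply, keepCoord_apply]
    · simp [eraseCoord_apply, keepCoord_apply, hj]
  idem g := by simp [eraseCoord_apply]

theorem eraseCoord_of_apply_eq_one {i : Fin n} {g : ∀ i, G i} (h : g i = 1) : eraseCoord i g = g := by
  rw [eraseCoord_apply, ← h, Function.update_eq_self]

variable [∀ i, TopologicalSpace (G i)]

theorem continuous_eraseCoord (i : Fin n) :
    Continuous (eraseCoord i : (∀ i, G i) →* (∀ i, G i)) :=
  continuous_id.update i continuous_const

theorem continuous_keepCoord (i : Fin n) :
    Continuous (keepCoord i : (∀ i, G i) →* (∀ i, G i)) :=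
  (continuous_mulSingle i).comp (continuous_apply i)

variable [∀ i, IsTopologicalGroup (G i)] [∀ i, LocallyCompactSpace (G i)]

/-- In the second countable case, either `Γ` has a fixed point in the target or there is a
continuous equivariant map from one of the factors. -/
theorem exists_fixed_point_or_factor_map [∀ i, SecondCountableTopology (G i)]
    {Γ : Subgroup (∀ i, G i)} (hirr : IsIrreducibleSubgroup Γ)
    {K V : Set (∀ i, G i)} (hK : IsCompact K) (hKΓ : ∀ x, ∃ γ : Γ, γ • x ∈ K) (hV : V ∈ 𝓝 1)
    (hVΓ : ∀ γ : Γ, ∀ v ∈ V, ∀ w ∈ V, (γ : ∀ i, G i) = v * w⁻¹ → γ = 1)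
    {X : Type*} [MetricSpace X] [CompleteSpace X] [Nonempty X] {m : X → X → X}
    (hm : IsUniformMidpoint m) {ρ : Γ →* (X ≃ᵢ X)}
    {S : Finset Γ} (hdisp : DisplacementTendsToInfinity ρ S)
    {Z : Type*} [MetricSpace Z] [CompleteSpace Z] {m' : Z → Z → Z}
    (hm' : IsUniformMidpoint m') {ρ' : Γ →* (Z ≃ᵢ Z)} (hred : IsReducedAction ρ')
    (hcl : ∀ T : Z ≃ᵢ Z, (∀ a b, dist a (T a) = dist b (T b)) → ∀ a, T a = a)
    {q : X → Z} (hq : LipschitzWith 1 q) (hqs : Function.Surjective q)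
    (hqρ : ∀ γ x, q (ρ γ x) = ρ' γ (q x)) (hqm : ∀ x y, m' (q x) (q y) = q (m x y)) :
    (∃ z, ∀ γ, ρ' γ z = z) ∨ ∃ (i : Fin n) (p : G i → Z), Continuous p ∧
      ∀ (γ : Γ) x, p ((γ : ∀ i, G i) i * x) = ρ' γ (p x) := by
  borelize (∀ i, G i)
  let μ : Measure (∀ i, G i) := Measure.haar
  obtain ⟨F, hF⟩ := exists_isCocompactDomain hK hKΓ hV hVΓ
  have := hF.countable
  have : μ.IsMulRightInvariant := hF.isMulRightInvariant μ
  obtain ⟨z₀⟩ := ‹Nonempty X›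
  obtain ⟨l, M, hl, hlin⟩ := hm.exists_linear_le_displacement hdisp z₀
  refine or_iff_not_imp_right.2 fun hno => ?_
  -- In the absence of an equivariant map from a factor, all factors have bounded orbits.
  have hbdd : ∀ i, ∃ R : ℝ, ∀ g, dist (EquivariantL2.base hF ρ' (q z₀) : EquivariantL2 ρ' (μ.restrict F))
      (EquivariantL2.translate hF (keepCoord i g) (EquivariantL2.base hF ρ' (q z₀))) ≤ R := by
    intro i
    have hdense : Dense {g : ∀ i, G i | ∃ γ : Γ, ∃ a, g = (γ : ∀ i, G i) * eraseCoord i a} := by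
      refine (hirr i).mono ?_
      rintro g ⟨γ, hγ, h, hh, rfl⟩
      exact ⟨⟨γ, hγ⟩, h, by rw [eraseCoord_of_apply_eq_one hh]⟩
    have hAB := isProductDecomposition_coord (G := G) i
    obtain ⟨D, hne, hDm, hDB, hD⟩ := EquivariantL2.exists_parallel_set (μ := μ) hF hm hm' hAB
      (continuous_eraseCoord i) (continuous_keepCoord i) hq hqs hqρ hqm S hl hlin
    rcases EquivariantL2.bounded_orbit_or_right_invariant hm' hAB (continuous_eraseCoord i)
      (continuous_keepCoord i) hdense hred hcl hne hDm hDB hD with ⟨φ, R, hR⟩ | ⟨φ, hA, hδ⟩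
    · refine ⟨_, fun g => (EquivariantL2.dist_translate_le hF _ _ φ).trans
        (add_le_add_right (hR g) _)⟩
    · obtain ⟨p, hpc, hpΓ, hpA⟩ := EquivariantL2.exists_continuous_equivariant φ
        (δ := fun g => (Real.sqrt (μ.real F))⁻¹ * dist φ (EquivariantL2.translate hF g φ))
        (continuous_const.mul (continuous_const.dist (EquivariantL2.continuous_translate φ)))
        (by rw [EquivariantL2.translate_one, dist_self, mul_zero]) hA hδ
      have hpB : ∀ x, p (keepCoord i x) = p x := fun x => by
        conv_rhs => rw [← hAB.mul_eq x, hAB.commute, hpA]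
      refine absurd ⟨i, fun x => p (Pi.mulSingle i x), hpc.comp (continuous_mulSingle i),
        fun γ x => ?_⟩ hno
      have h := hpΓ γ (Pi.mulSingle i x)
      rw [← hpB, keepCoord_apply] at h
      rw [← h]
      simp [Subgroup.smul_def]
  choose R hR using hbdd
  refine EquivariantL2.exists_fixed_point (R := ∑ i, R i) hF hm'
    (EquivariantL2.base hF ρ' (q z₀) : EquivariantL2 ρ' (μ.restrict F)) fun g => ?_
  -- Induction on the number of nontrivial coordinates.
  have hind : ∀ (s : Finset (Fin n)) (g : ∀ i, G i), (∀ i ∉ s, g i = 1) →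
      dist (EquivariantL2.base hF ρ' (q z₀) : EquivariantL2 ρ' (μ.restrict F))
        (EquivariantL2.translate hF g (EquivariantL2.base hF ρ' (q z₀))) ≤ ∑ i ∈ s, R i := by
    intro s
    induction s using Finset.induction_on with
    | empty =>
      intro g hg
      rw [show g = 1 from funext fun i => hg i (Finset.notMem_empty i), EquivariantL2.translate_one,
        dist_self, Finset.sum_empty]
    | insert i s his ih =>
      intro g hg
      have h₁ := ih (eraseCoord i g) fun j hj => by
        rw [eraseCoord_apply]
        rcases eq_or_ne j i with rfl | hji
        · simp
        · rw [Function.update_of_ne hji]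
          exact hg j (by simp [hj, hji])
      have h₂ := dist_triangle (EquivariantL2.base hF ρ' (q z₀) : EquivariantL2 ρ' (μ.restrict F))
        (EquivariantL2.translate hF (eraseCoord i g) (EquivariantL2.base hF ρ' (q z₀)))
        (EquivariantL2.translate hF (eraseCoord i g)
          (EquivariantL2.translate hF (keepCoord i g) (EquivariantL2.base hF ρ' (q z₀))))
      rw [(EquivariantL2.isometry_translate hF _).dist_eq, EquivariantL2.translate_translate,
        (isProductDecomposition_coord i).mul_eq] at h₂
      rw [Finset.sum_insert his]
      linarith [hR i g]
  exact hind Finset.univ g (by simp)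

/-- Cocompactness and discreteness of a uniform lattice without reference to the quotient space and
the subspace topology. In this form they persist in coarser topologies on the group for which the
set `V` is still a neighborhood of `1`. -/
theorem IsUniformLattice.exists_compact_nhds {H : Type*} [Group H] [TopologicalSpace H]
    [IsTopologicalGroup H] [LocallyCompactSpace H] {Γ : Subgroup H} (hΓ : IsUniformLattice Γ) :
    (∃ K : Set H, IsCompact K ∧ ∀ x, ∃ γ : Γ, γ • x ∈ K) ∧
      ∃ V ∈ 𝓝 (1 : H), ∀ γ : Γ, ∀ v ∈ V, ∀ w ∈ V, (γ : H) = v * w⁻¹ → γ = 1 := by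
  have := hΓ.discrete
  have := hΓ.cocompact
  constructor
  · obtain ⟨L, hL, hL1⟩ := exists_compact_mem_nhds (1 : H)
    have hcov : ∀ x : H, QuotientGroup.mk (s := Γ) '' ((fun y => x * y) '' L) ∈
        𝓝 (QuotientGroup.mk (s := Γ) x) := fun x => by
      refine (QuotientGroup.isOpenMap_coe (N := Γ)).image_mem_nhds ?_
      have := (Homeomorph.mulLeft x).isOpenMap.image_mem_nhds hL1
      simpa only [Homeomorph.coe_mulLeft, mul_one] using this
    obtain ⟨T, hT⟩ := CompactSpace.elim_nhds_subcover
      (fun y : H ⧸ Γ => QuotientGroup.mk (s := Γ) '' ((fun z => y.out * z) '' L)) fun y => by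
        have := hcov y.out
        rwa [QuotientGroup.out_eq'] at this
    refine ⟨(⋃ y ∈ T, (fun z => y.out * z) '' L)⁻¹, (T.finite_toSet.isCompact_biUnion fun y _ =>
      hL.image (continuous_const_mul _)).inv, fun x => ?_⟩
    have hx : (QuotientGroup.mk x⁻¹ : H ⧸ Γ) ∈ (⊤ : Set (H ⧸ Γ)) := mem_univ _
    rw [← hT] at hx
    obtain ⟨y, hy, w, hw, hwx⟩ := mem_iUnion₂.1 hx
    refine ⟨⟨_, QuotientGroup.eq.1 hwx⟩, mem_iUnion₂.2 ⟨y, hy, ?_⟩⟩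
    rwa [Subgroup.smul_def, smul_eq_mul, mul_inv_rev, mul_inv_rev, inv_inv, inv_inv,
      inv_mul_cancel_left]
  · obtain ⟨U, hU, hU1⟩ := (isOpen_discrete ({1} : Set Γ)) |>.mem_nhds rfl |> (mem_nhds_induced _ _ _).1
    have hlim : Tendsto (fun p : H × H => p.1 * p.2⁻¹) (𝓝 1 ×ˢ 𝓝 1) (𝓝 ((1 : Γ) : H)) := by
      have := (show Continuous fun p : H × H => p.1 * p.2⁻¹ by fun_prop).tendsto (1, 1)
      simpa only [nhds_prod_eq, inv_one, mul_one, OneMemClass.coe_one] using this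
    obtain ⟨V, hV, hVU⟩ := mem_prod_same_iff.1 (hlim hU)
    refine ⟨V, hV, fun γ v hv w hw h => ?_⟩
    refine hU1 (show (γ : H) ∈ U from ?_)
    rw [h]
    exact hVU (mk_mem_prod hv hw)

theorem pi_topology_mono {ι : Type*} {A : ι → Type*} {t₁ t₂ : ∀ i, TopologicalSpace (A i)}
    (h : ∀ i, t₁ i ≤ t₂ i) : @Pi.topologicalSpace _ _ t₁ ≤ @Pi.topologicalSpace _ _ t₂ :=
  iInf_mono fun i => induced_mono (h i)

theorem Dense.of_topology_le {A : Type*} {t₁ t₂ : TopologicalSpace A} {s : Set A}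
    (hs : @Dense A t₁ s) (h : t₁ ≤ t₂) : @Dense A t₂ s := fun x => closure.mono h (hs x)

/-- The alternative for arbitrary uniform lattices. It follows from the second countable case by
replacing the topologies of the factors by coarser second countable ones; a map that is continuous
for the coarser topology is continuous. -/
theorem exists_fixed_point_or_factor_map_of_isUniformLattice
    (hG : IsCompactlyGeneratedGroup (∀ i, G i))
    {Γ : Subgroup (∀ i, G i)} (hΓ : IsUniformLattice Γ) (hirr : IsIrreducibleSubgroup Γ)
    {X : Type*} [MetricSpace X] [CompleteSpace X] [Nonempty X] {m : X → X → X}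
    (hm : IsUniformMidpoint m) {ρ : Γ →* (X ≃ᵢ X)}
    {S : Finset Γ} (hdisp : DisplacementTendsToInfinity ρ S)
    {Z : Type*} [MetricSpace Z] [CompleteSpace Z] {m' : Z → Z → Z}
    (hm' : IsUniformMidpoint m') {ρ' : Γ →* (Z ≃ᵢ Z)} (hred : IsReducedAction ρ')
    (hcl : ∀ T : Z ≃ᵢ Z, (∀ a b, dist a (T a) = dist b (T b)) → ∀ a, T a = a)
    {q : X → Z} (hq : LipschitzWith 1 q) (hqs : Function.Surjective q)
    (hqρ : ∀ γ x, q (ρ γ x) = ρ' γ (q x)) (hqm : ∀ x y, m' (q x) (q y) = q (m x y)) :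
    (∃ z, ∀ γ, ρ' γ z = z) ∨ ∃ (i : Fin n) (p : G i → Z), Continuous p ∧
      ∀ (γ : Γ) x, p ((γ : ∀ i, G i) i * x) = ρ' γ (p x) := by
  obtain ⟨⟨K, hK, hKΓ⟩, V, hV, hVΓ⟩ := hΓ.exists_compact_nhds
  have hGi : ∀ i, IsCompactlyGeneratedGroup (G i) := fun i => by
    obtain ⟨L, hL, hLt⟩ := hG
    refine ⟨(fun g => g i) '' L, hL.image (continuous_apply i), ?_⟩
    have := (Pi.evalMonoidHom G i).map_closure L
    rw [hLt, ← MonoidHom.range_eq_map, MonoidHom.range_eq_top.2 (Function.surjective_eval i)] at this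
    exact this.symm
  obtain ⟨W, hW, hWV⟩ : ∃ W : ∀ i, Set (G i), (∀ i, W i ∈ 𝓝 1) ∧ Set.pi univ W ⊆ V := by
    rw [nhds_pi, Filter.mem_pi'] at hV
    obtain ⟨I, W, hW, hWV⟩ := hV
    exact ⟨W, hW, (Set.pi_mono' (fun _ _ => subset_rfl) (subset_univ _)).trans hWV⟩
  choose t hle htg htl hts htW using fun i => exists_coarser_secondCountable (hGi i) (hW i)
  have hle' := pi_topology_mono hle
  have hcon := @exists_fixed_point_or_factor_map n G _ t htg htl hts Γ
    (fun i => (hirr i).of_topology_le hle') K V (isCompact_of_le hle' hK) hKΓ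
    (mem_of_superset (@set_pi_mem_nhds _ _ t _ _ _ finite_univ fun i _ => htW i) hWV) hVΓ X _ _ _ m hm ρ S
    hdisp Z _ _ m' hm' ρ' hred hcl q hq hqs hqρ hqm
  refine hcon.imp id fun ⟨i, p, hp, hpΓ⟩ => ⟨i, p, ?_, hpΓ⟩
  exact continuous_le_dom (hle i) hp

end Factor

/-! ### Extension of the action -/

section Extension

variable {Γ : Type*} [Group Γ] {Z : Type*} [MetricSpace Z] [CompleteSpace Z] {m : Z → Z → Z}
  {ρ : Γ →* (Z ≃ᵢ Z)}

/-- For a reduced action without fixed points, an invariant closed convex set is everything: if it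
were bounded, its circumcenter would be fixed. -/
theorem IsReducedAction.eq_univ (hred : IsReducedAction ρ) (hm : IsUniformMidpoint m)
    (hfix : ∀ z, ∃ γ, ρ γ z ≠ z) {C : Set Z} (hne : C.Nonempty) (hcl : IsClosed C)
    (hmid : MidClosed m C) (hinv : ∀ γ, ∀ z ∈ C, ρ γ z ∈ C) : C = univ := by
  have himg : ∀ γ, ρ γ '' C = C := fun γ => by
    refine subset_antisymm (image_subset_iff.2 (hinv γ)) fun z hz => ⟨ρ γ⁻¹ z, hinv _ _ hz, ?_⟩
    rw [map_inv, IsometryEquiv.apply_inv_self]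
  by_contra hC
  by_cases hb : Bornology.IsBounded C
  · obtain ⟨z, hz⟩ := hm.exists_circumcenter hne hb
    obtain ⟨γ, hγ⟩ := hfix z
    exact hγ (dist_eq_zero.1 (hz _ (ρ γ).isometry (himg γ).ge))
  · refine hred ⟨C, hb, hcl, hm.geodesicallyConvex hcl hmid, hC, fun γ => ?_⟩
    rw [himg, Metric.hausdorffEDist_self]
    exact ENNReal.zero_ne_top

variable {H : Type*} [Group H] [TopologicalSpace H] [IsTopologicalGroup H] {i : Γ →* H}

/-- A continuous map that is equivariant along a homomorphism `i`. -/
structure IsEquivariantMap (ρ : Γ →* (Z ≃ᵢ Z)) (i : Γ →* H) (p : H → Z) : Prop where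
  continuous : Continuous p
  map_mul : ∀ γ x, p (i γ * x) = ρ γ (p x)

namespace IsEquivariantMap

variable {p q : H → Z}

/-- Equivariant maps are at constant distance, because the image of `Γ` is dense. -/
theorem dist_eq (hi : DenseRange i) (hp : IsEquivariantMap ρ i p) (hq : IsEquivariantMap ρ i q)
    (x y : H) : dist (p x) (q x) = dist (p y) (q y) := by
  have h : ∀ x, dist (p x) (q x) = dist (p 1) (q 1) := fun x =>
    hi.induction_on (p := fun x => dist (p x) (q x) = dist (p 1) (q 1)) x
      (isClosed_eq (hp.continuous.dist hq.continuous) continuous_const) fun γ => by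
        rw [← mul_one (i γ), hp.map_mul, hq.map_mul, IsometryEquiv.dist_eq]
  rw [h x, h y]

theorem eq_of_apply_one (hi : DenseRange i) (hp : IsEquivariantMap ρ i p)
    (hq : IsEquivariantMap ρ i q) (h : p 1 = q 1) : p = q := by
  funext x
  rw [← dist_eq_zero, dist_eq hi hp hq x 1, h, dist_self]

theorem comp_mul_right (hp : IsEquivariantMap ρ i p) (h : H) :
    IsEquivariantMap ρ i fun x => p (x * h) :=
  ⟨hp.continuous.comp (continuous_mul_const h), fun γ x => by rw [mul_assoc, hp.map_mul]⟩

/-- The values at `1` of the equivariant maps form a closed set. -/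
theorem isClosed_values (hi : DenseRange i) :
    IsClosed {z | ∃ p : H → Z, IsEquivariantMap ρ i p ∧ p 1 = z} := by
  refine isClosed_of_closure_subset fun z hz => ?_
  obtain ⟨u, hu, hlim⟩ := mem_closure_iff_seq_limit.1 hz
  choose p hp hp1 using hu
  have hd : ∀ k l x, dist (p k x) (p l x) = dist (u k) (u l) := fun k l x => by
    rw [dist_eq hi (hp k) (hp l) x 1, hp1, hp1]
  have hcau : ∀ x, CauchySeq fun k => p k x := fun x => Metric.cauchySeq_iff.2 fun ε hε => by
    simpa only [hd] using Metric.cauchySeq_iff.1 hlim.cauchySeq ε hε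
  choose q hq using fun x => cauchySeq_tendsto_of_complete (hcau x)
  have hdq : ∀ k x, dist (p k x) (q x) = dist (u k) z := fun k x =>
    tendsto_nhds_unique (tendsto_const_nhds.dist (hq x)) (by
      simpa only [hd] using tendsto_const_nhds.dist hlim)
  have hunif : TendstoUniformly p q atTop := Metric.tendstoUniformly_iff.2 fun ε hε => by
    filter_upwards [(tendsto_iff_dist_tendsto_zero.1 hlim).eventually (gt_mem_nhds hε)] with k hk x
    rwa [dist_comm, hdq]
  refine ⟨q, ⟨hunif.continuous (Frequently.of_forall fun k => (hp k).continuous), fun γ x => ?_⟩, ?_⟩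
  · refine tendsto_nhds_unique (hq _) ?_
    simpa only [(hp _).map_mul, Function.comp_def] using ((ρ γ).continuous.tendsto _).comp (hq x)
  · exact tendsto_nhds_unique (hq 1) (by simpa only [hp1] using hlim)

/-- If there is an equivariant map at all, then every point of `Z` is the value at `1` of one. -/
theorem exists_apply_one (hi : DenseRange i) (hred : IsReducedAction ρ) (hm : IsUniformMidpoint m)
    (hfix : ∀ z, ∃ γ, ρ γ z ≠ z) (hp : IsEquivariantMap ρ i p) (z : Z) :
    ∃ q : H → Z, IsEquivariantMap ρ i q ∧ q 1 = z := by
  have h := hred.eq_univ hm hfix (C := {z | ∃ p : H → Z, IsEquivariantMap ρ i p ∧ p 1 = z})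
    ⟨_, p, hp, rfl⟩ (isClosed_values hi) (by
      rintro _ ⟨q, hq, rfl⟩ _ ⟨r, hr, rfl⟩
      refine ⟨fun x => m (q x) (r x), ⟨hm.continuous.comp (hq.continuous.prodMk hr.continuous),
        fun γ x => ?_⟩, rfl⟩
      rw [hq.map_mul, hr.map_mul, hm.map_mid (ρ γ).isometry]) (by
      rintro γ _ ⟨q, hq, rfl⟩
      exact ⟨_, hq.comp_mul_right (i γ), by rw [one_mul, ← hq.map_mul, mul_one]⟩)
  exact h.ge (mem_univ z)

/-- If there is an equivariant map, the action extends to `H`: the orbit map of `z` is the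
equivariant map with value `z` at `1`. -/
theorem exists_extension (hi : DenseRange i) (hred : IsReducedAction ρ) (hm : IsUniformMidpoint m)
    (hfix : ∀ z, ∃ γ, ρ γ z ≠ z) (hp : IsEquivariantMap ρ i p) :
    ∃ β : H →* (Z ≃ᵢ Z), IsContinuousAction β ∧ ∀ γ, β (i γ) = ρ γ := by
  choose q hq hq1 using hp.exists_apply_one hi hred hm hfix
  have hmul : ∀ h k z, q z (h * k) = q (q z k) h := fun h k z =>
    congr_fun (eq_of_apply_one hi ((hq z).comp_mul_right k) (hq (q z k)) (by rw [one_mul, hq1])) h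
  have hdist : ∀ h z w, dist (q z h) (q w h) = dist z w := fun h z w => by
    rw [dist_eq hi (hq z) (hq w) h 1, hq1, hq1]
  let β : H →* (Z ≃ᵢ Z) :=
    { toFun := fun h =>
        { toFun := fun z => q z h
          invFun := fun z => q z h⁻¹
          left_inv := fun z => by beta_reduce; rw [← hmul, inv_mul_cancel, hq1]
          right_inv := fun z => by beta_reduce; rw [← hmul, mul_inv_cancel, hq1]
          isometry_toFun := Isometry.of_dist_eq fun z w => hdist h z w }
      map_one' := IsometryEquiv.ext fun z => hq1 z
      map_mul' := fun h k => IsometryEquiv.ext fun z => hmul h k z }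
  have hβ : ∀ h z, β h z = q z h := fun _ _ => rfl
  refine ⟨β, ?_, fun γ => IsometryEquiv.ext fun z => ?_⟩
  · refine continuous_iff_continuousAt.2 fun ⟨h₀, z₀⟩ => ?_
    refine tendsto_iff_dist_tendsto_zero.2 (squeeze_zero (g := fun x : H × Z =>
      dist x.2 z₀ + dist (q z₀ x.1) (q z₀ h₀)) (fun _ => dist_nonneg) (fun x => ?_) ?_)
    · beta_reduce
      rw [hβ, hβ, ← hdist x.1 x.2 z₀]
      exact dist_triangle _ _ _
    · have hc : Continuous fun x : H × Z => dist x.2 z₀ + dist (q z₀ x.1) (q z₀ h₀) :=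
        (continuous_snd.dist continuous_const).add
          (((hq z₀).continuous.comp continuous_fst).dist continuous_const)
      simpa only [dist_self, add_zero] using hc.tendsto (h₀, z₀)
  · rw [hβ, ← mul_one (i γ), (hq z).map_mul, hq1]

end IsEquivariantMap

/-- **Uniqueness** of continuous extensions of `ρ`, if `α` is one that is trivial on a normal subgroup
`N` with `Γ * N` dense. The fixed points of `N` under another extension `α'` form an invariant closed
convex set, and hence everything; it is nonempty because the orbits of `N` are bounded. -/
theorem eq_of_isContinuousAction [Nonempty Z] {Γ : Subgroup H} {ρ : Γ →* (Z ≃ᵢ Z)} (hred : IsReducedAction ρ)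
    (hm : IsUniformMidpoint m) (hfix : ∀ z, ∃ γ, ρ γ z ≠ z) {K : Set H} (hK : IsCompact K)
    (hKΓ : ∀ x, ∃ γ : Γ, γ • x ∈ K) (N : Subgroup H) [N.Normal]
    (hN : Dense {g : H | ∃ γ ∈ Γ, ∃ h ∈ N, g = γ * h})
    {α α' : H →* (Z ≃ᵢ Z)} (hα : IsContinuousAction α) (hα' : IsContinuousAction α')
    (hαΓ : ∀ γ : Γ, α γ = ρ γ) (hα'Γ : ∀ γ : Γ, α' γ = ρ γ) (hαN : ∀ g ∈ N, α g = 1) : α' = α := by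
  have horb : ∀ {α : H →* (Z ≃ᵢ Z)}, IsContinuousAction α → ∀ z, Continuous fun g => α g z :=
    fun hα z => hα.comp (continuous_id.prodMk continuous_const)
  have htriv : {z | ∀ g ∈ N, α' g z = z} = univ := by
    refine hred.eq_univ hm hfix ?_ ?_ ?_ ?_
    · -- The orbits of `N` are bounded, since modulo `Γ` the group `N` lies in a compact set.
      obtain ⟨z₀⟩ := ‹Nonempty Z›
      obtain ⟨R, hR⟩ := (hK.image ((horb hα' z₀).dist (horb hα z₀))).bddAbove
      have hbdd : ∀ g ∈ N, dist (α' g z₀) z₀ ≤ R := by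
        intro g hg
        obtain ⟨γ, hγ⟩ := hKΓ g
        rw [Subgroup.smul_def, smul_eq_mul] at hγ
        have h := hR ⟨_, hγ, rfl⟩
        simpa only [map_mul, hαN g hg, mul_one, hα'Γ, hαΓ, IsometryEquiv.mul_apply,
          IsometryEquiv.dist_eq] using h
      obtain ⟨z, hz⟩ := hm.exists_circumcenter (S := (fun g => α' g z₀) '' N)
        ⟨_, 1, one_mem N, rfl⟩ (Metric.isBounded_closedBall.subset (by
          rintro _ ⟨g, hg, rfl⟩
          exact Metric.mem_closedBall.2 (hbdd g hg)))
      refine ⟨z, fun g hg => dist_eq_zero.1 (hz _ (α' g).isometry ?_)⟩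
      rintro _ ⟨h, hh, rfl⟩
      refine ⟨_, ⟨g⁻¹ * h, mul_mem (inv_mem hg) hh, rfl⟩, ?_⟩
      rw [← IsometryEquiv.mul_apply, ← map_mul, mul_inv_cancel_left]
    · simp only [ofPred_forall]
      exact isClosed_biInter fun g _ => isClosed_eq (α' g).continuous continuous_id
    · intro a ha b hb g hg
      rw [hm.map_mid (α' g).isometry, ha g hg, hb g hg]
    · intro γ z hz g hg
      have h : α' g * α' γ = α' γ * α' ((γ : H)⁻¹ * g * γ) := by
        rw [← map_mul, ← map_mul]
        group
      have hconj : (γ : H)⁻¹ * g * γ ∈ N := by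
        simpa using ‹N.Normal›.conj_mem g hg (γ : H)⁻¹
      rw [← hα'Γ, ← IsometryEquiv.mul_apply, h, IsometryEquiv.mul_apply, hz _ hconj]
  refine MonoidHom.ext fun g => IsometryEquiv.ext fun z => ?_
  refine congr_fun (Continuous.ext_on hN (horb hα' z) (horb hα z) ?_) g
  rintro _ ⟨γ, hγ, h, hh, rfl⟩
  have h₁ : α' h z = z := htriv.ge (mem_univ z) h hh
  simp only [map_mul, IsometryEquiv.mul_apply, h₁, hαN h hh]
  rw [hα'Γ ⟨γ, hγ⟩, hαΓ ⟨γ, hγ⟩]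
  rfl

end Extension

end

theorem mainTheorem8
    {n : ℕ} (hn : 1 < n)
    {G : Fin n → Type*} [∀ i, Group (G i)] [∀ i, TopologicalSpace (G i)]
    [∀ i, IsTopologicalGroup (G i)] [∀ i, T2Space (G i)] [∀ i, LocallyCompactSpace (G i)]
    (hG : IsCompactlyGeneratedGroup (∀ i, G i))
    (Γ : Subgroup (∀ i, G i)) (hΓ : IsUniformLattice Γ) (hirr : IsIrreducibleSubgroup Γ)
    {X : Type*} [MetricSpace X] [CompleteSpace X] (hX : IsBNPC X) (hUC : IsUniformlyConvex X)
    (hCL : CliffordFormGroup X)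
    (ρ : Γ →* (X ≃ᵢ X))
    (S : Finset Γ) (hS : Subgroup.closure (S : Set Γ) = ⊤)
    (hdisp : DisplacementTendsToInfinity ρ S)
    (hred : IsReducedAction (CliffordQuotient.inducedIsometry.comp ρ))
    (hfix : Subsingleton (CliffordQuotient X) ∨
      ∀ y : CliffordQuotient X, ∃ γ : Γ, CliffordQuotient.inducedIsometry (ρ γ) y ≠ y) :
    ∃ α : (∀ i, G i) →* (CliffordQuotient X ≃ᵢ CliffordQuotient X),
      IsContinuousAction α ∧
      (∀ γ : Γ, α γ = CliffordQuotient.inducedIsometry (ρ γ)) ∧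
      (∃ (i : Fin n) (β : G i →* (CliffordQuotient X ≃ᵢ CliffordQuotient X)),
        IsContinuousAction β ∧ α = β.comp (Pi.evalMonoidHom G i)) ∧
      ∀ α' : (∀ i, G i) →* (CliffordQuotient X ≃ᵢ CliffordQuotient X),
        IsContinuousAction α' →
        (∀ γ : Γ, α' γ = CliffordQuotient.inducedIsometry (ρ γ)) → α' = α := by
  by_cases hsub : Subsingleton (CliffordQuotient X)
  · have htriv : ∀ f g : CliffordQuotient X ≃ᵢ CliffordQuotient X, f = g := fun f g =>
      IsometryEquiv.ext fun z => Subsingleton.elim _ _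
    exact ⟨1, continuous_snd, fun γ => htriv _ _, ⟨⟨0, by lia⟩, 1, continuous_snd, rfl⟩,
      fun α' _ _ => MonoidHom.ext fun g => htriv _ _⟩
  replace hfix := hfix.resolve_left hsub
  have hne' : Nonempty (CliffordQuotient X) := (not_subsingleton_iff_nontrivial.1 hsub).to_nonempty
  have hne : Nonempty X := ⟨(CliffordQuotient.mk_surjective hne'.some).choose⟩
  obtain ⟨m, hm⟩ := hX.exists_isUniformMidpoint hUC
  let := CliffordQuotient.metricSpace hCL hm
  have hm' := CliffordQuotient.isUniformMidpoint_mid hCL hm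
  have := CliffordQuotient.completeSpace (X := X)
  have hdense : ∀ i, Dense {g : ∀ i, G i | ∃ γ ∈ Γ, ∃ h ∈ (Pi.evalMonoidHom G i).ker, g = γ * h} := hirr
  obtain ⟨⟨K, hK, hKΓ⟩, -⟩ := hΓ.exists_compact_nhds
  rcases exists_fixed_point_or_factor_map_of_isUniformLattice hG hΓ hirr hm hdisp hm' hred
    (CliffordQuotient.eq_self_of_isometry_of_dist_const hCL hm)
    (LipschitzWith.of_dist_le_mul fun x y => by
      simpa using CliffordQuotient.dist_mk_le x y) CliffordQuotient.mk_surjective (fun γ x => rfl)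
    (CliffordQuotient.mid_mk hCL hm) with ⟨z, hz⟩ | ⟨i, p, hp, hpΓ⟩
  · obtain ⟨γ, hγ⟩ := hfix z
    exact absurd (hz γ) hγ
  -- The projection of `Γ` to the factor is dense, by irreducibility.
  let ι : Γ →* G i := (Pi.evalMonoidHom G i).comp Γ.subtype
  have hι : DenseRange ι := by
    have h := (Function.surjective_eval i).denseRange.dense_image (continuous_apply i) (hdense i)
    refine h.mono ?_
    rintro _ ⟨_, ⟨γ, hγ, h, hh, rfl⟩, rfl⟩
    have hh' : h i = 1 := hh
    exact ⟨⟨γ, hγ⟩, by simp [ι, hh']⟩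
  obtain ⟨β, hβ, hβΓ⟩ := IsEquivariantMap.exists_extension hι hred hm' hfix
    (p := p) ⟨hp, fun γ x => hpΓ γ x⟩
  have hα : IsContinuousAction (β.comp (Pi.evalMonoidHom G i)) :=
    hβ.comp (((continuous_apply i).comp continuous_fst).prodMk continuous_snd)
  refine ⟨β.comp (Pi.evalMonoidHom G i), hα, hβΓ, ⟨i, β, hβ, rfl⟩, fun α' hα' hα'Γ => ?_⟩
  refine eq_of_isContinuousAction hred hm' hfix hK hKΓ _ (hdense i) hα hα' hβΓ hα'Γ ?_
  intro g hg
  have hg' : g i = 1 := hg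
  simp [hg']
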